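/- A level line of $\zeta$ is a curve in the upper half-plane along which $\zeta$ is real (thick line) or along which $\zeta$ is purely imaginary (thin line). A line is always followed so that $|\zeta|$ is strictly monotone along it, in particular only up to a zero of $\zeta$, where lines join. The lines are numbered as follows. For $n\ge 2$, line $-2n$ is the thin line which cuts the real axis at the trivial zero $-2n$, and line $-(2n+1)$ is the thick line which cuts the real axis between $-2n-2$ and $-2n$. For $k\ge 1$, line $-4+k$ is the $k$-th line (thick or thin) above line $-4$ in the order in which the lines cross the vertical line $\operatorname{Re} s=-30$. Hence even lines are thin and odd lines are thick. Theorem. Let $t>5$ be such that $\zeta(-1+it)$ is real or purely imaginary. Then $-1+it$ lies on a numbered line, and the number of any numbered line passing through $-1+it$ is the unique integer nearest to $$\frac{2t}{\pi}\log\frac{t}{2\pi}-\frac{2t}{\pi}+\frac12 .$$ -/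

import Mathlib

/-- The points above the real axis which carry level lines of the parity of `n`: thin lines
(`ζ` purely imaginary) for even `n`, thick lines (`ζ` real) for odd `n`. -/
def ZetaLine.levelSet (n : ℤ) : Set ℂ :=
  {s | 0 < s.im ∧ (if Even n then (riemannZeta s).re = 0 else (riemannZeta s).im = 0)}

/-- `ZetaLine.Arc n a b`: there is an arc of a level line (of the parity of `n`) running from `a`
to `b` and lying above the real axis, except that `a` itself may be real. It is followed in the
direction in which `|ζ|` increases strictly: `ζ` is monotone along level lines, and `|ζ|` tends
to infinity along them on the left. Consequently an arc never runs through a zero of `ζ`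
(where two lines join); zeros can only be its initial point. -/
def ZetaLine.Arc (n : ℤ) (a b : ℂ) : Prop :=
  ∃ γ : Path a b,
    (∀ τ : unitInterval, 0 < τ → γ τ ∈ ZetaLine.levelSet n) ∧
    StrictMono (fun τ : unitInterval => ‖riemannZeta (γ τ)‖)

/-- The place where a line numbered `n ≤ -4` cuts the real axis: the trivial zero `n` if `n` is
even, some point strictly between the trivial zeros `n - 1` and `n + 1` if `n` is odd. -/
def ZetaLine.IsFoot (n : ℤ) (x : ℝ) : Prop :=
  if Even n then x = n else (n : ℝ) - 1 < x ∧ x < (n : ℝ) + 1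

/-- For `n ≤ -4`: the point `s` of the upper half-plane lies on the line which cuts the real axis
at the trivial zero `n` (`n` even), resp. between `n - 1` and `n + 1` (`n` odd). -/
def ZetaLine.OnLowLine (n : ℤ) (s : ℂ) : Prop :=
  s ∈ ZetaLine.levelSet n ∧ ∃ x : ℝ, ZetaLine.IsFoot n x ∧ ZetaLine.Arc n (x : ℂ) s

/-- The point at height `y` on the left border `Re s = -30`. -/
def ZetaLine.border (y : ℝ) : ℂ := ⟨-30, y⟩

/-- The heights `v` with `y₀ < v ≤ y` at which some level line, thin or thick, crosses the left
border `Re s = -30`. -/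
def ZetaLine.crossings (y₀ y : ℝ) : Set ℝ :=
  {v | y₀ < v ∧ v ≤ y ∧
    ((riemannZeta (ZetaLine.border v)).re = 0 ∨ (riemannZeta (ZetaLine.border v)).im = 0)}

/-- For `n ≥ -3`: the point `s` of the upper half-plane lies on the line that crosses the left
border as the `(n + 4)`-th line above line `-4`. -/
def ZetaLine.OnHighLine (n : ℤ) (s : ℂ) : Prop :=
  s ∈ ZetaLine.levelSet n ∧ ∃ y₀ y : ℝ,
    ZetaLine.OnLowLine (-4) (ZetaLine.border y₀) ∧ y₀ < y ∧
    ((ZetaLine.crossings y₀ y).ncard : ℤ) = n + 4 ∧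
    (s = ZetaLine.border y ∨ ZetaLine.Arc n s (ZetaLine.border y) ∨
      ZetaLine.Arc n (ZetaLine.border y) s)

/-- The point `s` of the upper half-plane lies on the level line of `ζ` numbered `n`. -/
def ZetaLine.OnLine (n : ℤ) (s : ℂ) : Prop :=
  (n ≤ -4 ∧ ZetaLine.OnLowLine n s) ∨ (-3 ≤ n ∧ ZetaLine.OnHighLine n s)

/-! Put z = 1 - s. In the quadrant Re z > 1, Im z < 0 the functional equation writes ζ(1 - z) as a
positive constant times exp L(z), L = `logZetaOneSub`. The three logarithms in L come from
Stirling's series for Γ, from the Dirichlet series of log ζ, and from 2 cos(πz/2) = exp(iπz/2)(1 +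
exp(-iπz)), whose second factor has positive real part. So N = 1 - (2/π) Im L (`lineNumber`) is
continuous, and its even and odd integer values mark exactly the thin and the thick lines
(`one_sub_mem_levelSet_iff`). At z = 2 - it, Stirling's formula turns N into the function of the
theorem, with an error (2/π)(c + E + g): c is elementary, E is Stirling's remainder and g = Im log
ζ(2 - it). The bound |c + E + g| < π/4 gives `abs_lineNumber_two_sub_lt`.

It remains to identify N with the number defined by curves. Two sign conditions on L' control the
lines. For Re z ≥ 2 and height at least 9, Re L' > 0 (`logZetaOneSubDeriv_re_pos`): N increases with
the height, each line is a graph over the abscissa, and |ζ| grows to the left along it. For Re z ≥ 3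
and height at most 9, Im L' > 0 (`logZetaOneSubDeriv_im_pos`): lines are graphs over the height, and
|ζ| grows upwards.

Hence the line from the trivial zero -4 rises to height 9 and then runs left to the border, with N =
-4 throughout (`exists_onLowLine_border`). Above it, N increases along the border, so counting
crossings computes N + 4 (`ncard_crossings`). A point -1 + it on a level line has N > -4, and 5 < t
≤ 9 would force -4 < N < -3; so t > 9, and the graph through the point reaches the border
(`exists_arc_border`).

Conversely, an arbitrary arc that starts high up with N ≥ -3 keeps N and runs left
(`Arc.lineNumber_eq_of_nine_le`). A line with foot n ≤ -4 has N = n, and therefore cannot reach Re s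
= -1, where N > -4 (`OnLowLine.re_lt_and_lineNumber_eq`). So the point carries no number other than
N. -/

namespace ZetaLine

open Filter Topology

/-! ### A logarithm of Γ from Stirling's series -/

lemma log_mul_of_re_pos {a b : ℂ} (ha : 0 < a.re) (hb : 0 < b.re) :
    Complex.log (a * b) = Complex.log a + Complex.log b := by
  have h1 := Complex.abs_arg_lt_pi_div_two_iff.2 (Or.inl ha)
  have h2 := Complex.abs_arg_lt_pi_div_two_iff.2 (Or.inl hb)
  rw [abs_lt] at h1 h2
  refine Complex.log_mul ?_ ?_ ⟨by linarith [h1.1, h2.1], by linarith [h1.2, h2.2]⟩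
  · rintro rfl; simp at ha
  · rintro rfl; simp at hb

/-- With w = h/a the difference is log(1 + w) - log(1 - w). The quadratic Taylor terms cancel, so
the error is cubic in w. -/
lemma norm_log_add_sub_log_sub_sub_le {a : ℂ} {h : ℝ} (hh : 0 < h) (ha : h < a.re) :
    ‖Complex.log (a + h) - Complex.log (a - h) - 2 * h / a‖ ≤
      2 / 3 * (h / ‖a‖) ^ 3 / (1 - h / ‖a‖) := by
  have ha0 : 0 < a.re := hh.trans ha
  have hane : a ≠ 0 := by rintro rfl; simp at ha0
  have hnorm : 0 < ‖a‖ := norm_pos_iff.2 hane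
  set w : ℂ := h / a with hw
  have hwn : ‖w‖ = h / ‖a‖ := by
    rw [hw, norm_div, Complex.norm_real, Real.norm_of_nonneg hh.le]
  have hw1 : ‖w‖ < 1 := by
    rw [hwn, div_lt_one hnorm]
    exact ha.trans_le (Complex.re_le_norm a)
  have hre : |w.re| < 1 := (Complex.abs_re_le_norm w).trans_lt hw1
  rw [abs_lt] at hre
  have e1 : a + h = a * (1 + w) := by rw [hw]; field_simp
  have e2 : a - h = a * (1 - w) := by rw [hw]; field_simp
  have l1 := log_mul_of_re_pos (a := a) (b := 1 + w) ha0 (by simp; linarith)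
  have l2 := log_mul_of_re_pos (a := a) (b := 1 - w) ha0 (by simp; linarith)
  have t1 := Complex.norm_log_sub_logTaylor_le 2 hw1
  have t2 := Complex.norm_log_sub_logTaylor_le 2 (z := -w) (by simpa using hw1)
  have e3 : 2 * (h : ℂ) / a = 2 * w := by rw [hw]; ring
  rw [e1, e2, l1, l2, e3]
  simp only [Complex.logTaylor, Finset.sum_range_succ, Finset.sum_range_zero] at t1 t2
  rw [norm_neg] at t2
  rw [← hwn]
  have key : Complex.log a + Complex.log (1 + w) - (Complex.log a + Complex.log (1 - w)) - 2 * w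
      = (Complex.log (1 + w) - (0 + (-1) ^ (0 + 1) * w ^ 0 / ((0 : ℕ) : ℂ)
          + (-1) ^ (1 + 1) * w ^ 1 / ((1 : ℕ) : ℂ) + (-1) ^ (2 + 1) * w ^ 2 / ((2 : ℕ) : ℂ)))
        - (Complex.log (1 + -w) - (0 + (-1) ^ (0 + 1) * (-w) ^ 0 / ((0 : ℕ) : ℂ)
          + (-1) ^ (1 + 1) * (-w) ^ 1 / ((1 : ℕ) : ℂ)
          + (-1) ^ (2 + 1) * (-w) ^ 2 / ((2 : ℕ) : ℂ))) := by
    rw [sub_eq_add_neg (1 : ℂ) w]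
    push_cast
    simp
    ring
  rw [key]
  refine (norm_sub_le _ _).trans ((add_le_add t1 t2).trans (le_of_eq ?_))
  have : 1 - ‖w‖ ≠ 0 := by linarith
  push_cast
  field_simp
  ring

/-- The `k = 0` term of the series for the remainder in Stirling's formula for `log Γ`. -/
noncomputable def stirlingTerm (z : ℂ) : ℂ :=
  (z + 1 / 2) * (Complex.log (z + 1) - Complex.log z) - 1

/-- Centring at a = z + 1/2 makes the term a times the cubic error with h = 1/2, at most
1/(6|a|(2|a| - 1)). The factor (2r + 1)/(2r) bounds 2|a|/(2|a| - 1). -/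
lemma norm_stirlingTerm_le {r : ℝ} (hr : 1 ≤ r) {z : ℂ} (hz : r ≤ z.re) :
    ‖stirlingTerm z‖ ≤ (2 * r + 1) / (24 * r) / ((z.re + 1 / 2) ^ 2) := by
  set a : ℂ := z + 1 / 2 with ha
  have hare : a.re = z.re + 1 / 2 := by simp [ha]
  have hle : z.re + 1 / 2 ≤ ‖a‖ := hare ▸ Complex.re_le_norm a
  have hane : a ≠ 0 := by intro h; rw [h] at hle; simp at hle; linarith
  have hb := norm_log_add_sub_log_sub_sub_le (a := a) (h := 1 / 2) (by norm_num)
    (by rw [hare]; linarith)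
  have e1 : a + ((1 / 2 : ℝ) : ℂ) = z + 1 := by rw [ha]; push_cast; ring
  have e2 : a - ((1 / 2 : ℝ) : ℂ) = z := by rw [ha]; push_cast; ring
  rw [e1, e2] at hb
  have e3 : stirlingTerm z =
      a * (Complex.log (z + 1) - Complex.log z - 2 * ((1 / 2 : ℝ) : ℂ) / a) := by
    rw [stirlingTerm, ← ha]; push_cast; field_simp
  have hapos : 0 < ‖a‖ := by linarith
  have h1 : 0 < 1 - 1 / 2 / ‖a‖ := by
    rw [sub_pos, div_lt_one hapos]; linarith
  rw [e3, norm_mul]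
  calc ‖a‖ * _ ≤ ‖a‖ * (2 / 3 * (1 / 2 / ‖a‖) ^ 3 / (1 - 1 / 2 / ‖a‖)) := by gcongr
    _ = 1 / (6 * ‖a‖ * (2 * ‖a‖ - 1)) := by
        have : 2 * ‖a‖ - 1 ≠ 0 := by linarith
        have h2 : 1 - 1 / 2 / ‖a‖ = (2 * ‖a‖ - 1) / (2 * ‖a‖) := by field_simp
        rw [h2]; field_simp; norm_num
    _ ≤ 1 / (6 * (z.re + 1 / 2) * (2 * (z.re + 1 / 2) - 1)) := by
        apply one_div_le_one_div_of_le
        · have : 0 < 2 * (z.re + 1 / 2) - 1 := by linarith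
          have : 0 < z.re + 1 / 2 := by linarith
          positivity
        · have : 0 ≤ 2 * (z.re + 1 / 2) - 1 := by linarith
          gcongr
    _ ≤ _ := by
        rw [div_div, div_le_div_iff₀ (by nlinarith) (by nlinarith [sq_nonneg (z.re + 1 / 2)])]
        have : 0 < z.re + 1 / 2 := by linarith
        have h3 : 0 ≤ (z.re + 1 / 2) * (z.re - r) := mul_nonneg this.le (by linarith)
        nlinarith

lemma hasSum_inv_mul_succ {r : ℝ} (hr : 0 < r) :
    HasSum (fun k : ℕ => 1 / ((r + k) * (r + k + 1))) (1 / r) := by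
  have h : ∀ n : ℕ, ∑ k ∈ Finset.range n, 1 / ((r + k) * (r + k + 1)) = 1 / r - 1 / (r + n) := by
    intro n
    induction n with
    | zero => simp
    | succ n ih =>
      rw [Finset.sum_range_succ, ih]
      have : r + n ≠ 0 := by positivity
      have : r + n + 1 ≠ 0 := by positivity
      push_cast
      field_simp
      ring
  rw [hasSum_iff_tendsto_nat_of_nonneg (fun k => by positivity)]
  simp_rw [h]
  have : Tendsto (fun n : ℕ => 1 / (r + n)) atTop (𝓝 0) := by
    simp_rw [one_div]
    exact tendsto_inv_atTop_zero.comp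
      (tendsto_atTop_add_const_left _ _ tendsto_natCast_atTop_atTop)
  simpa using tendsto_const_nhds.sub this

/-- The square (r + k + 1/2)² exceeds (r + k)(r + k + 1), which makes the majorant telescope. -/
lemma norm_stirlingTerm_add_natCast_le {r : ℝ} (hr : 1 ≤ r) {z : ℂ} (hz : r ≤ z.re) (k : ℕ) :
    ‖stirlingTerm (z + k)‖ ≤ (2 * r + 1) / (24 * r) * (1 / ((r + k) * (r + k + 1))) := by
  have hk : (0 : ℝ) ≤ k := k.cast_nonneg
  refine (norm_stirlingTerm_le hr (z := z + k) (by simp; linarith)).trans ?_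
  rw [div_eq_mul_one_div]
  have : (z + k).re = z.re + k := by simp
  rw [this]
  have : (r + k) * (r + k + 1) ≤ (z.re + k + 1 / 2) ^ 2 := by nlinarith
  gcongr

/-- The remainder in Stirling's formula for `log Γ`. -/
noncomputable def stirlingRem (z : ℂ) : ℂ := ∑' k : ℕ, stirlingTerm (z + k)

lemma summable_stirlingTerm {z : ℂ} (hz : 1 ≤ z.re) :
    Summable fun k : ℕ => stirlingTerm (z + k) :=
  .of_norm_bounded ((hasSum_inv_mul_succ (r := 1) one_pos).summable.mul_left _)
    (norm_stirlingTerm_add_natCast_le le_rfl hz)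

lemma norm_stirlingRem_le {r : ℝ} (hr : 1 ≤ r) {z : ℂ} (hz : r ≤ z.re) :
    ‖stirlingRem z‖ ≤ (2 * r + 1) / (24 * r) / r := by
  rw [div_eq_mul_one_div _ r]
  exact tsum_of_norm_bounded ((hasSum_inv_mul_succ (by linarith)).mul_left _)
    (norm_stirlingTerm_add_natCast_le hr hz)

lemma stirlingRem_add_one {z : ℂ} (hz : 1 ≤ z.re) :
    stirlingRem z = stirlingTerm z + stirlingRem (z + 1) := by
  rw [stirlingRem, (summable_stirlingTerm hz).tsum_eq_zero_add, stirlingRem, Nat.cast_zero, add_zero]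
  congr 2
  funext k
  congr 1
  push_cast
  ring

/-- The branch of `log Γ` given by Stirling's formula, up to an additive real constant. -/
noncomputable def logGamma (z : ℂ) : ℂ := (z - 1 / 2) * Complex.log z - z + stirlingRem z

lemma logGamma_add_one {z : ℂ} (hz : 1 ≤ z.re) :
    logGamma (z + 1) = logGamma z + Complex.log z := by
  rw [logGamma, logGamma, stirlingRem_add_one hz, stirlingTerm]
  ring

lemma exp_logGamma_add_natCast {z : ℂ} (hz : 1 ≤ z.re) (n : ℕ) :
    Complex.exp (logGamma (z + n)) =
      Complex.exp (logGamma z) * ∏ j ∈ Finset.range n, (z + j) := by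
  induction n with
  | zero => simp
  | succ n ih =>
    have hre : 1 ≤ (z + n).re := by simp; linarith [n.cast_nonneg (α := ℝ)]
    have hne : z + n ≠ 0 := by intro h; rw [h] at hre; simp at hre; linarith
    rw [Finset.prod_range_succ, ← mul_assoc, ← ih]
    push_cast
    rw [← add_assoc, logGamma_add_one hre, Complex.exp_add, Complex.exp_log hne]

lemma tendsto_stirlingRem_add_natCast {z : ℂ} (hz : 1 ≤ z.re) :
    Tendsto (fun n : ℕ => stirlingRem (z + n)) atTop (𝓝 0) := by
  have h : Tendsto (fun n : ℕ => (1 / 8 : ℝ) * (1 / ((n : ℝ) + 1))) atTop (𝓝 0) := by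
    simpa using tendsto_one_div_add_atTop_nhds_zero_nat.const_mul (1 / 8 : ℝ)
  refine squeeze_zero_norm (fun n => ?_) h
  have hn : (0 : ℝ) ≤ n := n.cast_nonneg
  refine (norm_stirlingRem_le (r := n + 1) (by linarith) (by simp; linarith)).trans ?_
  rw [div_eq_mul_one_div]
  refine mul_le_mul_of_nonneg_right ?_ (by positivity)
  rw [div_le_div_iff₀ (by positivity) (by norm_num)]
  linarith

/-- This is the asymptotic form of Γ(z + n + 1) ~ n! n^z. The main terms combine into n log(1 + z/n)
→ z; the remainders vanish. -/
lemma tendsto_logGamma_sub {z : ℂ} (hz : 1 ≤ z.re) :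
    Tendsto (fun n : ℕ => logGamma (z + (n + 1 : ℕ)) - logGamma ((1 : ℂ) + n) -
      z * Complex.log n) atTop (𝓝 0) := by
  -- `log (n + 1 + z) = log (n + 1) + log (1 + z / (n + 1))`
  have hlog : ∀ n : ℕ, Complex.log (z + (n + 1 : ℕ)) =
      Complex.log ((n + 1 : ℕ) : ℂ) + Complex.log (1 + z / ((n + 1 : ℕ) : ℂ)) := by
    intro n
    have hn : ((n + 1 : ℕ) : ℂ) ≠ 0 := by exact_mod_cast n.succ_ne_zero
    rw [← log_mul_of_re_pos]
    · congr 1; field_simp; ring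
    · simp; positivity
    · rw [Complex.add_re, Complex.one_re, Complex.div_natCast_re]
      have : 0 ≤ z.re / ((n + 1 : ℕ) : ℝ) := by positivity
      linarith
  have hs : Tendsto (fun n : ℕ => (n : ℂ) * Complex.log (1 + z / n)) atTop (𝓝 z) := by
    refine Complex.tendsto_nat_mul_log_one_add_of_tendsto ?_
    refine tendsto_const_nhds.congr' ?_
    filter_upwards [eventually_ne_atTop 0] with n hn
    have : (n : ℂ) ≠ 0 := by exact_mod_cast hn
    field_simp
  have hs1 := hs.comp (tendsto_add_atTop_nat 1)
  have hinv : Tendsto (fun n : ℕ => 1 / ((n : ℂ) + 1)) atTop (𝓝 0) := by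
    exact tendsto_one_div_add_atTop_nhds_zero_nat (𝕜 := ℂ)
  have hl0 : Tendsto (fun n : ℕ => Complex.log (1 + z / ((n + 1 : ℕ) : ℂ))) atTop (𝓝 0) := by
    have h1 : Tendsto (fun n : ℕ => 1 + z / ((n + 1 : ℕ) : ℂ)) atTop (𝓝 1) := by
      have := (hinv.const_mul z).const_add 1
      simpa [div_eq_mul_inv] using this
    have := (continuousAt_clog (x := 1) (by simp)).tendsto.comp h1
    simpa [Function.comp_def] using this
  have hd : Tendsto (fun n : ℕ => Complex.log ((n + 1 : ℕ) : ℂ) - Complex.log (n : ℂ))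
      atTop (𝓝 0) := by
    have h1 : Tendsto (fun n : ℕ => Real.log (1 + 1 / (n : ℝ))) atTop (𝓝 0) := by
      have : Tendsto (fun n : ℕ => 1 + 1 / (n : ℝ)) atTop (𝓝 1) := by
        simpa using tendsto_one_div_atTop_nhds_zero_nat.const_add (1 : ℝ)
      simpa [Function.comp_def] using
        (Real.continuousAt_log (x := 1) one_ne_zero).tendsto.comp this
    have h2 := (Complex.continuous_ofReal.tendsto 0).comp h1
    rw [Complex.ofReal_zero] at h2
    refine h2.congr' ?_
    filter_upwards [eventually_gt_atTop 0] with n hn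
    have hn' : (0 : ℝ) < n := by exact_mod_cast hn
    rw [← Complex.natCast_log, ← Complex.natCast_log, ← Complex.ofReal_sub,
      ← Real.log_div (by positivity) hn'.ne', Function.comp_apply]
    congr 2
    push_cast
    field_simp
  have hr := (tendsto_stirlingRem_add_natCast hz).comp (tendsto_add_atTop_nat 1)
  have hr' := tendsto_stirlingRem_add_natCast (z := 1) (by simp)
  have key := (((hs1.add (hl0.const_mul (z - 1 / 2))).add (hd.const_mul z)).add
    (hr.sub hr')).sub_const z
  have hz0 : z + (z - 1 / 2) * 0 + z * 0 + (0 - 0) - z = 0 := by ring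
  rw [hz0] at key
  refine key.congr fun n => ?_
  simp only [Function.comp_apply, logGamma]
  rw [hlog n, add_comm (1 : ℂ) n]
  push_cast
  ring

/-- `logGamma` is a logarithm of `Γ` up to an additive real constant. -/
theorem exp_logGamma {z : ℂ} (hz : 1 ≤ z.re) :
    Complex.exp (logGamma z) = Complex.exp (logGamma 1) * Complex.Gamma z := by
  -- Shifting z by n + 1 and 1 by n produces the product and the factorial in Euler's limit
  -- `GammaSeq`; what is left over tends to 1.
  have h1 : ∀ n : ℕ, n ≠ 0 → Complex.exp (logGamma z) =
      Complex.GammaSeq z n * (Complex.exp (logGamma 1) *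
        Complex.exp (logGamma (z + (n + 1 : ℕ)) - logGamma ((1 : ℂ) + n) -
          z * Complex.log n)) := by
    intro n hn
    have hn' : (n : ℂ) ≠ 0 := by exact_mod_cast hn
    have e1 := exp_logGamma_add_natCast hz (n + 1)
    have e2 := exp_logGamma_add_natCast (z := 1) (by simp) n
    have e3 : ∏ j ∈ Finset.range n, ((1 : ℂ) + j) = (n.factorial : ℂ) := by
      rw [← Finset.prod_range_add_one_eq_factorial]
      push_cast
      exact Finset.prod_congr rfl fun _ _ => add_comm _ _
    rw [e3] at e2
    have hp : ∏ j ∈ Finset.range (n + 1), (z + j) ≠ 0 := by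
      refine Finset.prod_ne_zero_iff.2 fun j _ h => ?_
      have := congrArg Complex.re h
      simp at this
      linarith [j.cast_nonneg (α := ℝ)]
    have hf : (n.factorial : ℂ) ≠ 0 := by exact_mod_cast n.factorial_ne_zero
    rw [Complex.exp_sub, Complex.exp_sub, e1, e2, Complex.GammaSeq,
      Complex.cpow_def_of_ne_zero hn', mul_comm z (Complex.log n)]
    field_simp [Complex.exp_ne_zero]
  have h2 : Tendsto (fun n : ℕ => Complex.GammaSeq z n * (Complex.exp (logGamma 1) *
        Complex.exp (logGamma (z + (n + 1 : ℕ)) - logGamma ((1 : ℂ) + n) -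
          z * Complex.log n))) atTop
      (𝓝 (Complex.Gamma z * (Complex.exp (logGamma 1) * Complex.exp 0))) :=
    (Complex.GammaSeq_tendsto_Gamma z).mul
      (((Complex.continuous_exp.tendsto 0).comp (tendsto_logGamma_sub hz)).const_mul _)
  have h3 : Tendsto (fun n : ℕ => Complex.GammaSeq z n * (Complex.exp (logGamma 1) *
        Complex.exp (logGamma (z + (n + 1 : ℕ)) - logGamma ((1 : ℂ) + n) -
          z * Complex.log n))) atTop (𝓝 (Complex.exp (logGamma z))) :=
    tendsto_const_nhds.congr' (by
      filter_upwards [eventually_ne_atTop 0] with n hn using h1 n hn)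
  rw [tendsto_nhds_unique h3 h2, Complex.exp_zero]
  ring

lemma stirlingTerm_ofReal_im {x : ℝ} (hx : 0 ≤ x) : (stirlingTerm x).im = 0 := by
  have : stirlingTerm x = (((x + 1 / 2) * (Real.log (x + 1) - Real.log x) - 1 : ℝ) : ℂ) := by
    rw [stirlingTerm]
    push_cast [Complex.ofReal_log hx, Complex.ofReal_log (show 0 ≤ x + 1 by linarith)]
    rfl
  rw [this, Complex.ofReal_im]

lemma stirlingRem_ofReal_im {x : ℝ} (hx : 1 ≤ x) : (stirlingRem x).im = 0 := by
  rw [stirlingRem, Complex.im_tsum (summable_stirlingTerm (by simpa using hx))]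
  refine (tsum_congr fun k => ?_).trans tsum_zero
  have := stirlingTerm_ofReal_im (x := x + k) (by positivity)
  simpa using this

lemma logGamma_ofReal_im {x : ℝ} (hx : 1 ≤ x) : (logGamma x).im = 0 := by
  have h0 : (0 : ℝ) ≤ x := by linarith
  have : logGamma x = (((x - 1 / 2) * Real.log x - x : ℝ) : ℂ) + stirlingRem x := by
    rw [logGamma]
    push_cast [Complex.ofReal_log h0]
    rfl
  rw [this, Complex.add_im, Complex.ofReal_im, stirlingRem_ofReal_im hx, add_zero]

/-! ### The digamma function and its bounds -/

lemma isOpen_one_lt_re : IsOpen {z : ℂ | 1 < z.re} :=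
  isOpen_lt continuous_const Complex.continuous_re

lemma hasDerivAt_stirlingTerm {z : ℂ} (hz : 0 < z.re) :
    HasDerivAt stirlingTerm
      (Complex.log (z + 1) - Complex.log z - (1 / z + 1 / (z + 1)) / 2) z := by
  have hz1 : 0 < (z + 1).re := by simp; linarith
  have h0 : z ≠ 0 := by rintro rfl; simp at hz
  have h1 : z + 1 ≠ 0 := by intro h; rw [h] at hz1; simp at hz1
  have d1 : HasDerivAt (fun y : ℂ => Complex.log (y + 1)) (1 / (z + 1)) z :=
    ((hasDerivAt_id z).add_const 1).clog (Or.inl hz1)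
  have d2 : HasDerivAt (fun y : ℂ => Complex.log y) (1 / z) z :=
    (hasDerivAt_id z).clog (Or.inl hz)
  have d3 : HasDerivAt (fun y : ℂ => y + 1 / 2) 1 z := (hasDerivAt_id z).add_const _
  refine ((d3.mul (d1.sub d2)).sub_const 1).congr_deriv ?_
  simp only [Pi.sub_apply]
  field_simp
  ring

lemma differentiableOn_stirlingTerm_add (k : ℕ) :
    DifferentiableOn ℂ (fun z => stirlingTerm (z + k)) {z | 1 < z.re} := by
  intro z hz
  have hz' : 0 < (z + (k : ℂ)).re := by
    have h1 : 1 < z.re := hz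
    simp; linarith [k.cast_nonneg (α := ℝ)]
  exact ((hasDerivAt_stirlingTerm hz').comp_add_const z (k : ℂ)).differentiableAt.differentiableWithinAt

lemma stirling_bound_aux (k : ℕ) (z : ℂ) (hz : z ∈ {z : ℂ | 1 < z.re}) :
    ‖stirlingTerm (z + k)‖ ≤ (2 * 1 + 1) / (24 * 1) * (1 / (((1 : ℝ) + k) * (1 + k + 1))) :=
  norm_stirlingTerm_add_natCast_le le_rfl (le_of_lt hz) k

lemma differentiableOn_stirlingRem : DifferentiableOn ℂ stirlingRem {z | 1 < z.re} :=
  Complex.differentiableOn_tsum_of_summable_norm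
    ((hasSum_inv_mul_succ (r := 1) one_pos).summable.mul_left _)
    differentiableOn_stirlingTerm_add isOpen_one_lt_re stirling_bound_aux

lemma hasDerivAt_logGamma {z : ℂ} (hz : 1 < z.re) :
    HasDerivAt logGamma (Complex.log z - 1 / (2 * z) + deriv stirlingRem z) z := by
  have h0 : z ≠ 0 := by rintro rfl; simp at hz; linarith
  have d2 : HasDerivAt (fun y : ℂ => Complex.log y) (1 / z) z :=
    (hasDerivAt_id z).clog (Or.inl (by simp; linarith))
  have d3 : HasDerivAt (fun y : ℂ => y - 1 / 2) 1 z := (hasDerivAt_id z).sub_const _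
  have d4 := (differentiableOn_stirlingRem.differentiableAt
    (isOpen_one_lt_re.mem_nhds hz)).hasDerivAt
  refine (((d3.mul d2).sub (hasDerivAt_id z)).add d4).congr_deriv ?_
  field_simp
  ring

/-- Termwise differentiation gives trapezoidal sums. They telescope to the classical limit for ψ(z),
up to an end term that tends to 0. -/
lemma tendsto_deriv_logGamma {z : ℂ} (hz : 1 < z.re) :
    Tendsto (fun n : ℕ => Complex.log (z + n) - ∑ k ∈ Finset.range n, 1 / (z + k)) atTop
      (𝓝 (deriv logGamma z)) := by
  have hs := (Complex.hasSum_deriv_of_summable_norm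
    ((hasSum_inv_mul_succ (r := 1) one_pos).summable.mul_left _)
    differentiableOn_stirlingTerm_add isOpen_one_lt_re stirling_bound_aux hz).tendsto_sum_nat
  have hd : ∀ k : ℕ, deriv (fun z => stirlingTerm (z + k)) z =
      Complex.log (z + k + 1) - Complex.log (z + k) - (1 / (z + k) + 1 / (z + k + 1)) / 2 := by
    intro k
    have hz' : 0 < (z + (k : ℂ)).re := by simp; linarith [k.cast_nonneg (α := ℝ)]
    exact ((hasDerivAt_stirlingTerm hz').comp_add_const z (k : ℂ)).deriv
  have hsum : ∀ n : ℕ, ∑ k ∈ Finset.range n, deriv (fun z => stirlingTerm (z + k)) z =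
      (Complex.log (z + n) - ∑ k ∈ Finset.range n, 1 / (z + k)) - 1 / (z + n) / 2 -
        (Complex.log z - 1 / (2 * z)) := by
    intro n
    induction n with
    | zero => simp; ring
    | succ n ih =>
      rw [Finset.sum_range_succ, ih, hd, Finset.sum_range_succ]
      push_cast
      rw [← add_assoc]
      ring
  simp_rw [hsum] at hs
  have h0 : Tendsto (fun n : ℕ => 1 / (z + n) / 2) atTop (𝓝 0) := by
    have h1 : Tendsto (fun n : ℕ => ((n : ℝ))⁻¹) atTop (𝓝 0) :=
      tendsto_inv_atTop_zero.comp tendsto_natCast_atTop_atTop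
    refine squeeze_zero_norm' ?_ h1
    filter_upwards [eventually_gt_atTop 0] with n hn
    have hn' : (0 : ℝ) < n := by exact_mod_cast hn
    rw [norm_div, norm_div, norm_one, one_div]
    have h2 : (n : ℝ) ≤ ‖z + n‖ := by
      refine le_trans ?_ (Complex.re_le_norm _)
      simp; linarith
    have h3 : ‖(2 : ℂ)‖ = 2 := by simp
    rw [h3]
    have h4 : ‖z + n‖⁻¹ ≤ (n : ℝ)⁻¹ := by gcongr
    have h5 : 0 ≤ ‖z + n‖⁻¹ := by positivity
    linarith
  have := (hs.add h0).add_const (Complex.log z - 1 / (2 * z))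
  rw [(hasDerivAt_logGamma hz).deriv, show stirlingRem = fun w => ∑' i : ℕ, stirlingTerm (w + i)
    from rfl]
  convert! this using 1
  · funext n; ring
  · congr 1; ring

lemma div_one_add_sq_le_arctan {u : ℝ} (hu : 0 ≤ u) : u / (1 + u ^ 2) ≤ Real.arctan u := by
  have h := Real.sin_le (x := 2 * Real.arctan u) (by linarith [Real.arctan_nonneg.2 hu])
  have h1 := Real.cos_sq_arctan u
  have h2 : Real.sin (Real.arctan u) = u * Real.cos (Real.arctan u) := by
    rw [Real.sin_arctan, Real.cos_arctan]; ring
  rw [Real.sin_two_mul, h2] at h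
  have h3 : u / (1 + u ^ 2) = u * Real.cos (Real.arctan u) * Real.cos (Real.arctan u) := by
    rw [mul_assoc, ← sq, h1]; ring
  linarith

/-- The right side is the integral of t/(u² + t²) over [y, y + 1], and the left side is the
integrand at its smallest, u = y + 1. The proof uses the addition formula for the arctangent instead
of the integral. -/
lemma div_le_arctan_sub_arctan {t y : ℝ} (ht : 0 < t) (hy : 0 < y) :
    t / ((y + 1) ^ 2 + t ^ 2) ≤ Real.arctan (t / y) - Real.arctan (t / (y + 1)) := by
  have h : t / y * -(t / (y + 1)) < 1 := by
    have : 0 < t / y * (t / (y + 1)) := by positivity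
    linarith
  rw [sub_eq_add_neg, ← Real.arctan_neg, Real.arctan_add h]
  have e : (t / y + -(t / (y + 1))) / (1 - t / y * -(t / (y + 1))) =
      t / (y ^ 2 + y + t ^ 2) := by
    have e1 : t / y + -(t / (y + 1)) = t / (y * (y + 1)) := by field_simp; ring
    have e2 : 1 - t / y * -(t / (y + 1)) = (y ^ 2 + y + t ^ 2) / (y * (y + 1)) := by
      field_simp; ring
    rw [e1, e2, div_div_div_cancel_right₀ (by positivity)]
  rw [e]
  refine le_trans ?_ (div_one_add_sq_le_arctan (by positivity))
  have hP : 0 < y ^ 2 + y + t ^ 2 := by positivity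
  have e2 : t / (y ^ 2 + y + t ^ 2) / (1 + (t / (y ^ 2 + y + t ^ 2)) ^ 2) =
      t * (y ^ 2 + y + t ^ 2) / ((y ^ 2 + y + t ^ 2) ^ 2 + t ^ 2) := by
    field_simp
  rw [e2, div_le_div_iff₀ (by positivity) (by positivity)]
  have : 0 ≤ t * ((y ^ 2 + y + t ^ 2) * (y + 1) - t ^ 2) :=
    mul_nonneg ht.le (by nlinarith [sq_nonneg t, mul_pos hy hy, mul_pos hy (pow_pos ht 2)])
  nlinarith

lemma arg_eq_neg_arctan {x t : ℝ} (hx : 0 < x) :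
    Complex.arg (⟨x, -t⟩ : ℂ) = -Real.arctan (t / x) := by
  rw [← Real.arctan_neg, ← neg_div, Real.arctan_eq_arcsin, Complex.arg_of_re_nonneg hx.le]
  congr 1
  have h : ‖(⟨x, -t⟩ : ℂ)‖ = x * √(1 + (-t / x) ^ 2) := by
    rw [Complex.norm_def, ← Real.sqrt_sq hx.le, ← Real.sqrt_mul (sq_nonneg x),
      Complex.normSq_apply, Real.sqrt_sq hx.le]
    congr 1
    simp
    field_simp
  rw [h]
  simp only
  field_simp

/-- A lower bound for the imaginary part of the digamma function below the real axis. -/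
lemma neg_arctan_le_deriv_logGamma_im {x t : ℝ} (hx : 1 < x) (ht : 0 < t) :
    -Real.arctan (t / (x - 1)) ≤ (deriv logGamma ⟨x, -t⟩).im := by
  have h := (Complex.continuous_im.tendsto _).comp
    (tendsto_deriv_logGamma (z := ⟨x, -t⟩) (by simpa using hx))
  refine ge_of_tendsto' h fun n => ?_
  have hsum : ∀ n : ℕ, ∑ k ∈ Finset.range n, t / ((x + k) ^ 2 + t ^ 2) ≤
      Real.arctan (t / (x - 1)) - Real.arctan (t / (x - 1 + n)) := by
    intro n
    induction n with
    | zero => simp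
    | succ n ih =>
      have := div_le_arctan_sub_arctan ht (y := x - 1 + n)
        (by linarith [n.cast_nonneg (α := ℝ)])
      rw [Finset.sum_range_succ]
      push_cast
      rw [← add_assoc]
      have e : x - 1 + n + 1 = x + n := by ring
      rw [e] at this ⊢
      linarith
  have hn : (0 : ℝ) ≤ n := n.cast_nonneg
  have e1 : (⟨x, -t⟩ : ℂ) + n = ⟨x + n, -t⟩ := by apply Complex.ext <;> simp
  have e2 : ∀ k : ℕ, (1 / ((⟨x, -t⟩ : ℂ) + k)).im = t / ((x + k) ^ 2 + t ^ 2) := by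
    intro k
    rw [one_div, Complex.inv_im, Complex.normSq_apply]
    simp
    ring
  have h1 := hsum n
  simp only [Function.comp_apply, Complex.sub_im, Complex.log_im, Complex.im_sum, e1, e2,
    arg_eq_neg_arctan (show 0 < x + n by linarith)]
  have h2 : Real.arctan (t / (x + n)) ≤ Real.arctan (t / (x - 1 + n)) := by
    apply Real.arctan_strictMono.monotone
    have : 0 < x - 1 + n := by linarith
    gcongr
    linarith
  linarith

/-- A lower bound for the real part of the digamma function. -/
lemma log_norm_sub_le_deriv_logGamma_re {x t : ℝ} (hx : 2 ≤ x) (ht : 9 ≤ t) :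
    Real.log ‖(⟨x - 1 / 2, -t⟩ : ℂ)‖ - 1 / 153 ≤ (deriv logGamma ⟨x, -t⟩).re := by
  set z : ℂ := ⟨x, -t⟩ with hz
  have h := (Complex.continuous_re.tendsto _).comp
    (tendsto_deriv_logGamma (z := z) (by simp [hz]; linarith))
  refine ge_of_tendsto' h fun n => ?_
  -- Each 1/(z + k) is compared with the integral of 1/u over the unit segment centred there. Since
  -- ‖z + k‖ ≥ 9, the factor 6(2‖z + k‖ - 1) is at least 6 · 17 = 102. Starting the telescoping
  -- series at 3/2 gives the total error (1/102)(2/3) = 1/153.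
  have hterm : ∀ k : ℕ, ‖Complex.log (z + k + (1 / 2 : ℝ)) - Complex.log (z + k - (1 / 2 : ℝ)) -
      1 / (z + k)‖ ≤ 1 / 102 * (1 / ((3 / 2 + k) * (3 / 2 + k + 1))) := by
    intro k
    have hk : (0 : ℝ) ≤ k := k.cast_nonneg
    have hb := norm_log_add_sub_log_sub_sub_le (a := z + k) (h := 1 / 2) (by norm_num)
      (by simp [hz]; linarith)
    have e : 2 * ((1 / 2 : ℝ) : ℂ) / (z + k) = 1 / (z + k) := by push_cast; ring
    rw [e] at hb
    refine hb.trans ?_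
    have hsq : ‖z + k‖ ^ 2 = (x + k) ^ 2 + t ^ 2 := by
      rw [← Complex.normSq_eq_norm_sq, Complex.normSq_apply]; simp [hz]; ring
    have h9 : 9 ≤ ‖z + k‖ := by nlinarith [norm_nonneg (z + k), sq_nonneg (x + k)]
    have hp : 0 < ‖z + k‖ := by linarith
    have h1 : 2 / 3 * (1 / 2 / ‖z + k‖) ^ 3 / (1 - 1 / 2 / ‖z + k‖) =
        1 / (6 * ‖z + k‖ ^ 2 * (2 * ‖z + k‖ - 1)) := by
      have : 2 * ‖z + k‖ - 1 ≠ 0 := by linarith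
      have h2 : 1 - 1 / 2 / ‖z + k‖ = (2 * ‖z + k‖ - 1) / (2 * ‖z + k‖) := by field_simp
      rw [h2]; field_simp; norm_num
    rw [h1, one_div_mul_one_div_rev]
    apply one_div_le_one_div_of_le (by positivity)
    rw [hsq]
    have h3 : (3 / 2 + (k : ℝ)) * (3 / 2 + k + 1) ≤ (x + k) ^ 2 + t ^ 2 := by nlinarith
    have h4 : 17 ≤ 2 * ‖z + k‖ - 1 := by linarith
    have h5 : 0 ≤ (3 / 2 + (k : ℝ)) * (3 / 2 + k + 1) := by positivity
    nlinarith
  have hsum : ∀ n : ℕ, Complex.log (z + n) - ∑ k ∈ Finset.range n, 1 / (z + k) =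
      (Complex.log (z + n) - Complex.log (z + n - (1 / 2 : ℝ))) +
        Complex.log (z - (1 / 2 : ℝ)) + ∑ k ∈ Finset.range n,
        (Complex.log (z + k + (1 / 2 : ℝ)) - Complex.log (z + k - (1 / 2 : ℝ)) - 1 / (z + k)) := by
    intro n
    induction n with
    | zero => simp
    | succ n ih =>
      rw [Finset.sum_range_succ, Finset.sum_range_succ]
      have e : z + ((n + 1 : ℕ) : ℂ) - (1 / 2 : ℝ) = z + n + (1 / 2 : ℝ) := by
        push_cast; ring
      rw [e]
      linear_combination ih
  have hb : ‖∑ k ∈ Finset.range n,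
        (Complex.log (z + k + (1 / 2 : ℝ)) - Complex.log (z + k - (1 / 2 : ℝ)) - 1 / (z + k))‖
        ≤ 1 / 153 := by
    have hs := (hasSum_inv_mul_succ (r := 3 / 2) (by norm_num)).mul_left (1 / 102)
    refine (norm_sum_le_of_le _ fun k _ => hterm k).trans ?_
    refine (sum_le_hasSum _ (fun k _ => by positivity) hs).trans (by norm_num)
  have hb' := (abs_le.1 ((Complex.abs_re_le_norm _).trans hb)).1
  have e3 : z - (1 / 2 : ℝ) = ⟨x - 1 / 2, -t⟩ := by apply Complex.ext <;> simp [hz]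
  have hmono : Real.log ‖z + n - (1 / 2 : ℝ)‖ ≤ Real.log ‖z + n‖ := by
    have hn : (0 : ℝ) ≤ n := n.cast_nonneg
    apply Real.log_le_log
    · rw [norm_pos_iff]
      intro h
      have := congrArg Complex.re h
      simp [hz] at this
      linarith
    · rw [Complex.norm_def, Complex.norm_def]
      apply Real.sqrt_le_sqrt
      rw [Complex.normSq_apply, Complex.normSq_apply]
      simp [hz]
      nlinarith
  rw [Function.comp_apply, hsum, Complex.add_re, Complex.add_re, Complex.sub_re, Complex.log_re,
    Complex.log_re, Complex.log_re, e3]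
  linarith

end ZetaLine

/-! ### The Dirichlet series of log ζ and -ζ'/ζ -/

namespace ZetaLine

open Filter Topology LSeries ArithmeticFunction

/-- The Dirichlet coefficients `Λ(n) / log n` of `log ζ`. -/
noncomputable def logZetaCoeff (n : ℕ) : ℝ := vonMangoldt n / Real.log n

/-- The branch of `log ζ` on `1 < Re z` that vanishes at infinity. -/
noncomputable def logZeta (z : ℂ) : ℂ := LSeries (fun n => (logZetaCoeff n : ℂ)) z

lemma logZetaCoeff_nonneg (n : ℕ) : 0 ≤ logZetaCoeff n :=
  div_nonneg vonMangoldt_nonneg (Real.log_natCast_nonneg n)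

lemma logZetaCoeff_le_one (n : ℕ) : logZetaCoeff n ≤ 1 :=
  div_le_one_of_le₀ vonMangoldt_le_log (Real.log_natCast_nonneg n)

lemma norm_logZetaCoeff_le (n : ℕ) : ‖(logZetaCoeff n : ℂ)‖ ≤ 1 := by
  rw [Complex.norm_real, Real.norm_of_nonneg (logZetaCoeff_nonneg n)]
  exact logZetaCoeff_le_one n

lemma logZetaCoeff_zero : logZetaCoeff 0 = 0 := by simp [logZetaCoeff]

lemma logZetaCoeff_one : logZetaCoeff 1 = 0 := by simp [logZetaCoeff]

lemma logZetaCoeff_two : logZetaCoeff 2 = 1 := by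
  rw [logZetaCoeff, vonMangoldt_apply_prime Nat.prime_two]
  exact div_self (by norm_num)

lemma abscissa_logZetaCoeff_le : abscissaOfAbsConv (fun n => (logZetaCoeff n : ℂ)) ≤ 1 :=
  abscissaOfAbsConv_le_of_le_const ⟨1, fun n _ => norm_logZetaCoeff_le n⟩

lemma lseriesSummable_logZetaCoeff {z : ℂ} (hz : 1 < z.re) :
    LSeriesSummable (fun n => (logZetaCoeff n : ℂ)) z :=
  LSeriesSummable_of_bounded_of_one_lt_re (fun n _ => norm_logZetaCoeff_le n) hz

lemma hasDerivAt_logZeta {z : ℂ} (hz : 1 < z.re) :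
    HasDerivAt logZeta (-LSeries (fun n => (vonMangoldt n : ℂ)) z) z := by
  have h := LSeries_hasDerivAt (f := fun n => (logZetaCoeff n : ℂ)) (s := z)
    (abscissa_logZetaCoeff_le.trans_lt (by exact_mod_cast hz))
  refine h.congr_deriv ?_
  congr 1
  refine LSeries_congr (fun {n} hn => ?_) z
  rw [logMul, logZetaCoeff, ← Complex.natCast_log, ← Complex.ofReal_mul]
  congr 1
  -- At n = 1 the denominator log n vanishes, but so does Λ(n).
  rcases eq_or_ne n 1 with rfl | h1
  · simp
  · have : Real.log n ≠ 0 := (Real.log_pos (by exact_mod_cast (by omega : 1 < n))).ne'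
    field_simp

lemma tendsto_logZeta : Tendsto (fun x : ℝ => logZeta x) atTop (𝓝 0) := by
  have := LSeries.tendsto_atTop (f := fun n => (logZetaCoeff n : ℂ))
    (abscissa_logZetaCoeff_le.trans_lt (EReal.coe_lt_top 1))
  simpa [logZetaCoeff_one] using! this

lemma tendsto_riemannZeta_ofReal : Tendsto (fun x : ℝ => riemannZeta x) atTop (𝓝 1) := by
  have h := LSeries.tendsto_atTop (f := 1) (by
    refine (abscissaOfAbsConv_le_of_le_const ⟨1, fun n _ => by simp⟩).trans_lt
      (EReal.coe_lt_top 1))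
  refine h.congr' ?_
  filter_upwards [eventually_gt_atTop 1] with x hx
  exact LSeries_one_eq_riemannZeta (by simpa using hx)

/-- The quotient of ζ by exp(`logZeta`) has derivative 0 on a connected half-plane, and it tends to
1 along the real axis. -/
theorem exp_logZeta {z : ℂ} (hz : 1 < z.re) : Complex.exp (logZeta z) = riemannZeta z := by
  have hne : ∀ y : ℂ, 1 < y.re → y ≠ 1 := by rintro y hy rfl; simp at hy
  have hd : ∀ y : ℂ, 1 < y.re →
      HasDerivAt (fun y => Complex.exp (-logZeta y) * riemannZeta y) 0 y := by
    intro y hy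
    have h1 := (hasDerivAt_logZeta hy).neg.cexp
    have h2 := (differentiableAt_riemannZeta (hne y hy)).hasDerivAt
    refine (h1.mul h2).congr_deriv ?_
    rw [LSeries_vonMangoldt_eq_deriv_riemannZeta_div hy]
    have := riemannZeta_ne_zero_of_one_lt_re hy
    simp only [Pi.neg_apply]
    field_simp
    ring
  have hconst : ∀ x : ℝ, 1 < x → Complex.exp (-logZeta x) * riemannZeta x =
      Complex.exp (-logZeta z) * riemannZeta z := fun x hx =>
    IsOpen.is_const_of_deriv_eq_zero (s := {y : ℂ | 1 < y.re}) isOpen_one_lt_re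
      (convex_halfSpace_re_gt 1).isPreconnected
      (fun y hy => (hd y hy).differentiableAt.differentiableWithinAt)
      (fun y hy => (hd y hy).deriv) (by simpa using hx) hz
  have hlim : Tendsto (fun x : ℝ => Complex.exp (-logZeta x) * riemannZeta x) atTop
      (𝓝 (Complex.exp (-0) * 1)) :=
    ((Complex.continuous_exp.tendsto _).comp tendsto_logZeta.neg).mul tendsto_riemannZeta_ofReal
  have hlim' : Tendsto (fun x : ℝ => Complex.exp (-logZeta x) * riemannZeta x) atTop
      (𝓝 (Complex.exp (-logZeta z) * riemannZeta z)) :=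
    tendsto_const_nhds.congr' (by
      filter_upwards [eventually_gt_atTop 1] with x hx using (hconst x hx).symm)
  have h := tendsto_nhds_unique hlim' hlim
  rw [neg_zero, Complex.exp_zero, one_mul, Complex.exp_neg] at h
  have := Complex.exp_ne_zero (logZeta z)
  field_simp at h
  exact h.symm

lemma term_ofReal_eq {a : ℕ → ℝ} (ha : a 0 = 0) (x t : ℝ) (n : ℕ) :
    LSeries.term (fun n => (a n : ℂ)) ⟨x, -t⟩ n =
      ⟨a n * (n : ℝ) ^ (-x) * Real.cos (t * Real.log n),
        a n * (n : ℝ) ^ (-x) * Real.sin (t * Real.log n)⟩ := by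
  rcases eq_or_ne n 0 with rfl | hn
  · simp [ha]; rfl
  have hn' : (0 : ℝ) < n := by exact_mod_cast Nat.pos_of_ne_zero hn
  have hnc : (n : ℂ) ≠ 0 := by exact_mod_cast hn
  rw [LSeries.term_of_ne_zero hn, Complex.cpow_def_of_ne_zero hnc, div_eq_mul_inv,
    ← Complex.exp_neg, ← Complex.natCast_log]
  have e : ∀ r : ℝ, -((r : ℂ) * ⟨x, -t⟩) = ⟨r * (-x), t * r⟩ := fun r => by
    apply Complex.ext
    · simp
    · simp [mul_comm]
  rw [e, Real.rpow_def_of_pos hn']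
  apply Complex.ext
  · rw [Complex.re_ofReal_mul, Complex.exp_re]; ring
  · rw [Complex.im_ofReal_mul, Complex.exp_im]; ring

lemma hasSum_re_lseries {a : ℕ → ℝ} (ha : a 0 = 0) {x t : ℝ}
    (hs : LSeriesSummable (fun n => (a n : ℂ)) ⟨x, -t⟩) :
    HasSum (fun n : ℕ => a n * (n : ℝ) ^ (-x) * Real.cos (t * Real.log n))
      (LSeries (fun n => (a n : ℂ)) ⟨x, -t⟩).re := by
  have := Complex.hasSum_re hs.LSeriesHasSum
  simpa only [term_ofReal_eq ha] using this

lemma hasSum_im_lseries {a : ℕ → ℝ} (ha : a 0 = 0) {x t : ℝ}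
    (hs : LSeriesSummable (fun n => (a n : ℂ)) ⟨x, -t⟩) :
    HasSum (fun n : ℕ => a n * (n : ℝ) ^ (-x) * Real.sin (t * Real.log n))
      (LSeries (fun n => (a n : ℂ)) ⟨x, -t⟩).im := by
  have := Complex.hasSum_im hs.LSeriesHasSum
  simpa only [term_ofReal_eq ha] using this

/-- For n ≥ K one has n^(-x) ≤ K^(-(x - 2)) n^(-2), so the tail at x is controlled by the tail at 2.
The latter is the full sum at 2, known or bounded separately, minus finitely many terms. The weights
g are the sines or cosines of t log n. -/
lemma abs_sub_sum_range_le {a g : ℕ → ℝ} {S T x : ℝ} {K : ℕ} (hK : K ≠ 0) (ha : ∀ n, 0 ≤ a n)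
    (hg : ∀ n, |g n| ≤ 1) (hx : 2 ≤ x) (hS : HasSum (fun n : ℕ => a n * (n : ℝ) ^ (-2 : ℝ)) S)
    (hT : HasSum (fun n : ℕ => a n * (n : ℝ) ^ (-x) * g n) T) :
    |T - ∑ n ∈ Finset.range K, a n * (n : ℝ) ^ (-x) * g n| ≤
      (K : ℝ) ^ (-(x - 2)) * (S - ∑ n ∈ Finset.range K, a n * (n : ℝ) ^ (-2 : ℝ)) := by
  have h1 := (hasSum_nat_add_iff' K).2 hS
  have h2 := (hasSum_nat_add_iff' K).2 hT
  rw [← h2.tsum_eq, ← Real.norm_eq_abs]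
  refine tsum_of_norm_bounded (h1.mul_left _) fun n => ?_
  have hKpos : (0 : ℝ) < K := by exact_mod_cast Nat.pos_of_ne_zero hK
  have hpos : (0 : ℝ) < ((n + K : ℕ) : ℝ) := by push_cast; positivity
  have e : (((n + K : ℕ) : ℝ)) ^ (-x) =
      ((n + K : ℕ) : ℝ) ^ (-(x - 2)) * ((n + K : ℕ) : ℝ) ^ (-2 : ℝ) := by
    rw [← Real.rpow_add hpos]; congr 1; ring
  have h3 : ((n + K : ℕ) : ℝ) ^ (-(x - 2)) ≤ (K : ℝ) ^ (-(x - 2)) :=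
    Real.rpow_le_rpow_of_nonpos hKpos (by push_cast; linarith [n.cast_nonneg (α := ℝ)])
      (by linarith)
  rw [norm_mul, norm_mul, Real.norm_of_nonneg (ha _), Real.norm_of_nonneg (by positivity), e]
  have h4 : 0 ≤ a (n + K) * ((n + K : ℕ) : ℝ) ^ (-2 : ℝ) := mul_nonneg (ha _) (by positivity)
  calc _ ≤ a (n + K) * (((n + K : ℕ) : ℝ) ^ (-(x - 2)) * ((n + K : ℕ) : ℝ) ^ (-2 : ℝ)) * 1 := by
        refine mul_le_mul_of_nonneg_left (hg _) (mul_nonneg (ha _) (by positivity))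
    _ = ((n + K : ℕ) : ℝ) ^ (-(x - 2)) * (a (n + K) * ((n + K : ℕ) : ℝ) ^ (-2 : ℝ)) := by ring
    _ ≤ _ := mul_le_mul_of_nonneg_right h3 h4

lemma hasSum_logZetaCoeff_two :
    HasSum (fun n : ℕ => logZetaCoeff n * (n : ℝ) ^ (-2 : ℝ)) (Real.log (Real.pi ^ 2 / 6)) := by
  have h2 : (1 : ℝ) < (⟨2, -0⟩ : ℂ).re := by norm_num
  have h := hasSum_re_lseries logZetaCoeff_zero (lseriesSummable_logZetaCoeff h2)
  have hi := hasSum_im_lseries logZetaCoeff_zero (lseriesSummable_logZetaCoeff h2)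
  simp only [zero_mul, Real.cos_zero, Real.sin_zero, mul_one, mul_zero] at h hi
  have him := hi.unique hasSum_zero
  have e2 : (⟨2, -0⟩ : ℂ) = 2 := by apply Complex.ext <;> simp
  have e := exp_logZeta (z := ⟨2, -0⟩) h2
  convert! h using 1
  have e3 : logZeta ⟨2, -0⟩ = ((logZeta ⟨2, -0⟩).re : ℂ) :=
    Complex.ext rfl (by rw [Complex.ofReal_im]; exact him)
  rw [e3, ← Complex.ofReal_exp, e2, riemannZeta_two] at e
  have e4 : Real.exp (logZeta 2).re = Real.pi ^ 2 / 6 := by exact_mod_cast e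
  rw [← e4, Real.log_exp, ← e2]
  rfl

/-- The contribution of the prime `2` to `log ζ`, with an error bound. -/
lemma abs_logZeta_im_sub_le {x t : ℝ} (hx : 2 ≤ x) :
    |(logZeta ⟨x, -t⟩).im - (2 : ℝ) ^ (-x) * Real.sin (t * Real.log 2)| ≤
      (3 : ℝ) ^ (-(x - 2)) * (Real.log (Real.pi ^ 2 / 6) - 1 / 4) := by
  have h := abs_sub_sum_range_le (K := 3) (by norm_num) logZetaCoeff_nonneg
    (fun n => Real.abs_sin_le_one (t * Real.log n)) hx hasSum_logZetaCoeff_two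
    (hasSum_im_lseries logZetaCoeff_zero (x := x) (t := t)
      (lseriesSummable_logZetaCoeff (by simp; linarith)))
  simp only [Finset.sum_range_succ, Finset.sum_range_zero, logZetaCoeff_zero, logZetaCoeff_one,
    logZetaCoeff_two] at h
  norm_num at h
  convert! h using 3
  norm_num

lemma norm_logZeta_le {x t : ℝ} (hx : 2 ≤ x) :
    |(logZeta ⟨x, -t⟩).im| ≤ Real.log (Real.pi ^ 2 / 6) := by
  have h := abs_sub_sum_range_le (K := 1) (by norm_num) logZetaCoeff_nonneg
    (fun n => Real.abs_sin_le_one (t * Real.log n)) hx hasSum_logZetaCoeff_two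
    (hasSum_im_lseries logZetaCoeff_zero (x := x) (t := t)
      (lseriesSummable_logZetaCoeff (by simp; linarith)))
  simp [logZetaCoeff_zero] at h
  exact h

/-- Since -(1 + log u)/u is a primitive of log u/u², the right side is an integral over a unit
interval centred at a; this is the midpoint inequality for a convex function. It is checked by
expanding in w = 1/(2a). -/
lemma log_div_sq_le {a : ℝ} (ha : 9 ≤ a) :
    Real.log a / a ^ 2 ≤
      (1 + Real.log (a - 1 / 2)) / (a - 1 / 2) - (1 + Real.log (a + 1 / 2)) / (a + 1 / 2) := by
  have ha0 : 0 < a := by linarith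
  set w : ℝ := 1 / (2 * a) with hw
  have hw0 : 0 < w := by positivity
  have hw1 : w ≤ 1 / 18 := by rw [hw]; apply one_div_le_one_div_of_le <;> linarith
  have haw : a * w = 1 / 2 := by rw [hw]; field_simp
  have e1 : Real.log (a - 1 / 2) = Real.log a + Real.log (1 - w) := by
    rw [← Real.log_mul ha0.ne' (by linarith)]; congr 1; rw [mul_sub, haw]; ring
  have e2 : Real.log (a + 1 / 2) = Real.log a + Real.log (1 + w) := by
    rw [← Real.log_mul ha0.ne' (by linarith)]; congr 1; rw [mul_add, haw]; ring
  have hb : w ^ 3 / (1 - w) ≤ 18 / 17 * w ^ 3 := by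
    rw [div_le_iff₀ (by linarith)]
    nlinarith [pow_pos hw0 3]
  have l1 : -w - w ^ 2 / 2 - 18 / 17 * w ^ 3 ≤ Real.log (1 - w) := by
    have h := Real.abs_log_sub_add_sum_range_le (x := w) (by rw [abs_of_pos hw0]; linarith) 2
    rw [abs_of_pos hw0] at h
    have := (abs_le.1 h).1
    norm_num [Finset.sum_range_succ] at this
    linarith
  have l2 : Real.log (1 + w) ≤ w - w ^ 2 / 2 + 18 / 17 * w ^ 3 := by
    have h := Real.abs_log_sub_add_sum_range_le (x := -w)
      (by rw [abs_neg, abs_of_pos hw0]; linarith) 2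
    rw [abs_neg, abs_of_pos hw0] at h
    have := (abs_le.1 h).2
    norm_num [Finset.sum_range_succ] at this
    linarith
  have l3 : 2 ≤ Real.log a := by
    have : Real.log 9 ≤ Real.log a := Real.log_le_log (by norm_num) ha
    have h9 : Real.log 9 = 2 * Real.log 3 := by
      rw [show (9 : ℝ) = 3 ^ 2 by norm_num, Real.log_pow]; norm_num
    linarith [Real.log_three_gt_d9]
  set ℓ := Real.log a
  rw [e1, e2, div_sub_div _ _ (by linarith) (by linarith), div_le_div_iff₀ (by positivity)
    (mul_pos (by linarith) (by linarith))]
  have h1 : (a + 1 / 2) * (-w - w ^ 2 / 2 - 18 / 17 * w ^ 3) ≤ (a + 1 / 2) * Real.log (1 - w) :=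
    mul_le_mul_of_nonneg_left l1 (by linarith)
  have h2 : (a - 1 / 2) * Real.log (1 + w) ≤ (a - 1 / 2) * (w - w ^ 2 / 2 + 18 / 17 * w ^ 3) :=
    mul_le_mul_of_nonneg_left l2 (by linarith)
  have h3 : -1 - 2 * w ^ 2 ≤ (a + 1 / 2) * (-w - w ^ 2 / 2 - 18 / 17 * w ^ 3) -
      (a - 1 / 2) * (w - w ^ 2 / 2 + 18 / 17 * w ^ 3) := by
    have : (a + 1 / 2) * (-w - w ^ 2 / 2 - 18 / 17 * w ^ 3) -
      (a - 1 / 2) * (w - w ^ 2 / 2 + 18 / 17 * w ^ 3) =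
      -2 * (a * w) - 36 / 17 * (a * w) * w ^ 2 - w ^ 2 / 2 := by ring
    rw [this, haw]
    nlinarith [sq_nonneg w]
  have haw2 : a ^ 2 * w ^ 2 = 1 / 4 := by rw [← mul_pow, haw]; norm_num
  have h4 : ℓ - 2 * w ^ 2 ≤ (1 + (ℓ + Real.log (1 - w))) * (a + 1 / 2) -
      (a - 1 / 2) * (1 + (ℓ + Real.log (1 + w))) := by nlinarith
  have h5 : (ℓ - 2 * w ^ 2) * a ^ 2 ≤ ((1 + (ℓ + Real.log (1 - w))) * (a + 1 / 2) -
      (a - 1 / 2) * (1 + (ℓ + Real.log (1 + w)))) * a ^ 2 :=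
    mul_le_mul_of_nonneg_right h4 (by positivity)
  refine le_trans ?_ h5
  nlinarith

/-- The sum is -ζ'(2). The terms n ≤ 8 are evaluated and the tail is bounded by the midpoint rule
from 17/2 on. -/
lemma sum_log_mul_rpow_le {L : ℝ} (hL : HasSum (fun n : ℕ => Real.log n * (n : ℝ) ^ (-2 : ℝ)) L) :
    L ≤ 0.9385 := by
  have h1 := (hasSum_nat_add_iff' 9).2 hL
  have hf : ∀ n : ℕ, ∑ k ∈ Finset.range n, Real.log ((k + 9 : ℕ) : ℝ) *
      ((k + 9 : ℕ) : ℝ) ^ (-2 : ℝ) ≤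
      (1 + Real.log (17 / 2)) / (17 / 2) - (1 + Real.log (n + 17 / 2)) / (n + 17 / 2) := by
    intro n
    induction n with
    | zero => simp
    | succ n ih =>
      have := log_div_sq_le (a := n + 9) (by linarith [n.cast_nonneg (α := ℝ)])
      rw [Finset.sum_range_succ]
      have e : ((n + 9 : ℕ) : ℝ) ^ (-2 : ℝ) = 1 / ((n : ℝ) + 9) ^ 2 := by
        rw [Real.rpow_neg (by positivity)]; push_cast; norm_num
      rw [e]
      push_cast at ih ⊢
      rw [mul_one_div]
      rw [show (n : ℝ) + 9 - 1 / 2 = n + 17 / 2 by ring,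
        show (n : ℝ) + 9 + 1 / 2 = n + 1 + 17 / 2 by ring] at this
      linarith
  have h2 := le_of_tendsto' h1.tendsto_sum_nat (b := (1 + Real.log (17 / 2)) / (17 / 2)) fun n => by
    refine (hf n).trans (sub_le_self _ ?_)
    have : 0 ≤ Real.log ((n : ℝ) + 17 / 2) :=
      Real.log_nonneg (by linarith [n.cast_nonneg (α := ℝ)])
    positivity
  have b2 := Real.log_two_lt_d9
  have b3 := Real.log_three_lt_d9
  have b5 := Real.log_five_lt_d9
  have l4 : Real.log 4 = 2 * Real.log 2 := by
    rw [show (4 : ℝ) = 2 ^ 2 by norm_num, Real.log_pow]; norm_num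
  have l8 : Real.log 8 = 3 * Real.log 2 := by
    rw [show (8 : ℝ) = 2 ^ 3 by norm_num, Real.log_pow]; norm_num
  have l6 : Real.log 6 = Real.log 2 + Real.log 3 := by
    rw [show (6 : ℝ) = 2 * 3 by norm_num, Real.log_mul (by norm_num) (by norm_num)]
  -- The inequality 7² ≤ 2 · 5² reduces log 7 to logarithms with known decimals.
  have l7 : 2 * Real.log 7 ≤ Real.log 2 + 2 * Real.log 5 := by
    have e1 : 2 * Real.log 7 = Real.log 49 := by
      rw [show (49 : ℝ) = 7 ^ 2 by norm_num, Real.log_pow]; norm_num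
    have e2 : Real.log 2 + 2 * Real.log 5 = Real.log 50 := by
      rw [show (50 : ℝ) = 2 * 5 ^ 2 by norm_num, Real.log_mul (by norm_num) (by norm_num),
        Real.log_pow]
      norm_num
    rw [e1, e2]
    exact Real.log_le_log (by norm_num) (by norm_num)
  have l85 : Real.log (17 / 2) ≤ 3 * Real.log 2 + 1 / 16 := by
    rw [show (17 / 2 : ℝ) = 2 ^ 3 * (17 / 16) by norm_num,
      Real.log_mul (by norm_num) (by norm_num), Real.log_pow]
    have := Real.log_le_sub_one_of_pos (x := 17 / 16) (by norm_num)
    norm_num at this ⊢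
    linarith
  simp only [Finset.sum_range_succ, Finset.sum_range_zero, Real.rpow_neg (Nat.cast_nonneg _)] at h2
  norm_num at h2
  rw [l4, l6, l8] at h2
  norm_num
  linarith

/-- The value of `-ζ'/ζ` at `2`. -/
noncomputable def vonMangoldtTwo : ℝ := (LSeries (fun n => (vonMangoldt n : ℂ)) 2).re

lemma ofReal_two_eq : (⟨2, -0⟩ : ℂ) = 2 := by apply Complex.ext <;> simp

lemma hasSum_vonMangoldt_two :
    HasSum (fun n : ℕ => vonMangoldt n * (n : ℝ) ^ (-2 : ℝ)) vonMangoldtTwo := by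
  have h := hasSum_re_lseries (a := fun n => vonMangoldt n) (by simp) (x := 2) (t := 0)
    (LSeriesSummable_vonMangoldt (by norm_num))
  rw [ofReal_two_eq] at h
  simpa [vonMangoldtTwo] using h

lemma vonMangoldtTwo_lt : vonMangoldtTwo < 0.571 := by
  have h2 : (1 : ℝ) < (2 : ℂ).re := by norm_num
  have habs : abscissaOfAbsConv (1 : ℕ → ℂ) < ((2 : ℂ).re : ℝ) :=
    (abscissaOfAbsConv_le_of_le_const ⟨1, fun n _ => by simp⟩).trans_lt
      (by exact_mod_cast h2)
  have hd : deriv riemannZeta 2 = -LSeries (logMul 1) 2 := by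
    rw [← LSeries_deriv habs]
    apply Filter.EventuallyEq.deriv_eq
    filter_upwards [isOpen_one_lt_re.mem_nhds h2] with z hz
    exact (LSeries_one_eq_riemannZeta hz).symm
  -- The constant is -ζ'(2)/ζ(2), with ζ(2) = π²/6 known exactly.
  have hL := LSeries_vonMangoldt_eq_deriv_riemannZeta_div h2
  rw [hd, neg_neg, riemannZeta_two] at hL
  have hl : (fun n : ℕ => ((Real.log n : ℝ) : ℂ)) = logMul 1 := by
    funext n; simp [logMul]
  rw [← hl] at hL
  have hsum : LSeriesSummable (fun n => ((Real.log n : ℝ) : ℂ)) ⟨2, -0⟩ := by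
    rw [hl, ofReal_two_eq]
    exact LSeriesSummable_logMul_of_lt_re habs
  have h3 := hasSum_re_lseries (a := fun n => Real.log n) (by simp) hsum
  simp only [zero_mul, Real.cos_zero, mul_one] at h3
  have h4 := sum_log_mul_rpow_le h3
  rw [ofReal_two_eq] at h4
  have e : vonMangoldtTwo = (LSeries (fun n => ((Real.log n : ℝ) : ℂ)) 2).re / (Real.pi ^ 2 / 6) := by
    rw [vonMangoldtTwo, hL]
    have : (Real.pi : ℂ) ^ 2 / 6 = ((Real.pi ^ 2 / 6 : ℝ) : ℂ) := by push_cast; ring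
    rw [this, Complex.div_ofReal_re]
  rw [e, div_lt_iff₀ (by positivity)]
  have hp := Real.pi_gt_d6
  have : 3.141592 ^ 2 < Real.pi ^ 2 := by gcongr
  norm_num at this h4 ⊢
  nlinarith

lemma vonMangoldt_two : vonMangoldt 2 = Real.log 2 := by
  simpa using vonMangoldt_apply_prime Nat.prime_two

lemma vonMangoldt_three : vonMangoldt 3 = Real.log 3 := by
  simpa using vonMangoldt_apply_prime Nat.prime_three

lemma vonMangoldt_re_le {x t : ℝ} (hx : 2 ≤ x) :
    (LSeries (fun n => (vonMangoldt n : ℂ)) ⟨x, -t⟩).re ≤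
      Real.log 2 * (2 : ℝ) ^ (-x) * Real.cos (t * Real.log 2) +
      Real.log 3 * (3 : ℝ) ^ (-x) * Real.cos (t * Real.log 3) +
      (4 : ℝ) ^ (2 - x) * (vonMangoldtTwo - Real.log 2 / 4 - Real.log 3 / 9) := by
  have h := abs_sub_sum_range_le (a := fun n => vonMangoldt n) (K := 4) (by norm_num)
    (fun _ => vonMangoldt_nonneg)
    (fun n => Real.abs_cos_le_one (t * Real.log n)) hx hasSum_vonMangoldt_two
    (hasSum_re_lseries (by simp) (x := x) (t := t)
      (LSeriesSummable_vonMangoldt (by simp; linarith)))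
  simp only [Finset.sum_range_succ, Finset.sum_range_zero] at h
  norm_num [vonMangoldt_two, vonMangoldt_three] at h
  have := (abs_le.1 h).2
  have e : ∀ a b c : ℝ, a - b / 4 - c / 9 = a - (b * (1 / 4) + c * (1 / 9)) := fun a b c => by ring
  rw [e]
  linarith

lemma vonMangoldt_im_le {x t : ℝ} (hx : 3 ≤ x) :
    (LSeries (fun n => (vonMangoldt n : ℂ)) ⟨x, -t⟩).im ≤ 0.197 := by
  have h := abs_sub_sum_range_le (a := fun n => vonMangoldt n) (K := 4) (by norm_num)
    (fun _ => vonMangoldt_nonneg)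
    (fun n => Real.abs_sin_le_one (t * Real.log n)) (by linarith : (2 : ℝ) ≤ x)
    hasSum_vonMangoldt_two
    (hasSum_im_lseries (by simp) (x := x) (t := t)
      (LSeriesSummable_vonMangoldt (by simp; linarith)))
  simp only [Finset.sum_range_succ, Finset.sum_range_zero] at h
  norm_num [vonMangoldt_two, vonMangoldt_three] at h
  have h0 := (abs_le.1 h).2
  have p2 : (2 : ℝ) ^ (-x) ≤ 1 / 8 := by
    refine (Real.rpow_le_rpow_of_exponent_le (by norm_num) (neg_le_neg hx)).trans ?_
    rw [Real.rpow_neg (by norm_num)]; norm_num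
  have p3 : (3 : ℝ) ^ (-x) ≤ 1 / 27 := by
    refine (Real.rpow_le_rpow_of_exponent_le (by norm_num) (neg_le_neg hx)).trans ?_
    rw [Real.rpow_neg (by norm_num)]; norm_num
  have p4 : (4 : ℝ) ^ (2 - x) ≤ 1 / 4 := by
    refine (Real.rpow_le_rpow_of_exponent_le (by norm_num) (by linarith : 2 - x ≤ -1)).trans ?_
    rw [Real.rpow_neg (by norm_num)]; norm_num
  have b2 := Real.log_two_lt_d9
  have b3 := Real.log_three_lt_d9
  have b2' := Real.log_two_gt_d9
  have b3' := Real.log_three_gt_d9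
  have hV := vonMangoldtTwo_lt
  have q2 : Real.log 2 * (2 : ℝ) ^ (-x) * Real.sin (t * Real.log 2) ≤ Real.log 2 * (1 / 8) * 1 := by
    calc _ ≤ Real.log 2 * (2 : ℝ) ^ (-x) * 1 := by gcongr; exact Real.sin_le_one _
      _ ≤ _ := by gcongr
  have q3 : Real.log 3 * (3 : ℝ) ^ (-x) * Real.sin (t * Real.log 3) ≤
      Real.log 3 * (1 / 27) * 1 := by
    calc _ ≤ Real.log 3 * (3 : ℝ) ^ (-x) * 1 := by gcongr; exact Real.sin_le_one _
      _ ≤ _ := by gcongr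
  have q4 : (4 : ℝ) ^ (2 - x) * (vonMangoldtTwo - (Real.log 2 * (1 / 4) + Real.log 3 * (1 / 9)))
      ≤ 1 / 4 * (0.571 - (Real.log 2 * (1 / 4) + Real.log 3 * (1 / 9))) := by
    have : (0 : ℝ) ≤ 0.571 - (Real.log 2 * (1 / 4) + Real.log 3 * (1 / 9)) := by
      norm_num; linarith
    calc _ ≤ (4 : ℝ) ^ (2 - x) * (0.571 - (Real.log 2 * (1 / 4) + Real.log 3 * (1 / 9))) := by
          gcongr
      _ ≤ _ := by gcongr
  norm_num at q4 b2 b3 b2' b3' ⊢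
  linarith

/-- Complements the constant bound `vonMangoldt_im_le` near the real axis: sin(t log n) ≤ tn costs
one power of n, which x ≥ 3 can spare. -/
lemma vonMangoldt_im_le_mul {x t : ℝ} (hx : 3 ≤ x) (ht : 0 ≤ t) :
    (LSeries (fun n => (vonMangoldt n : ℂ)) ⟨x, -t⟩).im ≤ 0.571 * t := by
  have h := hasSum_im_lseries (a := fun n => vonMangoldt n) (by simp) (x := x) (t := t)
      (LSeriesSummable_vonMangoldt (by simp; linarith))
  refine (hasSum_le (fun n => ?_) h (hasSum_vonMangoldt_two.mul_right t)).trans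
    (mul_le_mul_of_nonneg_right vonMangoldtTwo_lt.le ht)
  rcases Nat.eq_zero_or_pos n with rfl | hn
  · simp
  have hn' : (1 : ℝ) ≤ n := by exact_mod_cast hn
  have h1 : Real.sin (t * Real.log n) ≤ t * n := by
    have h2 : 0 ≤ Real.log n := Real.log_natCast_nonneg n
    refine (Real.sin_le (by positivity)).trans ?_
    gcongr
    linarith [Real.log_le_sub_one_of_pos (x := n) (by linarith)]
  have h2 : (n : ℝ) ^ (-x) * n ≤ (n : ℝ) ^ (-2 : ℝ) := by
    rw [← Real.rpow_add_one (by linarith)]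
    exact Real.rpow_le_rpow_of_exponent_le hn' (by linarith)
  calc vonMangoldt n * (n : ℝ) ^ (-x) * Real.sin (t * Real.log n)
      ≤ vonMangoldt n * (n : ℝ) ^ (-x) * (t * n) :=
        mul_le_mul_of_nonneg_left h1 (mul_nonneg vonMangoldt_nonneg (by positivity))
    _ = vonMangoldt n * ((n : ℝ) ^ (-x) * n) * t := by ring
    _ ≤ _ := by
        have : 0 ≤ vonMangoldt n := vonMangoldt_nonneg
        gcongr

/-! ### The logarithm of ζ(1 - z) and the line number -/

/-- A branch of `log ζ (1 - z)` in the quadrant `1 < Re z`, `Im z < 0`, up to an additive real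
constant, given by the functional equation. -/
noncomputable def logZetaOneSub (z : ℂ) : ℂ :=
  -z * Real.log (2 * Real.pi) + Complex.I * Real.pi * z / 2 +
    Complex.log (1 + Complex.exp (-(Complex.I * Real.pi * z))) + logGamma z + logZeta z

lemma norm_exp_neg_lt_one {z : ℂ} (hz : z.im < 0) :
    ‖Complex.exp (-(Complex.I * Real.pi * z))‖ < 1 := by
  rw [Complex.norm_exp, Real.exp_lt_one_iff]
  simp
  exact mul_neg_of_pos_of_neg Real.pi_pos hz

lemma one_add_exp_re_pos {z : ℂ} (hz : z.im < 0) :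
    0 < (1 + Complex.exp (-(Complex.I * Real.pi * z))).re := by
  have h1 := norm_exp_neg_lt_one hz
  have h2 := (abs_le.1 (Complex.abs_re_le_norm (Complex.exp (-(Complex.I * Real.pi * z))))).1
  rw [Complex.add_re, Complex.one_re]
  linarith

/-- The functional equation, with 2 cos(πz/2) factored as exp(iπz/2)(1 + exp(-iπz)). The prefactor
is positive because `logGamma` is real at 1. -/
theorem riemannZeta_one_sub_eq {z : ℂ} (hz : 1 < z.re) (hz' : z.im < 0) :
    riemannZeta (1 - z) = (Real.exp (-(logGamma 1).re) : ℂ) * Complex.exp (logZetaOneSub z) := by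
  have hg1 : logGamma 1 = ((logGamma 1).re : ℂ) :=
    Complex.ext rfl (by simpa using logGamma_ofReal_im (x := 1) le_rfl)
  have hne : (1 + Complex.exp (-(Complex.I * Real.pi * z))) ≠ 0 := by
    intro h
    have := one_add_exp_re_pos hz'
    rw [h] at this
    simp at this
  have h2pi : (2 * Real.pi : ℂ) ≠ 0 := by
    have := Real.pi_ne_zero
    exact_mod_cast mul_ne_zero two_ne_zero this
  rw [riemannZeta_one_sub (s := z), logZetaOneSub, Complex.exp_add, Complex.exp_add, Complex.exp_add,
    Complex.exp_add, Complex.exp_log hne, exp_logGamma hz.le, exp_logZeta hz, hg1,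
    Complex.ofReal_exp, Complex.ofReal_re, Complex.ofReal_neg, Complex.exp_neg,
    Complex.cpow_def_of_ne_zero h2pi, Complex.cos]
  · have e1 : Complex.log (2 * Real.pi) * -z = -z * (Real.log (2 * Real.pi) : ℂ) := by
      rw [Complex.ofReal_log (by positivity)]
      push_cast
      ring
    have e2 : Complex.exp (Real.pi * z / 2 * Complex.I) =
        Complex.exp (Complex.I * Real.pi * z / 2) := by congr 1; ring
    have e3 : Complex.exp (-(Real.pi * z / 2) * Complex.I) =
        Complex.exp (Complex.I * Real.pi * z / 2) *
          Complex.exp (-(Complex.I * Real.pi * z)) := by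
      rw [← Complex.exp_add]; congr 1; ring
    have e4 := Complex.exp_ne_zero ((logGamma 1).re : ℂ)
    rw [e1, e2, e3]
    field_simp
  · intro n h
    rw [h] at hz'
    simp at hz'
  · rintro rfl
    simp at hz'

lemma norm_riemannZeta_one_sub {z : ℂ} (hz : 1 < z.re) (hz' : z.im < 0) :
    ‖riemannZeta (1 - z)‖ = Real.exp (-(logGamma 1).re) * Real.exp (logZetaOneSub z).re := by
  rw [riemannZeta_one_sub_eq hz hz', norm_mul, Complex.norm_real, Complex.norm_exp,
    Real.norm_of_nonneg (Real.exp_pos _).le]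

/-- The derivative of `logZetaOneSub`. -/
noncomputable def logZetaOneSubDeriv (z : ℂ) : ℂ :=
  -Real.log (2 * Real.pi) + Complex.I * Real.pi / 2 *
    ((1 - Complex.exp (-(Complex.I * Real.pi * z))) /
      (1 + Complex.exp (-(Complex.I * Real.pi * z)))) +
    deriv logGamma z - LSeries (fun n => (vonMangoldt n : ℂ)) z

lemma hasDerivAt_logZetaOneSub {z : ℂ} (hz : 1 < z.re) (hz' : z.im < 0) :
    HasDerivAt logZetaOneSub (logZetaOneSubDeriv z) z := by
  have hpos := one_add_exp_re_pos hz'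
  have hne : (1 + Complex.exp (-(Complex.I * Real.pi * z))) ≠ 0 := by
    intro h; rw [h] at hpos; simp at hpos
  have d1 : HasDerivAt (fun y : ℂ => -y * Real.log (2 * Real.pi))
      (-1 * Real.log (2 * Real.pi)) z := (hasDerivAt_id z).neg.mul_const _
  have d2 : HasDerivAt (fun y : ℂ => Complex.I * Real.pi * y / 2)
      (Complex.I * Real.pi * 1 / 2) z := ((hasDerivAt_id z).const_mul _).div_const 2
  have d3 : HasDerivAt (fun y : ℂ => -(Complex.I * Real.pi * y))
      (-(Complex.I * Real.pi * 1)) z := ((hasDerivAt_id z).const_mul _).neg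
  have d4 := ((d3.cexp).const_add 1).clog (Or.inl hpos)
  have d5 : HasDerivAt logGamma (deriv logGamma z) z :=
    (hasDerivAt_logGamma hz).differentiableAt.hasDerivAt
  refine ((((d1.add d2).add d4).add d5).add (hasDerivAt_logZeta hz)).congr_deriv ?_
  rw [logZetaOneSubDeriv]
  field_simp
  ring

lemma isOpen_quadrant : IsOpen {z : ℂ | 1 < z.re ∧ z.im < 0} :=
  isOpen_one_lt_re.inter (isOpen_lt Complex.continuous_im continuous_const)

lemma continuousOn_logZetaOneSub : ContinuousOn logZetaOneSub {z : ℂ | 1 < z.re ∧ z.im < 0} :=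
  fun _ hz => (hasDerivAt_logZetaOneSub hz.1 hz.2).continuousAt.continuousWithinAt

lemma continuousOn_logZetaOneSubDeriv :
    ContinuousOn logZetaOneSubDeriv {z : ℂ | 1 < z.re ∧ z.im < 0} := by
  have h : DifferentiableOn ℂ logZetaOneSub {z : ℂ | 1 < z.re ∧ z.im < 0} :=
    fun z hz => (hasDerivAt_logZetaOneSub hz.1 hz.2).differentiableAt.differentiableWithinAt
  exact (h.deriv isOpen_quadrant).continuousOn.congr fun z hz =>
    (hasDerivAt_logZetaOneSub hz.1 hz.2).deriv.symm

/-- The mean value theorem for the real function Re(c f conj(b - a)) on the segment from a to b: its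
slope is Re(c f') |b - a|². Besides injectivity this yields the direction of motion, since equal
imaginary (or real) parts of f at a and b force one coordinate of b - a to have a definite sign. -/
lemma re_mul_sub_mul_conj_pos {f f' : ℂ → ℂ} {s : Set ℂ} (hs : Convex ℝ s)
    (hd : ∀ z ∈ s, HasDerivAt f (f' z) z) {c : ℂ} (hpos : ∀ z ∈ s, 0 < (c * f' z).re)
    {a b : ℂ} (ha : a ∈ s) (hb : b ∈ s) (hne : a ≠ b) :
    0 < (c * (f b - f a) * (starRingEnd ℂ) (b - a)).re := by
  set g : ℝ → ℝ := fun τ => (c * f (a + τ * (b - a)) * (starRingEnd ℂ) (b - a)).re with hg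
  have hmem : ∀ τ ∈ Set.Icc (0 : ℝ) 1, a + τ * (b - a) ∈ s := fun τ hτ => by
    have := hs.add_smul_sub_mem ha hb hτ
    simpa using this
  have hderiv : ∀ τ ∈ Set.Icc (0 : ℝ) 1, HasDerivAt g
      (c * (f' (a + τ * (b - a)) * (b - a)) * (starRingEnd ℂ) (b - a)).re τ := fun τ hτ => by
    have h1 : HasDerivAt (fun τ : ℂ => a + τ * (b - a)) (b - a) (τ : ℂ) := by
      simpa using ((hasDerivAt_id (τ : ℂ)).mul_const (b - a)).const_add a
    have h2 := ((hd _ (hmem τ hτ)).comp (τ : ℂ) h1).const_mul c |>.mul_const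
      ((starRingEnd ℂ) (b - a))
    exact h2.real_of_complex
  obtain ⟨τ, hτ, he⟩ := exists_hasDerivAt_eq_slope g _ zero_lt_one
    (fun τ hτ => (hderiv τ hτ).continuousAt.continuousWithinAt)
    (fun τ hτ => hderiv τ (Set.Ioo_subset_Icc_self hτ))
  have h3 : g 1 - g 0 = (c * (f b - f a) * (starRingEnd ℂ) (b - a)).re := by
    simp only [hg, ← Complex.sub_re]
    congr 1
    push_cast
    rw [one_mul, zero_mul, add_zero, add_sub_cancel]
    ring
  rw [← h3]
  have h4 : (c * (f' (a + τ * (b - a)) * (b - a)) * (starRingEnd ℂ) (b - a)).re =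
      (c * f' (a + τ * (b - a))).re * Complex.normSq (b - a) := by
    rw [← Complex.re_mul_ofReal, ← Complex.mul_conj]
    congr 1
    ring
  rw [h4] at he
  have h5 := mul_pos (hpos _ (hmem τ (Set.Ioo_subset_Icc_self hτ)))
    (Complex.normSq_pos.2 (sub_ne_zero.2 hne.symm))
  rw [he] at h5
  simpa using h5

/-- The real-valued numbering of the level lines through the points `1 - z`. -/
noncomputable def lineNumber (z : ℂ) : ℝ := 1 - 2 / Real.pi * (logZetaOneSub z).im

lemma logZetaOneSub_im (z : ℂ) :
    (logZetaOneSub z).im = Real.pi / 2 - lineNumber z * (Real.pi / 2) := by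
  rw [lineNumber]
  field_simp
  ring

/-- Up to a positive factor ζ(1 - z) is exp(i(π/2)(1 - N)) with N = `lineNumber z`. Its real part is
sin(πN/2) and its imaginary part is cos(πN/2), vanishing at even and odd integers respectively. -/
lemma one_sub_mem_levelSet_iff {z : ℂ} (hz : 1 < z.re) (hz' : z.im < 0) (n : ℤ) :
    1 - z ∈ levelSet n ↔ ∃ m : ℤ, lineNumber z = m ∧ (Even m ↔ Even n) := by
  have hC := Real.exp_pos (-(logGamma 1).re)
  have hE := Real.exp_pos (logZetaOneSub z).re
  have hre : (riemannZeta (1 - z)).re = 0 ↔ ∃ m : ℤ, lineNumber z = m ∧ Even m := by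
    rw [riemannZeta_one_sub_eq hz hz', Complex.re_ofReal_mul, Complex.exp_re,
      mul_eq_zero, mul_eq_zero, or_iff_right hC.ne', or_iff_right hE.ne', logZetaOneSub_im,
      Real.cos_pi_div_two_sub, Real.sin_eq_zero_iff]
    have hpi := Real.pi_ne_zero
    constructor
    · rintro ⟨k, hk⟩
      refine ⟨2 * k, ?_, even_two_mul k⟩
      push_cast
      field_simp at hk
      linarith
    · rintro ⟨m, hm, k, rfl⟩
      refine ⟨k, ?_⟩
      rw [hm]
      push_cast
      ring
  have him : (riemannZeta (1 - z)).im = 0 ↔ ∃ m : ℤ, lineNumber z = m ∧ ¬ Even m := by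
    rw [riemannZeta_one_sub_eq hz hz', Complex.im_ofReal_mul, Complex.exp_im,
      mul_eq_zero, mul_eq_zero, or_iff_right hC.ne', or_iff_right hE.ne', logZetaOneSub_im,
      Real.sin_pi_div_two_sub, Real.cos_eq_zero_iff]
    have hpi := Real.pi_ne_zero
    constructor
    · rintro ⟨k, hk⟩
      refine ⟨2 * k + 1, ?_, by simp⟩
      push_cast
      field_simp at hk
      linarith
    · rintro ⟨m, hm, hodd⟩
      obtain ⟨k, rfl⟩ := Int.not_even_iff_odd.1 hodd
      refine ⟨k, ?_⟩
      rw [hm]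
      push_cast
      ring
  have him0 : 0 < (1 - z).im := by simpa using hz'
  rw [levelSet, Set.mem_ofPred_eq, and_iff_right him0]
  split_ifs with h
  · rw [hre]; simp [h]
  · rw [him]; simp [h]

/-! ### Numerical bounds for the line number -/

/-- The main term of `arg ζ (1 - z)`, `z = x - i t`, by Stirling's formula. -/
noncomputable def argMain (x t : ℝ) : ℝ :=
  t * (1 + Real.log (2 * Real.pi) - Real.log (x ^ 2 + t ^ 2) / 2) -
    (x - 1 / 2) * Real.arctan (t / x)

lemma logZetaOneSub_im_eq {x t : ℝ} (hx : 1 < x) :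
    (logZetaOneSub ⟨x, -t⟩).im = Real.pi * x / 2 + argMain x t +
      (Complex.log (1 + Complex.exp (-(Complex.I * Real.pi * ⟨x, -t⟩)))).im +
      (stirlingRem ⟨x, -t⟩).im + (logZeta ⟨x, -t⟩).im := by
  have h1 : (Complex.log ⟨x, -t⟩).re = Real.log (x ^ 2 + t ^ 2) / 2 := by
    rw [Complex.log_re, Complex.norm_def, Real.log_sqrt (Complex.normSq_nonneg _),
      Complex.normSq_apply]
    congr 2
    simp only
    ring
  have h2 : (Complex.log ⟨x, -t⟩).im = -Real.arctan (t / x) := by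
    rw [Complex.log_im, arg_eq_neg_arctan (by linarith)]
  rw [logZetaOneSub, logGamma, argMain]
  simp only [Complex.add_im, Complex.sub_im, Complex.mul_im, h1, h2]
  simp
  ring

lemma exp_neg_of_odd {m : ℤ} (hm : Odd m) (t : ℝ) :
    Complex.exp (-(Complex.I * Real.pi * ⟨m, -t⟩)) = -(Real.exp (-(Real.pi * t)) : ℂ) := by
  obtain ⟨k, rfl⟩ := hm
  have e : -(Complex.I * Real.pi * (⟨((2 * k + 1 : ℤ) : ℝ), -t⟩ : ℂ)) =
      ((-(Real.pi * t) : ℝ) : ℂ) + Real.pi * Complex.I + (-(k + 1) : ℤ) * (2 * Real.pi * Complex.I) := by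
    apply Complex.ext
    · simp
    · simp; ring
  rw [e, Complex.exp_periodic.int_mul, Complex.exp_add, Complex.exp_pi_mul_I, Complex.ofReal_exp]
  ring

lemma exp_neg_of_even {m : ℤ} (hm : Even m) (t : ℝ) :
    Complex.exp (-(Complex.I * Real.pi * ⟨m, -t⟩)) = (Real.exp (-(Real.pi * t)) : ℂ) := by
  obtain ⟨k, rfl⟩ := hm
  have e : -(Complex.I * Real.pi * (⟨((k + k : ℤ) : ℝ), -t⟩ : ℂ)) =
      ((-(Real.pi * t) : ℝ) : ℂ) + (-k : ℤ) * (2 * Real.pi * Complex.I) := by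
    apply Complex.ext
    · simp
    · simp; ring
  rw [e, Complex.exp_periodic.int_mul, Complex.ofReal_exp]

/-- At integral abscissae the logarithm of the trigonometric factor is real. -/
lemma log_one_add_exp_im_intCast (m : ℤ) {t : ℝ} (ht : 0 < t) :
    (Complex.log (1 + Complex.exp (-(Complex.I * Real.pi * ⟨m, -t⟩)))).im = 0 := by
  have h1 : Real.exp (-(Real.pi * t)) < 1 := by
    rw [Real.exp_lt_one_iff]; have := Real.pi_pos; nlinarith
  have h0 := Real.exp_pos (-(Real.pi * t))
  rcases Int.even_or_odd m with hm | hm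
  · rw [exp_neg_of_even hm, ← Complex.ofReal_one, ← Complex.ofReal_add,
      ← Complex.ofReal_log (by linarith), Complex.ofReal_im]
  · rw [exp_neg_of_odd hm, ← Complex.ofReal_neg, ← Complex.ofReal_one, ← Complex.ofReal_add,
      ← Complex.ofReal_log (by linarith), Complex.ofReal_im]

lemma logZetaOneSub_im_intCast (m : ℤ) (hm : 1 < m) {t : ℝ} (ht : 0 < t) :
    (logZetaOneSub ⟨m, -t⟩).im = Real.pi * m / 2 + argMain m t +
      (stirlingRem ⟨m, -t⟩).im + (logZeta ⟨m, -t⟩).im := by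
  rw [logZetaOneSub_im_eq (by exact_mod_cast hm), log_one_add_exp_im_intCast m ht, add_zero]

lemma abs_stirlingRem_im_le {r x t : ℝ} (hr : 1 ≤ r) (hx : r ≤ x) :
    |(stirlingRem ⟨x, -t⟩).im| ≤ (2 * r + 1) / (24 * r) / r :=
  (Complex.abs_im_le_norm _).trans (norm_stirlingRem_le hr hx)

lemma two_mul_div_le_log {u : ℝ} (hu : 0 ≤ u) : 2 * u / (u + 2) ≤ Real.log (1 + u) :=
  Real.le_log_one_add_of_nonneg hu

lemma arctan_sub_nonneg_of_deriv {p p' : ℝ → ℝ} (hp : ∀ x, HasDerivAt p (p' x) x)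
    (h0 : p 0 = 0) (hle : ∀ x, p' x ≤ 1 / (1 + x ^ 2)) {u : ℝ} (hu : 0 ≤ u) :
    p u ≤ Real.arctan u := by
  have hmono : Monotone fun x => Real.arctan x - p x :=
    monotone_of_hasDerivAt_nonneg (fun x => (Real.hasDerivAt_arctan x).sub (hp x))
      fun x => sub_nonneg.2 (hle x)
  have := hmono hu
  simp only [Real.arctan_zero, h0, sub_zero] at this
  linarith

lemma sub_cube_le_arctan {u : ℝ} (hu : 0 ≤ u) : u - u ^ 3 / 3 ≤ Real.arctan u := by
  refine arctan_sub_nonneg_of_deriv (p := fun u => u - u ^ 3 / 3) (p' := fun x => 1 - x ^ 2)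
    (fun x => ?_) (by norm_num) (fun x => ?_) hu
  · refine ((hasDerivAt_id x).sub ((hasDerivAt_pow 3 x).div_const 3)).congr_deriv ?_
    norm_num
  · rw [le_div_iff₀ (by positivity)]
    nlinarith [sq_nonneg (x ^ 2)]

lemma arctan_le_self {u : ℝ} (hu : 0 ≤ u) : Real.arctan u ≤ u := by
  have hmono : Monotone fun x => x - Real.arctan x :=
    monotone_of_hasDerivAt_nonneg (fun x => (hasDerivAt_id x).sub (Real.hasDerivAt_arctan x))
      fun x => by
        rw [Pi.zero_apply, sub_nonneg]
        exact div_le_one_of_le₀ (by nlinarith [sq_nonneg x]) (by positivity)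
  have := hmono hu
  simp at this
  exact this

lemma arctan_le_quintic {u : ℝ} (hu : 0 ≤ u) :
    Real.arctan u ≤ u - u ^ 3 / 3 + u ^ 5 / 5 := by
  have hmono : Monotone fun x : ℝ => (x - x ^ 3 / 3 + x ^ 5 / 5) - Real.arctan x :=
    monotone_of_hasDerivAt_nonneg (f' := fun x => (1 - x ^ 2 + x ^ 4) - 1 / (1 + x ^ 2))
      (fun x => by
        refine ((((hasDerivAt_id x).sub ((hasDerivAt_pow 3 x).div_const 3)).add
          ((hasDerivAt_pow 5 x).div_const 5)).sub (Real.hasDerivAt_arctan x)).congr_deriv ?_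
        norm_num)
      fun x => by
        rw [Pi.zero_apply, sub_nonneg, div_le_iff₀ (by positivity)]
        nlinarith [sq_nonneg (x ^ 3)]
  have := hmono hu
  simp at this
  linarith

lemma arctan_eq_pi_div_two_sub {t x : ℝ} (ht : 0 < t) (hx : 0 < x) :
    Real.arctan (t / x) = Real.pi / 2 - Real.arctan (x / t) := by
  rw [← inv_div, Real.arctan_inv_of_pos (by positivity)]

lemma log_pi_sq_div_six_lt : Real.log (Real.pi ^ 2 / 6) < 0.4978 := by
  have h1 : Real.pi ^ 2 / 6 ≤ 5 / 3 * 0.986962 := by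
    have := Real.pi_lt_d6
    have h2 : Real.pi ^ 2 ≤ 3.141593 ^ 2 := by gcongr
    norm_num at h2 ⊢
    linarith
  have h2 := Real.log_le_log (by positivity) h1
  have e : Real.log (5 / 3 * 0.986962) = Real.log 5 - Real.log 3 + Real.log 0.986962 := by
    rw [Real.log_mul (by norm_num) (by norm_num), Real.log_div (by norm_num) (by norm_num)]
  rw [e] at h2
  have h3 := Real.log_le_sub_one_of_pos (x := 0.986962) (by norm_num)
  have h4 := Real.log_five_lt_d9
  have h5 := Real.log_three_gt_d9
  norm_num at h4 h5
  linarith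

lemma log_two_pi_gt : 1.83786 < Real.log (2 * Real.pi) := by
  have h1 : 2 * 3 * (1 + 0.047197) ≤ 2 * Real.pi := by
    have := Real.pi_gt_d6
    norm_num at this ⊢
    linarith
  have h2 := Real.log_le_log (by norm_num) h1
  rw [Real.log_mul (by norm_num) (by norm_num), Real.log_mul (by norm_num) (by norm_num)] at h2
  have h3 := two_mul_div_le_log (u := 0.047197) (by norm_num)
  have h4 := Real.log_two_gt_d9
  have h5 := Real.log_three_gt_d9
  norm_num at *
  linarith

lemma log_two_pi_lt : Real.log (2 * Real.pi) < 1.83789 := by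
  have h1 : 2 * Real.pi ≤ 2 * 3 * (1 - (-0.047198)) := by
    have := Real.pi_lt_d6
    norm_num at this ⊢
    linarith
  have h2 := Real.log_le_log (by positivity) h1
  have e : Real.log (2 * 3 * (1 - (-0.047198))) =
      Real.log 2 + Real.log 3 + Real.log (1 - (-0.047198)) := by
    rw [Real.log_mul (by norm_num) (by norm_num), Real.log_mul (by norm_num) (by norm_num)]
  rw [e] at h2
  have h3 := (abs_le.1 (Real.abs_log_sub_add_sum_range_le (x := -0.047198)
    (by norm_num [abs_lt]) 3)).2
  rw [show |(-0.047198 : ℝ)| = 0.047198 by norm_num [abs_of_nonpos]] at h3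
  have h4 := Real.log_two_lt_d9
  have h5 := Real.log_three_lt_d9
  norm_num [Finset.sum_range_succ] at h3 h4 h5
  norm_num1 at h2
  linarith

lemma hasDerivAt_argMain {x t : ℝ} (hx : 0 < x) :
    HasDerivAt (argMain x)
      (Real.log (2 * Real.pi) - Real.log (x ^ 2 + t ^ 2) / 2 + x / 2 / (x ^ 2 + t ^ 2)) t := by
  have hpos : x ^ 2 + t ^ 2 ≠ 0 := by positivity
  have d1 : HasDerivAt (fun t : ℝ => x ^ 2 + t ^ 2) (2 * t) t := by
    simpa using (hasDerivAt_pow 2 t).const_add (x ^ 2)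
  have d2 := ((d1.log hpos).div_const 2).const_sub (1 + Real.log (2 * Real.pi))
  have d3 := (hasDerivAt_id t).mul d2
  have d4 := (((hasDerivAt_id t).div_const x).arctan).const_mul (x - 1 / 2)
  refine (d3.sub d4).congr_deriv ?_
  simp only [id]
  have : 1 + (t / x) ^ 2 = (x ^ 2 + t ^ 2) / x ^ 2 := by field_simp
  rw [this]
  field_simp
  ring

/-- `argMain x` is concave, so it lies below its tangents. -/
lemma argMain_le_tangent {x t s : ℝ} (hx : 0 < x) (ht : 0 ≤ t) (hs : 0 ≤ s) :
    argMain x t ≤ argMain x s + (Real.log (2 * Real.pi) - Real.log (x ^ 2 + s ^ 2) / 2 +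
      x / 2 / (x ^ 2 + s ^ 2)) * (t - s) := by
  have hconc : ConcaveOn ℝ (Set.Ici 0) (argMain x) := by
    have hcont : Continuous (argMain x) :=
      continuous_iff_continuousAt.2 fun t => (hasDerivAt_argMain (t := t) hx).continuousAt
    refine AntitoneOn.concaveOn_of_deriv (convex_Ici 0) hcont.continuousOn
      (fun t _ => (hasDerivAt_argMain hx).differentiableAt.differentiableWithinAt) ?_
    rw [interior_Ici]
    intro a ha b hb hab
    rw [(hasDerivAt_argMain hx).deriv, (hasDerivAt_argMain hx).deriv]
    have ha' : (0 : ℝ) < a := ha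
    have h1 : x ^ 2 + a ^ 2 ≤ x ^ 2 + b ^ 2 := by gcongr
    have h2 : Real.log (x ^ 2 + a ^ 2) ≤ Real.log (x ^ 2 + b ^ 2) :=
      Real.log_le_log (by positivity) h1
    have h3 : x / 2 / (x ^ 2 + b ^ 2) ≤ x / 2 / (x ^ 2 + a ^ 2) := by gcongr
    linarith
  have hd := hasDerivAt_argMain (t := s) hx
  rcases lt_trichotomy t s with h | rfl | h
  · have := hconc.le_slope_of_hasDerivAt (x := t) (y := s) ht hs h hd
    rw [slope_def_field, le_div_iff₀ (by linarith)] at this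
    linarith
  · simp
  · have := hconc.slope_le_of_hasDerivAt (x := s) (y := t) hs ht h hd
    rw [slope_def_field, div_le_iff₀ (by linarith)] at this
    linarith

lemma lineNumber_intCast (m : ℤ) (hm : 1 < m) {t : ℝ} (ht : 0 < t) :
    lineNumber ⟨m, -t⟩ = 1 - m - 2 / Real.pi * (argMain m t +
      (stirlingRem ⟨m, -t⟩).im + (logZeta ⟨m, -t⟩).im) := by
  rw [lineNumber, logZetaOneSub_im_intCast m hm ht]
  have := Real.pi_ne_zero
  field_simp
  ring

lemma argMain_two_eq {t : ℝ} (ht : 0 < t) :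
    argMain 2 t = t * (1 + Real.log (2 * Real.pi) - Real.log t) - 3 * Real.pi / 4 +
      (3 / 2 * Real.arctan (2 / t) - t / 2 * Real.log (1 + (2 / t) ^ 2)) := by
  have e : Real.log (2 ^ 2 + t ^ 2) = 2 * Real.log t + Real.log (1 + (2 / t) ^ 2) := by
    rw [show (2 : ℝ) * Real.log t = Real.log (t ^ 2) by rw [Real.log_pow]; norm_num,
      ← Real.log_mul (by positivity) (by positivity)]
    congr 1
    field_simp
    ring
  rw [argMain, e, arctan_eq_pi_div_two_sub ht two_pos]
  ring

/-- The correction behaves like 3/t - 2/t = 1/t. The value 0.2297 is just above 3/t - 2t/(t² + 2) at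
t = 5. -/
lemma correction_bounds {t : ℝ} (ht : 5 ≤ t) :
    1 / t - 4 / t ^ 3 ≤ 3 / 2 * Real.arctan (2 / t) - t / 2 * Real.log (1 + (2 / t) ^ 2) ∧
      3 / 2 * Real.arctan (2 / t) - t / 2 * Real.log (1 + (2 / t) ^ 2) < 0.2297 := by
  have ht0 : 0 < t := by linarith
  have hu : 0 ≤ 2 / t := by positivity
  have a1 := sub_cube_le_arctan hu
  have a2 := arctan_le_self hu
  have l1 := Real.log_le_sub_one_of_pos (x := 1 + (2 / t) ^ 2) (by positivity)
  have l2 := two_mul_div_le_log (u := (2 / t) ^ 2) (by positivity)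
  constructor
  · have h1 : t / 2 * Real.log (1 + (2 / t) ^ 2) ≤ t / 2 * (2 / t) ^ 2 := by
      gcongr
      linarith
    have e : 1 / t - 4 / t ^ 3 = 3 / 2 * (2 / t - (2 / t) ^ 3 / 3) - t / 2 * (2 / t) ^ 2 := by
      field_simp
      ring
    rw [e]
    linarith
  · have h1 : t / 2 * (2 * (2 / t) ^ 2 / ((2 / t) ^ 2 + 2)) ≤
        t / 2 * Real.log (1 + (2 / t) ^ 2) := by gcongr
    have e : 3 / 2 * (2 / t) - t / 2 * (2 * (2 / t) ^ 2 / ((2 / t) ^ 2 + 2)) =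
        3 / t - 2 * t / (t ^ 2 + 2) := by
      have : t ^ 2 * 2 + 2 ^ 2 ≠ 0 := by positivity
      field_simp
      ring
    have h2 : 3 / t - 2 * t / (t ^ 2 + 2) < 0.2297 := by
      rw [div_sub_div _ _ (by positivity) (by positivity), div_lt_iff₀ (by positivity)]
      nlinarith [mul_nonneg (sub_nonneg.2 ht) (sq_nonneg t), mul_nonneg (sub_nonneg.2 ht) ht0.le]
    linarith

/-- The minimum is attained at t = 2π. It makes the function of the theorem at least -4 + 1/2. -/
lemma two_pi_mul_log_ge {t : ℝ} (ht : 0 < t) :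
    -(2 * Real.pi) ≤ t * Real.log (t / (2 * Real.pi)) - t := by
  have hp := Real.pi_pos
  have h := Real.one_sub_inv_le_log_of_pos (x := t / (2 * Real.pi)) (by positivity)
  have h2 := mul_le_mul_of_nonneg_left h ht.le
  rw [inv_div, mul_sub, mul_one, mul_div_cancel₀ _ ht.ne'] at h2
  linarith

/-- The function of `t` in the theorem is within `1 / 2` of the real-valued line number. -/
theorem abs_lineNumber_two_sub_lt {t : ℝ} (ht : 5 < t) :
    |2 * t / Real.pi * Real.log (t / (2 * Real.pi)) - 2 * t / Real.pi + 1 / 2 -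
      lineNumber ⟨2, -t⟩| < 1 / 2 := by
  have ht0 : 0 < t := by linarith
  have hp := Real.pi_pos
  have h1 := lineNumber_intCast 2 (by norm_num) ht0
  have hE := abs_stirlingRem_im_le (r := 2) (x := 2) (t := t) (by norm_num) le_rfl
  have hg := norm_logZeta_le (x := 2) (t := t) le_rfl
  have hl := log_pi_sq_div_six_lt
  obtain ⟨c1, c2⟩ := correction_bounds ht.le
  have c0 : 0 ≤ 1 / t - 4 / t ^ 3 := by
    rw [sub_nonneg, div_le_div_iff₀ (by positivity) (by positivity)]
    nlinarith [sq_nonneg t]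
  push_cast at h1
  rw [h1, argMain_two_eq ht0, Real.log_div ht0.ne' (by positivity)]
  set c := 3 / 2 * Real.arctan (2 / t) - t / 2 * Real.log (1 + (2 / t) ^ 2)
  set E := (stirlingRem ⟨2, -t⟩).im
  set g := (logZeta ⟨2, -t⟩).im
  have e : 2 * t / Real.pi * (Real.log t - Real.log (2 * Real.pi)) - 2 * t / Real.pi + 1 / 2 -
      (1 - 2 - 2 / Real.pi * (t * (1 + Real.log (2 * Real.pi) - Real.log t) - 3 * Real.pi / 4 + c +
        E + g)) = 2 / Real.pi * (c + E + g) := by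
    field_simp
    ring
  rw [e, abs_mul, abs_of_pos (by positivity : 0 < 2 / Real.pi), div_mul_eq_mul_div,
    div_lt_iff₀ hp]
  -- The three bounds add up to less than 0.7797, while π/4 > 0.785.
  have h2 : |c + E + g| ≤ 0.2297 + 5 / 96 + 0.4978 := by
    refine (abs_add_three _ _ _).trans ?_
    rw [abs_of_nonneg (c0.trans c1)]
    norm_num at *
    linarith
  have := Real.pi_gt_d6
  norm_num at *
  linarith

/-- For t > 5 the function of the theorem is at least -7/2 and differs from N by less than 1/2. For
t ≤ 5 concavity suffices: the slope of `argMain 2` at 5 is nonnegative, so its value there is an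
upper bound. -/
lemma neg_four_lt_lineNumber_two {t : ℝ} (ht : 0 < t) : -4 < lineNumber ⟨2, -t⟩ := by
  have hp := Real.pi_pos
  rcases lt_or_ge 5 t with h5 | h5
  · have h := (abs_lt.1 (abs_lineNumber_two_sub_lt h5)).2
    have h1 := two_pi_mul_log_ge ht
    have h2 : -4 ≤ 2 * t / Real.pi * Real.log (t / (2 * Real.pi)) - 2 * t / Real.pi := by
      have : 2 / Real.pi * -(2 * Real.pi) ≤
          2 / Real.pi * (t * Real.log (t / (2 * Real.pi)) - t) := by gcongr
      have e1 : 2 / Real.pi * -(2 * Real.pi) = -4 := by field_simp; norm_num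
      have e2 : 2 / Real.pi * (t * Real.log (t / (2 * Real.pi)) - t) =
        2 * t / Real.pi * Real.log (t / (2 * Real.pi)) - 2 * t / Real.pi := by ring
      linarith
    linarith
  · have h1 := lineNumber_intCast 2 (by norm_num) ht
    have hE := (abs_le.1 (abs_stirlingRem_im_le (r := 2) (x := 2) (t := t) (by norm_num) le_rfl)).2
    have hg := (abs_le.1 (norm_logZeta_le (x := 2) (t := t) le_rfl)).2
    have hl := log_pi_sq_div_six_lt
    push_cast at h1
    have htan := argMain_le_tangent (x := 2) (t := t) (s := 5) two_pos ht.le (by norm_num)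
    -- The number 29 = 2² + 5² is enclosed by 144/5 and 30, which have only the prime factors 2, 3,
    -- 5.
    have l29 : Real.log (144 / 5) ≤ Real.log (2 ^ 2 + 5 ^ 2) :=
      Real.log_le_log (by norm_num) (by norm_num)
    have l29' : Real.log (2 ^ 2 + 5 ^ 2) ≤ Real.log 30 :=
      Real.log_le_log (by norm_num) (by norm_num)
    rw [show (144 / 5 : ℝ) = 2 ^ 4 * 3 ^ 2 / 5 by norm_num, Real.log_div (by norm_num) (by norm_num),
      Real.log_mul (by norm_num) (by norm_num), Real.log_pow, Real.log_pow] at l29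
    rw [show (30 : ℝ) = 2 * 3 * 5 by norm_num, Real.log_mul (by norm_num) (by norm_num),
      Real.log_mul (by norm_num) (by norm_num)] at l29'
    have b2 := Real.log_two_gt_d9
    have b3 := Real.log_three_gt_d9
    have b5 := Real.log_five_lt_d9
    have b2' := Real.log_two_lt_d9
    have b3' := Real.log_three_lt_d9
    have p1 := log_two_pi_gt
    have p2 := log_two_pi_lt
    have hpi := Real.pi_gt_d6
    have ha := arctan_le_self (u := 2 / 5) (by norm_num)
    have hslope : 0 ≤ Real.log (2 * Real.pi) - Real.log (2 ^ 2 + 5 ^ 2) / 2 +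
        2 / 2 / (2 ^ 2 + 5 ^ 2) := by
      norm_num at *
      linarith
    have h2 : argMain 2 t ≤ argMain 2 5 := by nlinarith
    have h3 : argMain 2 5 < 4.1 := by
      rw [argMain, arctan_eq_pi_div_two_sub (by norm_num) two_pos]
      norm_num at *
      linarith
    rw [h1]
    have h4 : 2 / Real.pi * (argMain 2 t + (stirlingRem ⟨2, -t⟩).im + (logZeta ⟨2, -t⟩).im) < 3 := by
      rw [div_mul_eq_mul_div, div_lt_iff₀ hp]
      norm_num at *
      linarith
    linarith

/-- A concave function on an interval is at least the smaller of its end values. -/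
lemma le_mul_sub_log_of_mem_Icc {L a b m t : ℝ} (ha : 0 < a) (h1 : a ≤ t) (h2 : t ≤ b)
    (hma : m ≤ a * (1 + L - Real.log a)) (hmb : m ≤ b * (1 + L - Real.log b)) :
    m ≤ t * (1 + L - Real.log t) := by
  have hconc : ConcaveOn ℝ (Set.Ici 0) fun t : ℝ => t * (1 + L - Real.log t) := by
    have h := (Real.convexOn_mul_log.neg).add
      ((LinearMap.mulRight ℝ (1 + L)).concaveOn (convex_Ici (0 : ℝ)))
    refine h.congr fun t _ => ?_
    simp only [Pi.add_apply, Pi.neg_apply, LinearMap.mulRight_apply]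
    ring
  have := hconc.min_le_of_mem_Icc (x := a) (y := b) ha.le (ha.le.trans (h1.trans h2)) ⟨h1, h2⟩
  exact (le_min hma hmb).trans this

lemma neg_le_logZeta_im {x t : ℝ} (hx : 2 ≤ x) {δ : ℝ} (hδ : 0 ≤ δ)
    (hs : -δ ≤ Real.sin (t * Real.log 2)) :
    -(0.2478 + δ / 4) ≤ (logZeta ⟨x, -t⟩).im := by
  have h := (abs_le.1 (abs_logZeta_im_sub_le (x := x) (t := t) hx)).1
  have hl := log_pi_sq_div_six_lt
  have p3 : (3 : ℝ) ^ (-(x - 2)) ≤ 1 := Real.rpow_le_one_of_one_le_of_nonpos (by norm_num)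
    (by linarith)
  have p2 : (2 : ℝ) ^ (-x) ≤ 1 / 4 := by
    refine (Real.rpow_le_rpow_of_exponent_le (by norm_num) (neg_le_neg hx)).trans ?_
    rw [Real.rpow_neg (by norm_num)]; norm_num
  have p2' : (0 : ℝ) < (2 : ℝ) ^ (-x) := by positivity
  have p3' : (0 : ℝ) < (3 : ℝ) ^ (-(x - 2)) := by positivity
  have q : (3 : ℝ) ^ (-(x - 2)) * (Real.log (Real.pi ^ 2 / 6) - 1 / 4) ≤ 0.2478 := by
    calc _ ≤ (3 : ℝ) ^ (-(x - 2)) * (0.4978 - 1 / 4) := by gcongr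
      _ ≤ 1 * (0.4978 - 1 / 4) := by
        refine mul_le_mul_of_nonneg_right p3 (by norm_num)
      _ = 0.2478 := by norm_num
  have r : (2 : ℝ) ^ (-x) * -δ ≤ (2 : ℝ) ^ (-x) * Real.sin (t * Real.log 2) := by gcongr
  nlinarith

lemma neg_le_sin_of_near_two_pi {y δ : ℝ} (h1 : 2 * Real.pi - y ≤ δ) (h2 : 0 ≤ 2 * Real.pi - y) :
    -δ ≤ Real.sin y := by
  have := Real.sin_le h2
  rw [Real.sin_two_pi_sub] at this
  linarith

/-- Together with N > -4 this excludes integers N for 5 < t ≤ 9. The crude bound on log ζ is enough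
at first. Towards t = 9, t log 2 approaches 2π from below, so the contribution of the prime 2 is
only slightly negative. -/
lemma lineNumber_two_lt_neg_three {t : ℝ} (ht : 5 < t) (ht' : t ≤ 9) :
    lineNumber ⟨2, -t⟩ < -3 := by
  have ht0 : 0 < t := by linarith
  have hp := Real.pi_pos
  have hpi := Real.pi_lt_d6
  have hpi' := Real.pi_gt_d6
  have h1 := lineNumber_intCast 2 (by norm_num) ht0
  have hE := (abs_le.1 (abs_stirlingRem_im_le (r := 2) (x := 2) (t := t) (by norm_num) le_rfl)).1
  have hg := (abs_le.1 (norm_logZeta_le (x := 2) (t := t) le_rfl)).1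
  have hl := log_pi_sq_div_six_lt
  obtain ⟨c1, -⟩ := correction_bounds ht.le
  push_cast at h1
  rw [h1, argMain_two_eq ht0]
  set c := 3 / 2 * Real.arctan (2 / t) - t / 2 * Real.log (1 + (2 / t) ^ 2)
  set E := (stirlingRem ⟨2, -t⟩).im
  set L := Real.log (2 * Real.pi)
  have b2 := Real.log_two_gt_d9
  have b3 := Real.log_three_gt_d9
  have b5 := Real.log_five_lt_d9
  have b2' := Real.log_two_lt_d9
  have b3' := Real.log_three_lt_d9
  have b5' := Real.log_five_gt_d9
  have p1 := log_two_pi_gt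
  -- The subdivision points 135/16 and 2187/250 are chosen with prime factors 2, 3, 5 only.
  have e1 : Real.log (135 / 16) = 3 * Real.log 3 + Real.log 5 - 4 * Real.log 2 := by
    rw [show (135 / 16 : ℝ) = 3 ^ 3 * 5 / 2 ^ 4 by norm_num,
      Real.log_div (by norm_num) (by norm_num), Real.log_mul (by norm_num) (by norm_num),
      Real.log_pow, Real.log_pow]
    norm_num
  have e2 : Real.log (2187 / 250) = 7 * Real.log 3 - (Real.log 2 + 3 * Real.log 5) := by
    rw [show (2187 / 250 : ℝ) = 3 ^ 7 / (2 * 5 ^ 3) by norm_num,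
      Real.log_div (by norm_num) (by norm_num), Real.log_mul (by norm_num) (by norm_num),
      Real.log_pow, Real.log_pow]
    norm_num
  have e3 : Real.log 9 = 2 * Real.log 3 := by
    rw [show (9 : ℝ) = 3 ^ 2 by norm_num, Real.log_pow]; norm_num
  -- the lower bound for the correction is decreasing in `t`
  have hc : ∀ s : ℝ, t ≤ s → 1 / s - 4 / s ^ 3 ≤ c := by
    intro s hs
    refine le_trans ?_ c1
    have hs0 : 0 < s := by linarith
    have i1 : 1 / s ≤ 1 / 5 := one_div_le_one_div_of_le (by norm_num) (by linarith)
    have i2 : 1 / t ≤ 1 / 5 := one_div_le_one_div_of_le (by norm_num) (by linarith)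
    have i3 : 1 / s ≤ 1 / t := one_div_le_one_div_of_le ht0 hs
    have i0 : 0 < 1 / s := by positivity
    have e : ∀ r : ℝ, 1 / r - 4 / r ^ 3 = 1 / r - 4 * (1 / r) ^ 3 := fun r => by
      rw [div_pow, one_pow]; ring
    rw [e, e]
    nlinarith [mul_nonneg (sub_nonneg.2 i3) (sub_nonneg.2 i1),
      mul_nonneg (sub_nonneg.2 i3) (sub_nonneg.2 i2), mul_pos i0 (i0.trans_le i3),
      mul_nonneg (sub_nonneg.2 i3) (mul_nonneg (sub_nonneg.2 i1) i0.le),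
      mul_nonneg (sub_nonneg.2 i3) (mul_nonneg (sub_nonneg.2 i2) (i0.trans_le i3).le),
      mul_nonneg (sub_nonneg.2 i3) (mul_nonneg (sub_nonneg.2 i1) (i0.trans_le i3).le)]
  have m1 : t * 0.6931471803 ≤ t * Real.log 2 := by gcongr
  have m2 : t * Real.log 2 ≤ t * 0.6931471808 := by gcongr
  norm_num1 at hE hg hl hpi hpi' b2 b3 b5 b2' b3' b5' p1 m1 m2
  have key : Real.pi < t * (1 + L - Real.log t) - 3 * Real.pi / 4 + c + E +
      (logZeta ⟨2, -t⟩).im := by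
    rcases le_total t (135 / 16) with h | h
    · have hh := le_mul_sub_log_of_mem_Icc (L := L) (a := 5) (b := 135 / 16) (m := 5.9498)
        (by norm_num) ht.le h (by norm_num1; linarith) (by rw [e1]; norm_num1; linarith)
      have := hc _ h
      norm_num1 at this hh
      linarith
    rcases le_total t (2187 / 250) with h' | h'
    · have hh := le_mul_sub_log_of_mem_Icc (L := L) (a := 135 / 16) (b := 2187 / 250) (m := 5.8520)
        (by norm_num) h h' (by rw [e1]; norm_num1; linarith)
        (by rw [e2]; norm_num1; linarith)
      have := hc _ h'
      have hs := neg_le_logZeta_im (x := 2) (t := t) le_rfl (δ := 0.45) (by norm_num)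
        (neg_le_sin_of_near_two_pi (by norm_num1; linarith) (by linarith))
      norm_num1 at this hh hs
      linarith
    · have hh := le_mul_sub_log_of_mem_Icc (L := L) (a := 2187 / 250) (b := 9) (m := 5.7654)
        (by norm_num) h' ht' (by rw [e2]; norm_num1; linarith)
        (by rw [e3]; norm_num1; linarith)
      have := hc _ ht'
      have hs := neg_le_logZeta_im (x := 2) (t := t) le_rfl (δ := 0.22) (by norm_num)
        (neg_le_sin_of_near_two_pi (by norm_num1; linarith) (by linarith))
      norm_num1 at this hh hs
      linarith
  have h2 : 2 < 2 / Real.pi * (t * (1 + L - Real.log t) - 3 * Real.pi / 4 + c + E +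
      (logZeta ⟨2, -t⟩).im) := by
    rw [div_mul_eq_mul_div, lt_div_iff₀ hp]
    linarith
  linarith

/-- The tangent is taken at 29/5, close to the maximum, so its slope lies between -0.004 and 0 and
costs little for any t ≥ 0. -/
lemma argMain_three_lt {t : ℝ} (ht : 0 ≤ t) : argMain 3 t < 2.88 := by
  have htan := argMain_le_tangent (x := 3) (t := t) (s := 29 / 5) (by norm_num) ht (by norm_num)
  have p1 := log_two_pi_gt
  have p2 := log_two_pi_lt
  have b2 := Real.log_two_gt_d9
  have b3 := Real.log_three_gt_d9
  have b2' := Real.log_two_lt_d9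
  have b3' := Real.log_three_lt_d9
  have hpi := Real.pi_gt_d6
  have ha := arctan_le_quintic (u := 15 / 29) (by norm_num)
  have e0 : Real.log (3 ^ 2 + (29 / 5) ^ 2) = 7 * Real.log 2 - Real.log 3 + Real.log 0.999375 := by
    rw [show (3 ^ 2 + (29 / 5) ^ 2 : ℝ) = 2 ^ 7 / 3 * 0.999375 by norm_num,
      Real.log_mul (by norm_num) (by norm_num), Real.log_div (by norm_num) (by norm_num),
      Real.log_pow]
    norm_num
  have l1 := Real.log_le_sub_one_of_pos (x := 0.999375) (by norm_num)
  have l2 := Real.one_sub_inv_le_log_of_pos (x := 0.999375) (by norm_num)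
  have hB : argMain 3 (29 / 5) < 2.8475 := by
    rw [argMain, e0, arctan_eq_pi_div_two_sub (by norm_num) (by norm_num)]
    norm_num at *
    linarith
  rw [e0] at htan
  have hs1 : Real.log (2 * Real.pi) - (7 * Real.log 2 - Real.log 3 + Real.log 0.999375) / 2 +
      3 / 2 / (3 ^ 2 + (29 / 5) ^ 2) ≤ 0 := by
    norm_num at *; linarith
  have hs2 : -0.004 ≤ Real.log (2 * Real.pi) -
      (7 * Real.log 2 - Real.log 3 + Real.log 0.999375) / 2 + 3 / 2 / (3 ^ 2 + (29 / 5) ^ 2) := by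
    norm_num at *; linarith
  nlinarith

/-- Places the curve N = -4 at abscissas beyond 3, where Im L' > 0 is available. The margin is
small, so the prime 2 is separated from the rest of log ζ. -/
lemma neg_four_lt_lineNumber_three {t : ℝ} (ht : 0 < t) :
    -4 < lineNumber ⟨3, -t⟩ := by
  have hp := Real.pi_pos
  have h1 := lineNumber_intCast 3 (by norm_num) ht
  have hE := (abs_le.1 (abs_stirlingRem_im_le (r := 3) (x := 3) (t := t) (by norm_num) le_rfl)).2
  have hg := (abs_le.1 (abs_logZeta_im_sub_le (x := 3) (t := t) (by norm_num))).2
  have hl := log_pi_sq_div_six_lt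
  have hpi := Real.pi_gt_d6
  have hB := argMain_three_lt ht.le
  have hs := Real.sin_le_one (t * Real.log 2)
  have r2 : (2 : ℝ) ^ (-3 : ℝ) = 1 / 8 := by rw [Real.rpow_neg (by norm_num)]; norm_num
  have r3 : (3 : ℝ) ^ (-((3 : ℝ) - 2)) = 1 / 3 := by
    rw [show -((3 : ℝ) - 2) = -1 by norm_num, Real.rpow_neg_one]; norm_num
  rw [r2, r3] at hg
  push_cast at h1
  rw [h1]
  have h4 : 2 / Real.pi * (argMain 3 t + (stirlingRem ⟨3, -t⟩).im + (logZeta ⟨3, -t⟩).im) < 2 := by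
    rw [div_mul_eq_mul_div, div_lt_iff₀ hp]
    norm_num at *
    linarith
  linarith

/-- Bounds the curve N = -4 on the other side: it meets the border only above height 9. At x = 31
the term 1 - x = -30 outweighs crude bounds for the rest. -/
lemma lineNumber_thirty_one_lt {t : ℝ} (ht : 0 < t) (ht' : t ≤ 9) :
    lineNumber ⟨31, -t⟩ < -4 := by
  have hp := Real.pi_pos
  have h1 := lineNumber_intCast 31 (by norm_num) ht
  have hE := (abs_le.1 (abs_stirlingRem_im_le (r := 2) (x := 31) (t := t) (by norm_num)
    (by norm_num))).1
  have hg := (abs_le.1 (norm_logZeta_le (x := 31) (t := t) (by norm_num))).1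
  have hl := log_pi_sq_div_six_lt
  have hpi := Real.pi_gt_d6
  have p1 := log_two_pi_gt
  have b2 := Real.log_two_lt_d9
  have l1 : Real.log (31 ^ 2 + t ^ 2) ≤ 11 * Real.log 2 := by
    rw [show (11 : ℝ) * Real.log 2 = Real.log (2 ^ 11) by rw [Real.log_pow]; norm_num]
    exact Real.log_le_log (by positivity) (by nlinarith)
  have ha := arctan_le_self (u := t / 31) (by positivity)
  push_cast at h1
  rw [h1]
  have hB : -40 ≤ argMain 31 t := by
    have : argMain 31 t = t * (1 + Real.log (2 * Real.pi) - Real.log (31 ^ 2 + t ^ 2) / 2) -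
      (31 - 1 / 2) * Real.arctan (t / 31) := rfl
    have h3 : t * (1 + 1.83786 - 11 * 0.6931471808 / 2) ≤
        t * (1 + Real.log (2 * Real.pi) - Real.log (31 ^ 2 + t ^ 2) / 2) := by
      gcongr
      norm_num at *
      linarith
    norm_num at *
    linarith
  have h4 : -26 < 2 / Real.pi * (argMain 31 t + (stirlingRem ⟨31, -t⟩).im +
      (logZeta ⟨31, -t⟩).im) := by
    rw [div_mul_eq_mul_div, lt_div_iff₀ hp]
    norm_num at *
    linarith
  linarith

lemma exp_neg_nat_le (n : ℕ) : Real.exp (-n) ≤ (1 / 2) ^ n := by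
  rw [Real.exp_neg, ← Real.exp_one_pow, one_div, inv_pow]
  have := Real.exp_one_gt_d9
  gcongr
  norm_num at *
  linarith

lemma norm_exp_eq (x t : ℝ) :
    ‖Complex.exp (-(Complex.I * Real.pi * ⟨x, -t⟩))‖ = Real.exp (-(Real.pi * t)) := by
  rw [Complex.norm_exp]
  simp

lemma exp_neg_pi_mul_nine_le {t : ℝ} (ht : 9 ≤ t) : Real.exp (-(Real.pi * t)) ≤ 1 / 100000 := by
  have hp := Real.pi_gt_three
  have h := exp_neg_nat_le 27
  have : Real.exp (-(Real.pi * t)) ≤ Real.exp (-(27 : ℕ)) := by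
    apply Real.exp_le_exp.2
    push_cast
    nlinarith
  exact this.trans (h.trans (by norm_num))

/-- The real-valued line number at height `9` lies below `-3`. -/
lemma lineNumber_nine_lt {x : ℝ} (hx : 2 ≤ x) : lineNumber ⟨x, -9⟩ < -3 := by
  have hp := Real.pi_pos
  have hpi := Real.pi_lt_d6
  have hpi' := Real.pi_gt_d6
  have h1 := logZetaOneSub_im_eq (x := x) (t := 9) (by linarith)
  have hE := (abs_le.1 (abs_stirlingRem_im_le (r := 2) (x := x) (t := 9) (by norm_num) hx)).1
  have b2 := Real.log_two_gt_d9
  have b3 := Real.log_three_gt_d9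
  have b2' := Real.log_two_lt_d9
  have b3' := Real.log_three_lt_d9
  have p1 := log_two_pi_gt
  have hg := neg_le_logZeta_im (x := x) (t := 9) hx (δ := 0.046) (by norm_num)
        (neg_le_sin_of_near_two_pi (by norm_num at *; linarith) (by norm_num at *; linarith))
  have hψ : -(1 / 1000) ≤
      (Complex.log (1 + Complex.exp (-(Complex.I * Real.pi * ⟨x, -9⟩)))).im := by
    have hq := norm_exp_eq x 9
    have hq' := exp_neg_pi_mul_nine_le (t := 9) le_rfl
    rw [← hq] at hq'
    have := Complex.norm_log_one_add_half_le_self (hq'.trans (by norm_num))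
    have := (abs_le.1 ((Complex.abs_im_le_norm _).trans this)).1
    norm_num at *
    linarith
  -- The main part increases with x, since its derivative is arctan(x/9) - (9/2)/(x² + 81); only x =
  -- 2 needs a numerical value.
  have hmono : Real.pi * 2 / 2 + argMain 2 9 ≤ Real.pi * x / 2 + argMain x 9 := by
    have hd : ∀ y : ℝ, 0 < y → HasDerivAt (fun y => Real.pi * y / 2 + argMain y 9)
        (Real.pi / 2 - Real.arctan (9 / y) - 9 / 2 / (y ^ 2 + 9 ^ 2)) y := by
      intro y hy
      have hpos : y ^ 2 + 9 ^ 2 ≠ 0 := by positivity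
      have d1 : HasDerivAt (fun y : ℝ => y ^ 2 + 9 ^ 2) (2 * y) y := by
        simpa using (hasDerivAt_pow 2 y).add_const (9 ^ 2 : ℝ)
      have d2 := (((d1.log hpos).div_const 2).const_sub (1 + Real.log (2 * Real.pi))).const_mul 9
      have d3 := (hasDerivAt_id y).sub_const (1 / 2 : ℝ)
      have d4 : HasDerivAt (fun y : ℝ => 9 / y) (-9 / y ^ 2) y := by
        simpa [div_eq_mul_inv] using (hasDerivAt_inv hy.ne').const_mul 9
      have d5 := d3.mul d4.arctan
      have d6 := ((hasDerivAt_id y).const_mul Real.pi).div_const 2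
      refine (d6.add (d2.sub d5)).congr_deriv ?_
      simp only [id]
      have : 1 + (9 / y) ^ 2 = (y ^ 2 + 9 ^ 2) / y ^ 2 := by field_simp
      rw [this]
      field_simp
      ring
    have hm : MonotoneOn (fun y => Real.pi * y / 2 + argMain y 9) (Set.Ici 2) := by
      refine monotoneOn_of_deriv_nonneg (convex_Ici 2)
        (fun y hy => (hd y (by have : (2 : ℝ) ≤ y := hy; linarith)).continuousAt.continuousWithinAt)
        ?_ ?_
      · intro y hy
        rw [interior_Ici] at hy
        have : (2 : ℝ) < y := hy
        exact (hd y (by linarith)).differentiableAt.differentiableWithinAt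
      · intro y hy
        rw [interior_Ici] at hy
        have hy2 : (2 : ℝ) < y := hy
        have hy0 : 0 < y := by linarith
        rw [(hd y hy0).deriv, arctan_eq_pi_div_two_sub (by norm_num) hy0]
        have h3 := div_one_add_sq_le_arctan (u := y / 9) (by positivity)
        have h4 : 9 / 2 / (y ^ 2 + 9 ^ 2) ≤ y / 9 / (1 + (y / 9) ^ 2) := by
          have : 1 + (y / 9) ^ 2 = (y ^ 2 + 9 ^ 2) / 9 ^ 2 := by field_simp; ring
          rw [this, div_div_eq_mul_div]
          gcongr
          linarith
        linarith
    exact hm (Set.mem_Ici.2 le_rfl) hx hx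
  have hB : 3.49 < argMain 2 9 := by
    have ha := sub_cube_le_arctan (u := 2 / 9) (by norm_num)
    have l1 := Real.log_le_sub_one_of_pos (x := 85 / 81) (by norm_num)
    have e0 : Real.log (2 ^ 2 + 9 ^ 2) = 4 * Real.log 3 + Real.log (85 / 81) := by
      rw [show (2 ^ 2 + 9 ^ 2 : ℝ) = 3 ^ 4 * (85 / 81) by norm_num,
        Real.log_mul (by norm_num) (by norm_num), Real.log_pow]
      norm_num
    rw [argMain, e0, arctan_eq_pi_div_two_sub (by norm_num) two_pos]
    norm_num at *
    linarith
  rw [lineNumber]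
  have h4 : 4 < 2 / Real.pi * (logZetaOneSub ⟨x, -9⟩).im := by
    rw [div_mul_eq_mul_div, lt_div_iff₀ hp, h1]
    norm_num at *
    linarith
  linarith

lemma exists_le_lineNumber {x : ℝ} (hx : 2 ≤ x) (n : ℝ) :
    ∃ t, 9 ≤ t ∧ n ≤ lineNumber ⟨x, -t⟩ := by
  have hp := Real.pi_pos
  set L := Real.log (2 * Real.pi)
  -- From exp(2 + L) on, `argMain x T` is at most -T; the third entry absorbs the linear terms and,
  -- through the 3, all error terms.
  set T := max 9 (max (Real.exp (2 + L)) (Real.pi / 2 * (n + x) + 3)) with hT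
  have hT9 : 9 ≤ T := le_max_left _ _
  have hT0 : 0 < T := by linarith
  have hT1 : Real.exp (2 + L) ≤ T := (le_max_left _ _).trans (le_max_right _ _)
  have hT2 : Real.pi / 2 * (n + x) + 3 ≤ T := (le_max_right _ _).trans (le_max_right _ _)
  refine ⟨T, hT9, ?_⟩
  have h1 := logZetaOneSub_im_eq (x := x) (t := T) (by linarith)
  have hE := (abs_le.1 (abs_stirlingRem_im_le (r := 2) (x := x) (t := T) (by norm_num) hx)).2
  have hg := (abs_le.1 (norm_logZeta_le (x := x) (t := T) hx)).2
  have hl := log_pi_sq_div_six_lt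
  have hψ : (Complex.log (1 + Complex.exp (-(Complex.I * Real.pi * ⟨x, -T⟩)))).im ≤
      Real.pi / 2 := by
    rw [Complex.log_im]
    exact ((abs_lt.1 (Complex.abs_arg_lt_pi_div_two_iff.2
      (Or.inl (one_add_exp_re_pos (by simpa using hT0))))).2).le
  have hlog : 2 * (2 + L) ≤ Real.log (x ^ 2 + T ^ 2) := by
    have h2 : Real.log (T ^ 2) ≤ Real.log (x ^ 2 + T ^ 2) :=
      Real.log_le_log (by positivity) (by nlinarith)
    have h3 := (Real.le_log_iff_exp_le hT0).2 hT1
    rw [Real.log_pow] at h2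
    push_cast at h2
    linarith
  have hB : argMain x T ≤ -T := by
    rw [argMain]
    have h2 : 0 ≤ (x - 1 / 2) * Real.arctan (T / x) :=
      mul_nonneg (by linarith) (Real.arctan_nonneg.2 (by positivity))
    have h3 : T * (1 + L - Real.log (x ^ 2 + T ^ 2) / 2) ≤ T * (-1) := by
      gcongr
      linarith
    linarith
  have hpi := Real.pi_lt_d6
  rw [lineNumber, h1]
  have h5 : 2 / Real.pi * (Real.pi * x / 2 + argMain x T +
      (Complex.log (1 + Complex.exp (-(Complex.I * Real.pi * ⟨x, -T⟩)))).im +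
      (stirlingRem ⟨x, -T⟩).im + (logZeta ⟨x, -T⟩).im) ≤ 1 - n := by
    rw [div_mul_eq_mul_div, div_le_iff₀ hp]
    norm_num at *
    linarith
  linarith

/-! ### Signs of the derivative of log ζ(1 - z) -/

lemma cos_le_of_le_sub_two_pi {θ Y : ℝ} (h0 : 0 ≤ Y) (h1 : Y ≤ 1) (hY : Y ≤ θ - 2 * Real.pi)
    (hθ : θ - 2 * Real.pi ≤ Real.pi) : Real.cos θ ≤ 1 - Y ^ 2 / 2 + 5 / 96 * Y ^ 4 := by
  rw [← Real.cos_sub_two_pi θ]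
  have h2 := Real.cos_le_cos_of_nonneg_of_le_pi h0 hθ hY
  have h3 := (abs_le.1 (Real.cos_bound (x := Y) (by rwa [abs_of_nonneg h0]))).2
  rw [abs_of_nonneg h0] at h3
  linarith

lemma cos_eq_neg_cos_sub_three_pi (θ : ℝ) : Real.cos θ = -Real.cos (θ - 3 * Real.pi) := by
  rw [show θ - 3 * Real.pi = θ - Real.pi - 2 * Real.pi by ring, Real.cos_sub_two_pi,
    Real.cos_sub_pi, neg_neg]

lemma cos_le_neg_of_sub_three_pi_le {θ Y : ℝ} (h0 : 0 ≤ θ - 3 * Real.pi)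
    (hY : θ - 3 * Real.pi ≤ Y) : Real.cos θ ≤ -(1 - Y ^ 2 / 2) := by
  rw [cos_eq_neg_cos_sub_three_pi]
  have := Real.one_sub_sq_div_two_le_cos (x := θ - 3 * Real.pi)
  have : (θ - 3 * Real.pi) ^ 2 ≤ Y ^ 2 := by gcongr
  linarith

lemma cos_le_of_sub_three_pi_le {θ C : ℝ} (h0 : 0 ≤ θ - 3 * Real.pi) (hC : 0 ≤ C)
    (h : θ - 3 * Real.pi - Real.pi / 2 ≤ C) : Real.cos θ ≤ C := by
  have hp := Real.pi_pos
  rw [cos_eq_neg_cos_sub_three_pi, ← Real.sin_sub_pi_div_two]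
  rcases le_total 0 (θ - 3 * Real.pi - Real.pi / 2) with h1 | h1
  · exact (Real.sin_le h1).trans h
  · exact (Real.sin_nonpos_of_nonpos_of_neg_pi_le h1 (by linarith)).trans hC

/-- Reduces x ≥ 2 to x = 2. With p = 2^(2-x) and q = 3^(2-x) the bound becomes pA + q(log 3/9)C₃,
where p² ≤ q ≤ 1; the loss from a negative C₃ is covered by A ≥ 2 log 3/9. -/
lemma vonMangoldt_re_le_of_cos_le {x t C₂ C₃ : ℝ} (hx : 2 ≤ x)
    (h2 : Real.cos (t * Real.log 2) ≤ C₂) (h3 : Real.cos (t * Real.log 3) ≤ C₃)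
    (hC2 : 0 ≤ C₂) (hC3 : -1 ≤ C₃) :
    (LSeries (fun n => (vonMangoldt n : ℂ)) ⟨x, -t⟩).re ≤
      0.571 - Real.log 2 / 4 * (1 - C₂) - Real.log 3 / 9 * (1 - C₃) := by
  have h := vonMangoldt_re_le (t := t) hx
  have b2 := Real.log_two_gt_d9
  have b3 := Real.log_three_gt_d9
  have b2' := Real.log_two_lt_d9
  have b3' := Real.log_three_lt_d9
  have hV := vonMangoldtTwo_lt
  norm_num1 at b2 b3 b2' b3' hV
  set p : ℝ := (2 : ℝ) ^ (2 - x) with hp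
  set q : ℝ := (3 : ℝ) ^ (2 - x) with hq
  have hp0 : 0 < p := by positivity
  have hq0 : 0 < q := by positivity
  have hp1 : p ≤ 1 := Real.rpow_le_one_of_one_le_of_nonpos (by norm_num) (by linarith)
  have hq1 : q ≤ 1 := Real.rpow_le_one_of_one_le_of_nonpos (by norm_num) (by linarith)
  have e2 : (2 : ℝ) ^ (-x) = p / 4 := by
    rw [hp, Real.rpow_sub (by norm_num), Real.rpow_neg (by norm_num)]; norm_num; ring
  have e3 : (3 : ℝ) ^ (-x) = q / 9 := by
    rw [hq, Real.rpow_sub (by norm_num), Real.rpow_neg (by norm_num)]; norm_num; ring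
  have e4 : (4 : ℝ) ^ (2 - x) = p ^ 2 := by
    rw [hp, ← Real.rpow_natCast, ← Real.rpow_mul (by norm_num), mul_comm, Real.rpow_mul (by norm_num)]
    norm_num
  have hpq : p ^ 2 ≤ q := by
    rw [← e4, hq]
    exact Real.rpow_le_rpow_of_nonpos (by norm_num) (by norm_num) (by linarith)
  rw [e2, e3, e4] at h
  have i2 : Real.log 2 * (p / 4) * Real.cos (t * Real.log 2) ≤ Real.log 2 * (p / 4) * C₂ := by
    gcongr
  have i3 : Real.log 3 * (q / 9) * Real.cos (t * Real.log 3) ≤ Real.log 3 * (q / 9) * C₃ := by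
    gcongr
  have i4 : p ^ 2 * (vonMangoldtTwo - Real.log 2 / 4 - Real.log 3 / 9) ≤
      p * (571 / 1000 - Real.log 2 / 4 - Real.log 3 / 9) := by
    calc _ ≤ p ^ 2 * (571 / 1000 - Real.log 2 / 4 - Real.log 3 / 9) := by gcongr
      _ ≤ _ := mul_le_mul_of_nonneg_right (by nlinarith) (by linarith)
  set A := 571 / 1000 - Real.log 2 / 4 * (1 - C₂) - Real.log 3 / 9 with hA
  have hA0 : Real.log 3 * 2 / 9 ≤ A := by
    have : 0 ≤ Real.log 2 / 4 * C₂ := by positivity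
    rw [hA]
    linarith
  have key : p * A + q * (Real.log 3 / 9 * C₃) ≤ A + Real.log 3 / 9 * C₃ := by
    have j1 : 1 - q ≤ 2 * (1 - p) := by nlinarith [sq_nonneg (1 - p)]
    have j2 : -(Real.log 3 / 9 * C₃) * (1 - q) ≤ Real.log 3 / 9 * (1 - q) := by
      refine mul_le_mul_of_nonneg_right ?_ (by linarith)
      have : Real.log 3 / 9 * -1 ≤ Real.log 3 / 9 * C₃ := by gcongr
      linarith
    have j3 : Real.log 3 / 9 * (1 - q) ≤ Real.log 3 / 9 * (2 * (1 - p)) := by gcongr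
    have j4 : Real.log 3 * 2 / 9 * (1 - p) ≤ A * (1 - p) :=
      mul_le_mul_of_nonneg_right hA0 (by linarith)
    linarith
  norm_num1
  rw [hA] at key
  linarith

/-- The real part is (1 - |q|²)/|1 + q|², and |1 + q| ≤ 1 + |q|. -/
lemma re_one_sub_div_one_add_ge {q : ℂ} (hq : ‖q‖ < 1) :
    (1 - ‖q‖) / (1 + ‖q‖) ≤ ((1 - q) / (1 + q)).re := by
  have hne : 1 + q ≠ 0 := by
    intro h
    have : q = -1 := by linear_combination h
    rw [this] at hq
    simp at hq
  have hpos : 0 < Complex.normSq (1 + q) := Complex.normSq_pos.2 hne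
  have e : ((1 - q) / (1 + q)).re = (1 - ‖q‖ ^ 2) / Complex.normSq (1 + q) := by
    rw [Complex.div_re, ← add_div, ← Complex.normSq_eq_norm_sq, Complex.normSq_apply q]
    congr 1
    simp
    ring
  have h1 : Complex.normSq (1 + q) ≤ (1 + ‖q‖) ^ 2 := by
    rw [Complex.normSq_eq_norm_sq]
    gcongr
    simpa using norm_add_le 1 q
  have h0 := norm_nonneg q
  rw [e]
  calc (1 - ‖q‖) / (1 + ‖q‖) = (1 - ‖q‖ ^ 2) / (1 + ‖q‖) ^ 2 := by field_simp; ring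
    _ ≤ _ := by
      have : 0 ≤ 1 - ‖q‖ ^ 2 := by nlinarith
      gcongr

lemma abs_im_one_sub_div_one_add_le {q : ℂ} (hq : ‖q‖ ≤ 1 / 2) :
    |((1 - q) / (1 + q)).im| ≤ 4 * ‖q‖ := by
  have h1 : 1 / 2 ≤ ‖1 + q‖ := by
    have := norm_sub_norm_le (1 : ℂ) (-q)
    rw [norm_one, norm_neg, sub_neg_eq_add] at this
    linarith
  have hne : 1 + q ≠ 0 := by
    intro h
    rw [h, norm_zero] at h1
    linarith
  have e : (1 - q) / (1 + q) = 1 - 2 * q / (1 + q) := by field_simp; ring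
  rw [e, Complex.sub_im, Complex.one_im, zero_sub, abs_neg]
  refine (Complex.abs_im_le_norm _).trans ?_
  rw [norm_div, norm_mul, div_le_iff₀ (by linarith)]
  have : ‖(2 : ℂ)‖ = 2 := by simp
  rw [this]
  nlinarith [norm_nonneg q]

/-- Reduces positivity to a numerical inequality at the left end a of a range of t. In it 1.83789
bounds log 2π, 0.0067 covers the digamma error 1/153 and the trigonometric term, and 9/4 = (3/2)²
comes from x - 1/2 ≥ 3/2. -/
lemma logZetaOneSubDeriv_re_pos_of_bounds {x t a C₂ C₃ : ℝ} (hx : 2 ≤ x) (ha : 9 ≤ a)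
    (hat : a ≤ t) (h2 : Real.cos (t * Real.log 2) ≤ C₂) (h3 : Real.cos (t * Real.log 3) ≤ C₃)
    (hC2 : 0 ≤ C₂) (hC3 : -1 ≤ C₃)
    (hnum : 0.571 - Real.log 2 / 4 * (1 - C₂) - Real.log 3 / 9 * (1 - C₃) + 0.0067 + 1.83789 ≤
      Real.log (9 / 4 + a ^ 2) / 2) :
    0 < (logZetaOneSubDeriv ⟨x, -t⟩).re := by
  have hV := vonMangoldt_re_le_of_cos_le hx h2 h3 hC2 hC3
  have hψ := log_norm_sub_le_deriv_logGamma_re hx (ha.trans hat)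
  have hL := log_two_pi_lt
  have hlog : Real.log (9 / 4 + a ^ 2) / 2 ≤ Real.log ‖(⟨x - 1 / 2, -t⟩ : ℂ)‖ := by
    rw [Complex.norm_def, Real.log_sqrt (Complex.normSq_nonneg _), Complex.normSq_apply]
    have : Real.log (9 / 4 + a ^ 2) ≤ Real.log ((x - 1 / 2) * (x - 1 / 2) + -t * -t) :=
      Real.log_le_log (by positivity) (by nlinarith)
    linarith
  set q := Complex.exp (-(Complex.I * Real.pi * ⟨x, -t⟩)) with hq
  have hqn : ‖q‖ ≤ 1 / 100000 := by
    rw [hq, norm_exp_eq]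
    exact exp_neg_pi_mul_nine_le (ha.trans hat)
  have him := (abs_le.1 (abs_im_one_sub_div_one_add_le (hqn.trans (by norm_num)))).2
  have hpi := Real.pi_lt_d6
  have hp := Real.pi_pos
  have e : (logZetaOneSubDeriv ⟨x, -t⟩).re = -Real.log (2 * Real.pi) -
      Real.pi / 2 * ((1 - q) / (1 + q)).im + (deriv logGamma ⟨x, -t⟩).re -
      (LSeries (fun n => (vonMangoldt n : ℂ)) ⟨x, -t⟩).re := by
    rw [logZetaOneSubDeriv, ← hq]
    have : Complex.I * Real.pi / 2 * ((1 - q) / (1 + q)) =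
        ((Real.pi / 2 : ℝ) : ℂ) * (Complex.I * ((1 - q) / (1 + q))) := by push_cast; ring
    rw [this, Complex.sub_re, Complex.add_re, Complex.add_re, Complex.re_ofReal_mul,
      Complex.I_mul_re, ← Complex.ofReal_neg, Complex.ofReal_re]
    ring
  rw [e]
  have h5 : Real.pi / 2 * ((1 - q) / (1 + q)).im ≤ 0.0001 := by
    calc _ ≤ Real.pi / 2 * (4 * (1 / 100000)) := by gcongr; linarith
      _ ≤ _ := by norm_num at *; linarith
  norm_num1 at *
  linarith

/-- Far above the real axis the modulus of `ζ` increases to the left. -/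
theorem logZetaOneSubDeriv_re_pos {x t : ℝ} (hx : 2 ≤ x) (ht : 9 ≤ t) :
    0 < (logZetaOneSubDeriv ⟨x, -t⟩).re := by
  have b2 := Real.log_two_gt_d9
  have b3 := Real.log_three_gt_d9
  have b5 := Real.log_five_gt_d9
  have b2' := Real.log_two_lt_d9
  have b3' := Real.log_three_lt_d9
  have b5' := Real.log_five_lt_d9
  have hpi := Real.pi_gt_d6
  have hpi' := Real.pi_lt_d6
  have ht0 : 0 < t := by linarith
  have m1 : t * 0.6931471803 ≤ t * Real.log 2 := by gcongr
  have m2 : t * Real.log 2 ≤ t * 0.6931471808 := by gcongr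
  have m3 : t * 1.0986122885 ≤ t * Real.log 3 := by gcongr
  have m4 : t * Real.log 3 ≤ t * 1.0986122888 := by gcongr
  norm_num1 at b2 b3 b5 b2' b3' b5' hpi hpi' m1 m2 m3 m4
  -- Just above height 9 the angle t log 3 is slightly past 3π, so the prime 3 helps; once that gain
  -- fades, t log 2 is far enough past 2π for the prime 2 to take over. The subdivision follows this
  -- exchange.
  rcases le_total t (46 / 5) with h1 | h1
  · refine logZetaOneSubDeriv_re_pos_of_bounds hx (a := 9) (C₂ := 1) (C₃ := -(1 - 0.683 ^ 2 / 2))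
      le_rfl ht (Real.cos_le_one _) (cos_le_neg_of_sub_three_pi_le (by linarith)
        (by norm_num1; linarith)) (by norm_num) (by norm_num) ?_
    have e : Real.log (9 / 4 + 9 ^ 2) = 4 * Real.log 3 + Real.log (1 + 1 / 36) := by
      rw [show (9 / 4 + 9 ^ 2 : ℝ) = 3 ^ 4 * (1 + 1 / 36) by norm_num,
        Real.log_mul (by norm_num) (by norm_num), Real.log_pow]
      norm_num
    have l := two_mul_div_le_log (u := 1 / 36) (by norm_num)
    rw [e]
    norm_num1 at l ⊢
    linarith
  rcases le_total t (47 / 5) with h2 | h2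
  · refine logZetaOneSubDeriv_re_pos_of_bounds hx (a := 46 / 5) (C₂ := 1)
      (C₃ := -(1 - 0.903 ^ 2 / 2)) (by norm_num) h1 (Real.cos_le_one _)
      (cos_le_neg_of_sub_three_pi_le (by linarith) (by norm_num1; linarith))
      (by norm_num) (by norm_num) ?_
    have e : Real.log (9 / 4 + (46 / 5) ^ 2) =
        4 * Real.log 2 + 3 * Real.log 3 - Real.log 5 + Real.log (1 + 49 / 8640) := by
      rw [show (9 / 4 + (46 / 5) ^ 2 : ℝ) = 2 ^ 4 * 3 ^ 3 / 5 * (1 + 49 / 8640) by norm_num,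
        Real.log_mul (by norm_num) (by norm_num), Real.log_div (by norm_num) (by norm_num),
        Real.log_mul (by norm_num) (by norm_num), Real.log_pow, Real.log_pow]
      norm_num
    have l := two_mul_div_le_log (u := 49 / 8640) (by norm_num)
    rw [e]
    norm_num1 at l ⊢
    linarith
  rcases le_total t (48 / 5) with h3 | h3
  · refine logZetaOneSubDeriv_re_pos_of_bounds hx (a := 47 / 5) (C₂ := 1)
      (C₃ := -(1 - 1.1222 ^ 2 / 2)) (by norm_num) h2 (Real.cos_le_one _)
      (cos_le_neg_of_sub_three_pi_le (by linarith) (by norm_num1; linarith))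
      (by norm_num) (by norm_num) ?_
    have e : Real.log (9 / 4 + (47 / 5) ^ 2) =
        Real.log 2 + 2 * Real.log 3 + Real.log 5 + Real.log (1 + 61 / 9000) := by
      rw [show (9 / 4 + (47 / 5) ^ 2 : ℝ) = 2 * 3 ^ 2 * 5 * (1 + 61 / 9000) by norm_num,
        Real.log_mul (by norm_num) (by norm_num), Real.log_mul (by norm_num) (by norm_num),
        Real.log_mul (by norm_num) (by norm_num), Real.log_pow]
      norm_num
    have l := two_mul_div_le_log (u := 61 / 9000) (by norm_num)
    rw [e]
    norm_num1 at l ⊢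
    linarith
  rcases le_total t (49 / 5) with h4 | h4
  · refine logZetaOneSubDeriv_re_pos_of_bounds hx (a := 48 / 5)
      (C₂ := 1 - 0.371 ^ 2 / 2 + 5 / 96 * 0.371 ^ 4)
      (C₃ := -(1 - 1.342 ^ 2 / 2)) (by norm_num) h3
      (cos_le_of_le_sub_two_pi (by norm_num) (by norm_num) (by norm_num1; linarith) (by linarith))
      (cos_le_neg_of_sub_three_pi_le (by linarith) (by norm_num1; linarith))
      (by norm_num) (by norm_num) ?_
    have e : Real.log (9 / 4 + (48 / 5) ^ 2) =
        Real.log 3 + 3 * Real.log 5 - 2 * Real.log 2 + Real.log (1 + 22 / 3125) := by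
      rw [show (9 / 4 + (48 / 5) ^ 2 : ℝ) = 3 * 5 ^ 3 / 2 ^ 2 * (1 + 22 / 3125) by norm_num,
        Real.log_mul (by norm_num) (by norm_num), Real.log_div (by norm_num) (by norm_num),
        Real.log_mul (by norm_num) (by norm_num), Real.log_pow, Real.log_pow]
      norm_num
    have l := two_mul_div_le_log (u := 22 / 3125) (by norm_num)
    rw [e]
    norm_num1 at l ⊢
    linarith
  rcases le_total t 10 with h5 | h5
  · refine logZetaOneSubDeriv_re_pos_of_bounds hx (a := 49 / 5)
      (C₂ := 1 - 0.5 ^ 2 / 2 + 5 / 96 * 0.5 ^ 4) (C₃ := 0) (by norm_num) h4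
      (cos_le_of_le_sub_two_pi (by norm_num) (by norm_num) (by norm_num1; linarith) (by linarith))
      (cos_le_of_sub_three_pi_le (by linarith) le_rfl (by linarith))
      (by norm_num) (by norm_num) ?_
    have e : Real.log (486 / 5) = Real.log 2 + 5 * Real.log 3 - Real.log 5 := by
      rw [show (486 / 5 : ℝ) = 2 * 3 ^ 5 / 5 by norm_num,
        Real.log_div (by norm_num) (by norm_num),
        Real.log_mul (by norm_num) (by norm_num), Real.log_pow]
      norm_num
    have l : Real.log (486 / 5) ≤ Real.log (9 / 4 + (49 / 5) ^ 2) :=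
      Real.log_le_log (by norm_num) (by norm_num)
    rw [e] at l
    norm_num1 at l ⊢
    linarith
  have e100 : Real.log 100 = 2 * Real.log 2 + 2 * Real.log 5 := by
    rw [show (100 : ℝ) = 2 ^ 2 * 5 ^ 2 by norm_num,
      Real.log_mul (by norm_num) (by norm_num), Real.log_pow, Real.log_pow]
    norm_num
  rcases le_total t (41 / 4) with h6 | h6
  · refine logZetaOneSubDeriv_re_pos_of_bounds hx (a := 10)
      (C₂ := 1 - 0.6 ^ 2 / 2 + 5 / 96 * 0.6 ^ 4) (C₃ := 0.266) (by norm_num) h5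
      (cos_le_of_le_sub_two_pi (by norm_num) (by norm_num) (by norm_num1; linarith) (by linarith))
      (cos_le_of_sub_three_pi_le (by linarith) (by norm_num) (by norm_num1; linarith))
      (by norm_num) (by norm_num) ?_
    have l : Real.log 100 ≤ Real.log (9 / 4 + 10 ^ 2) :=
      Real.log_le_log (by norm_num) (by norm_num)
    rw [e100] at l
    norm_num1 at l ⊢
    linarith
  rcases le_total t (21 / 2) with h7 | h7
  · refine logZetaOneSubDeriv_re_pos_of_bounds hx (a := 41 / 4)
      (C₂ := 1 - 0.8 ^ 2 / 2 + 5 / 96 * 0.8 ^ 4) (C₃ := 0.541) (by norm_num) h6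
      (cos_le_of_le_sub_two_pi (by norm_num) (by norm_num) (by norm_num1; linarith) (by linarith))
      (cos_le_of_sub_three_pi_le (by linarith) (by norm_num) (by norm_num1; linarith))
      (by norm_num) (by norm_num) ?_
    have e : Real.log (320 / 3) = 6 * Real.log 2 + Real.log 5 - Real.log 3 := by
      rw [show (320 / 3 : ℝ) = 2 ^ 6 * 5 / 3 by norm_num,
        Real.log_div (by norm_num) (by norm_num),
        Real.log_mul (by norm_num) (by norm_num), Real.log_pow]
      norm_num
    have l : Real.log (320 / 3) ≤ Real.log (9 / 4 + (41 / 4) ^ 2) :=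
      Real.log_le_log (by norm_num) (by norm_num)
    rw [e] at l
    norm_num1 at l ⊢
    linarith
  rcases le_total t (23 / 2) with h8 | h8
  · refine logZetaOneSubDeriv_re_pos_of_bounds hx (a := 21 / 2)
      (C₂ := 1 - 0.99 ^ 2 / 2 + 5 / 96 * 0.99 ^ 4) (C₃ := 1) (by norm_num) h7
      (cos_le_of_le_sub_two_pi (by norm_num) (by norm_num) (by norm_num1; linarith) (by linarith))
      (Real.cos_le_one _) (by norm_num) (by norm_num) ?_
    have e : Real.log (9 / 4 + (21 / 2) ^ 2) = 2 * Real.log 3 + 2 * Real.log 5 - Real.log 2 := by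
      rw [show (9 / 4 + (21 / 2) ^ 2 : ℝ) = 3 ^ 2 * 5 ^ 2 / 2 by norm_num,
        Real.log_div (by norm_num) (by norm_num),
        Real.log_mul (by norm_num) (by norm_num), Real.log_pow, Real.log_pow]
      norm_num
    rw [e]
    norm_num1
    linarith
  -- From here on the logarithm alone is large enough, and both cosines may be bounded by 1.
  · refine logZetaOneSubDeriv_re_pos_of_bounds hx (a := 23 / 2) (C₂ := 1) (C₃ := 1)
      (by norm_num) h8 (Real.cos_le_one _) (Real.cos_le_one _) (by norm_num) (by norm_num) ?_
    have e : Real.log (400 / 3) = 4 * Real.log 2 + 2 * Real.log 5 - Real.log 3 := by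
      rw [show (400 / 3 : ℝ) = 2 ^ 4 * 5 ^ 2 / 3 by norm_num,
        Real.log_div (by norm_num) (by norm_num),
        Real.log_mul (by norm_num) (by norm_num), Real.log_pow, Real.log_pow]
      norm_num
    have l : Real.log (400 / 3) ≤ Real.log (9 / 4 + (23 / 2) ^ 2) :=
      Real.log_le_log (by norm_num) (by norm_num)
    rw [e] at l
    norm_num1 at l ⊢
    linarith

/-- Close to the real axis the modulus of `ζ` increases upwards along level lines. -/
theorem logZetaOneSubDeriv_im_pos {x t : ℝ} (hx : 3 ≤ x) (ht : 0 < t) (ht' : t ≤ 9) :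
    0 < (logZetaOneSubDeriv ⟨x, -t⟩).im := by
  have hp := Real.pi_pos
  have hpi := Real.pi_gt_d6
  have hpi' := Real.pi_lt_d6
  set q := Complex.exp (-(Complex.I * Real.pi * ⟨x, -t⟩)) with hq
  have hqn : ‖q‖ = Real.exp (-(Real.pi * t)) := norm_exp_eq x t
  have hq1 : ‖q‖ < 1 := by
    rw [hqn, Real.exp_lt_one_iff]; nlinarith
  have hre := re_one_sub_div_one_add_ge hq1
  have hψ := neg_arctan_le_deriv_logGamma_im (x := x) (by linarith) ht
  have e : (logZetaOneSubDeriv ⟨x, -t⟩).im = Real.pi / 2 * ((1 - q) / (1 + q)).re +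
      (deriv logGamma ⟨x, -t⟩).im - (LSeries (fun n => (vonMangoldt n : ℂ)) ⟨x, -t⟩).im := by
    rw [logZetaOneSubDeriv, ← hq]
    have : Complex.I * Real.pi / 2 * ((1 - q) / (1 + q)) =
        ((Real.pi / 2 : ℝ) : ℂ) * (Complex.I * ((1 - q) / (1 + q))) := by push_cast; ring
    rw [this, Complex.sub_im, Complex.add_im, Complex.add_im, Complex.im_ofReal_mul,
      Complex.I_mul_im, ← Complex.ofReal_neg, Complex.ofReal_im]
    ring
  have hat : Real.arctan (t / (x - 1)) ≤ Real.arctan (t / 2) := by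
    apply Real.arctan_strictMono.monotone
    gcongr
    linarith
  have hV1 := vonMangoldt_im_le (x := x) (t := t) hx
  have hV2 := vonMangoldt_im_le_mul (x := x) (t := t) hx ht.le
  -- a lower bound for the trigonometric term in terms of an upper bound for `‖q‖`
  have htrig : ∀ r, ‖q‖ ≤ r → Real.pi / 2 * ((1 - r) / (1 + r)) ≤
      Real.pi / 2 * ((1 - q) / (1 + q)).re := by
    intro r hr
    refine mul_le_mul_of_nonneg_left (le_trans ?_ hre) (by positivity)
    have h0 := norm_nonneg q
    rw [div_le_div_iff₀ (by linarith) (by linarith)]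
    nlinarith
  rw [e]
  -- Everything vanishes linearly as t → 0, so slopes are compared: the trigonometric term has slope
  -- at least 1.0711, against 1/2 from the arctangent and 0.571 from -ζ'/ζ. Further up, constant
  -- bounds suffice.
  rcases le_total t (4 / 5) with h1 | h1
  · have hqr : ‖q‖ ≤ 1 / (1 + Real.pi * t) := by
      rw [hqn, Real.exp_neg, ← one_div]
      apply one_div_le_one_div_of_le (by positivity)
      linarith [Real.add_one_le_exp (Real.pi * t)]
    have h2 := htrig _ hqr
    have e2 : Real.pi / 2 * ((1 - 1 / (1 + Real.pi * t)) / (1 + 1 / (1 + Real.pi * t))) =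
        Real.pi ^ 2 * t / (2 * (Real.pi * t + 2)) := by
      field_simp
      ring
    have h3 : 1.0711 * t ≤ Real.pi ^ 2 * t / (2 * (Real.pi * t + 2)) := by
      rw [le_div_iff₀ (by positivity)]
      have h4 : 1.0711 * (2 * (Real.pi * t + 2)) ≤ Real.pi ^ 2 := by
        norm_num at *
        nlinarith
      nlinarith
    have ha := arctan_le_self (u := t / 2) (by positivity)
    norm_num1 at *
    linarith
  have hexp : ∀ n : ℕ, (n : ℝ) ≤ Real.pi * t → ‖q‖ ≤ (1 / 2) ^ n := fun n hn => by
    rw [hqn]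
    exact (Real.exp_le_exp.2 (neg_le_neg hn)).trans (exp_neg_nat_le n)
  rcases le_total t 3 with h2 | h2
  · have hqr : ‖q‖ ≤ 0.085 := by
      have h3 : Real.exp (-(Real.pi * t)) ≤ Real.exp (-(5 / 2)) := by
        apply Real.exp_le_exp.2
        norm_num at *
        nlinarith
      have h4 : Real.exp (-(5 / 2)) ^ 2 ≤ 0.085 ^ 2 := by
        rw [← Real.exp_nat_mul]
        have h5 : ((2 : ℕ) : ℝ) * -(5 / 2) = -5 := by norm_num
        rw [h5, Real.exp_neg, ← Real.exp_one_rpow, ← Real.rpow_natCast]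
        have := Real.exp_one_gt_d9
        have h6 : (2.7 : ℝ) ^ (5 : ℝ) ≤ Real.exp 1 ^ (5 : ℝ) := by
          gcongr
          norm_num at *
          linarith
        rw [inv_le_comm₀ (by positivity) (by positivity)]
        refine le_trans ?_ h6
        norm_num
      have h5 := le_of_sq_le_sq h4 (by norm_num)
      rw [hqn]
      exact h3.trans h5
    have h3 := htrig _ hqr
    have h4 : Real.arctan (t / 2) ≤ Real.pi / 2 - 0.5 := by
      have h5 : Real.arctan (t / 2) ≤ Real.arctan (3 / 2) := by
        apply Real.arctan_strictMono.monotone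
        gcongr
      rw [arctan_eq_pi_div_two_sub (t := 3) (by norm_num) two_pos] at h5
      have := sub_cube_le_arctan (u := 2 / 3) (by norm_num)
      norm_num1 at this ⊢
      linarith
    norm_num1 at *
    linarith
  · have hqr := hexp 9 (by push_cast; nlinarith)
    have h3 := htrig _ hqr
    have h4 : Real.arctan (t / 2) ≤ Real.pi / 2 - 0.2185 := by
      have h5 : Real.arctan (t / 2) ≤ Real.arctan (9 / 2) := by
        apply Real.arctan_strictMono.monotone
        gcongr
      rw [arctan_eq_pi_div_two_sub (t := 9) (by norm_num) two_pos] at h5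
      have := sub_cube_le_arctan (u := 2 / 9) (by norm_num)
      norm_num1 at this ⊢
      linarith
    norm_num1 at *
    linarith

end ZetaLine

/-! ### Level lines as graphs, and arcs along them -/

namespace ZetaLine

open Filter Topology

lemma mk_neg_eq (x t : ℝ) : (⟨x, -t⟩ : ℂ) = x - t * Complex.I := by
  apply Complex.ext <;> simp

lemma one_sub_mk_neg (x t : ℝ) : 1 - (⟨x, -t⟩ : ℂ) = ⟨1 - x, t⟩ := by
  apply Complex.ext <;> simp

lemma border_eq (y : ℝ) : border y = 1 - (⟨31, -y⟩ : ℂ) := by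
  rw [one_sub_mk_neg, border]
  norm_num

lemma mk_re_neg_neg_im (z : ℂ) : (⟨z.re, - -z.im⟩ : ℂ) = z := by
  rw [neg_neg]

lemma continuousOn_lineNumber : ContinuousOn lineNumber {z : ℂ | 1 < z.re ∧ z.im < 0} :=
  continuousOn_const.sub (continuousOn_const.mul
    (Complex.continuous_im.comp_continuousOn continuousOn_logZetaOneSub))

lemma continuousOn_lineNumber_im {x : ℝ} (hx : 1 < x) :
    ContinuousOn (fun t : ℝ => lineNumber ⟨x, -t⟩) (Set.Ioi 0) := by
  refine continuousOn_lineNumber.comp (f := fun t : ℝ => (⟨x, -t⟩ : ℂ)) ?_ ?_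
  · simp_rw [mk_neg_eq]
    fun_prop
  · intro t ht
    exact ⟨hx, by simpa using ht⟩

lemma continuousOn_lineNumber_re {t : ℝ} (ht : 0 < t) :
    ContinuousOn (fun x : ℝ => lineNumber ⟨x, -t⟩) (Set.Ioi 1) := by
  refine continuousOn_lineNumber.comp (f := fun x : ℝ => (⟨x, -t⟩ : ℂ)) ?_ ?_
  · simp_rw [mk_neg_eq]
    fun_prop
  · intro x hx
    exact ⟨hx, by simpa using ht⟩

/-- The case c = 1 on a convex region. At equal N, the larger abscissa has the larger |ζ|; at equal
abscissa, N increases with the height. -/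
lemma far_pos {a b : ℂ} (ha : 2 ≤ a.re) (ha' : a.im ≤ -9) (hb : 2 ≤ b.re) (hb' : b.im ≤ -9)
    (hne : a ≠ b) :
    0 < (logZetaOneSub b - logZetaOneSub a).re * (b.re - a.re) +
      (logZetaOneSub b - logZetaOneSub a).im * (b.im - a.im) := by
  have hconv : Convex ℝ {z : ℂ | 2 ≤ z.re ∧ z.im ≤ -9} :=
    (convex_halfSpace_re_ge 2).inter (convex_halfSpace_im_le (-9))
  have h := re_mul_sub_mul_conj_pos hconv (f := logZetaOneSub) (f' := logZetaOneSubDeriv) (c := 1)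
    (fun z hz => hasDerivAt_logZetaOneSub (by linarith [hz.1]) (by linarith [hz.2]))
    (fun z hz => by
      have := logZetaOneSubDeriv_re_pos hz.1 (t := -z.im) (by linarith [hz.2])
      rw [mk_re_neg_neg_im] at this
      rwa [one_mul]) ⟨ha, ha'⟩ ⟨hb, hb'⟩ hne
  rw [one_mul, Complex.mul_re, Complex.conj_re, Complex.conj_im] at h
  simp only [Complex.sub_re, Complex.sub_im] at h ⊢
  linarith

/-- The case c = -i. At equal N, the greater height has the larger |ζ|; at equal height, N decreases
with the abscissa. -/
lemma near_pos {a b : ℂ} (ha : 3 ≤ a.re) (ha0 : a.im < 0) (ha' : -9 ≤ a.im) (hb : 3 ≤ b.re)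
    (hb0 : b.im < 0) (hb' : -9 ≤ b.im) (hne : a ≠ b) :
    0 < (logZetaOneSub b - logZetaOneSub a).im * (b.re - a.re) -
      (logZetaOneSub b - logZetaOneSub a).re * (b.im - a.im) := by
  have hconv : Convex ℝ {z : ℂ | 3 ≤ z.re ∧ z.im < 0 ∧ -9 ≤ z.im} :=
    (convex_halfSpace_re_ge 3).inter ((convex_halfSpace_im_lt 0).inter
      (convex_halfSpace_im_ge (-9)))
  have h := re_mul_sub_mul_conj_pos hconv (f := logZetaOneSub) (f' := logZetaOneSubDeriv)
    (c := -Complex.I)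
    (fun z hz => hasDerivAt_logZetaOneSub (by linarith [hz.1]) hz.2.1)
    (fun z hz => by
      have := logZetaOneSubDeriv_im_pos hz.1 (t := -z.im) (by linarith [hz.2.1])
        (by linarith [hz.2.2])
      rw [mk_re_neg_neg_im] at this
      simpa using this) ⟨ha, ha0, ha'⟩ ⟨hb, hb0, hb'⟩ hne
  rw [mul_assoc, Complex.mul_re, Complex.mul_im, Complex.conj_re, Complex.conj_im] at h
  simp only [Complex.sub_re, Complex.sub_im, Complex.neg_re, Complex.neg_im, Complex.I_re,
    Complex.I_im] at h ⊢
  linarith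

lemma logZetaOneSub_im_lt_iff {a b : ℂ} :
    (logZetaOneSub a).im < (logZetaOneSub b).im ↔ lineNumber b < lineNumber a := by
  have h : 0 < 2 / Real.pi := by positivity
  rw [lineNumber, lineNumber, sub_lt_sub_iff_left, mul_lt_mul_iff_right₀ h]

lemma logZetaOneSub_im_eq_of_lineNumber_eq {a b : ℂ} (h : lineNumber a = lineNumber b) :
    (logZetaOneSub a).im = (logZetaOneSub b).im := by
  rw [logZetaOneSub_im, logZetaOneSub_im, h]

lemma strictMonoOn_lineNumber_im {x : ℝ} (hx : 2 ≤ x) :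
    StrictMonoOn (fun t : ℝ => lineNumber ⟨x, -t⟩) (Set.Ici 9) := by
  intro t ht t' ht' h
  have ht9 : (9 : ℝ) ≤ t := ht
  have hne : (⟨x, -t⟩ : ℂ) ≠ ⟨x, -t'⟩ := by
    intro he
    have := congrArg Complex.im he
    simp at this
    linarith
  have hp := far_pos (a := ⟨x, -t⟩) (b := ⟨x, -t'⟩) hx (by simp; linarith) hx (by simp; linarith)
    hne
  refine logZetaOneSub_im_lt_iff.1 ?_
  simp only [Complex.sub_im, Complex.sub_re, sub_self, mul_zero, zero_add] at hp
  nlinarith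

lemma strictAntiOn_lineNumber_re {t : ℝ} (ht : 0 < t) (ht' : t ≤ 9) :
    StrictAntiOn (fun x : ℝ => lineNumber ⟨x, -t⟩) (Set.Ici 3) := by
  intro x hx x' hx' h
  have hne : (⟨x, -t⟩ : ℂ) ≠ ⟨x', -t⟩ := by
    intro he
    have := congrArg Complex.re he
    simp at this
    linarith
  have hp := near_pos (a := ⟨x, -t⟩) (b := ⟨x', -t⟩) hx (by simpa using ht) (by simpa using ht') hx'
    (by simpa using ht) (by simpa using ht') hne
  refine logZetaOneSub_im_lt_iff.1 ?_
  simp only [Complex.sub_im, Complex.sub_re, sub_self, mul_zero, sub_zero] at hp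
  nlinarith

lemma norm_riemannZeta_one_sub_lt_iff {a b : ℂ} (ha : 1 < a.re) (ha' : a.im < 0) (hb : 1 < b.re)
    (hb' : b.im < 0) : ‖riemannZeta (1 - a)‖ < ‖riemannZeta (1 - b)‖ ↔
      (logZetaOneSub a).re < (logZetaOneSub b).re := by
  rw [norm_riemannZeta_one_sub ha ha', norm_riemannZeta_one_sub hb hb',
    mul_lt_mul_iff_right₀ (Real.exp_pos _), Real.exp_lt_exp]

/-- Comparing T(a) with b amounts to comparing F(a, b) with c, an open condition in a. Hence
separate continuity of F is enough and no implicit function theorem is needed. -/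
lemma continuousOn_of_strictMonoOn {I J : Set ℝ} (hJ : J.OrdConnected) {F : ℝ → ℝ → ℝ}
    {T : ℝ → ℝ} {c : ℝ} (hT : ∀ a ∈ I, T a ∈ J) (hF : ∀ a ∈ I, F a (T a) = c)
    (hmono : ∀ a ∈ I, StrictMonoOn (F a) J) (hcont : ∀ b ∈ J, ContinuousOn (fun a => F a b) I) :
    ContinuousOn T I := by
  intro a ha
  refine tendsto_order.2 ⟨fun b hb => ?_, fun b hb => ?_⟩
  · by_cases hbJ : b ∈ J
    · have h1 : F a b < c := hF a ha ▸ hmono a ha hbJ (hT a ha) hb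
      filter_upwards [(hcont b hbJ a ha).eventually_lt_const h1, self_mem_nhdsWithin] with a' h2 ha'
      rw [← hF a' ha'] at h2
      exact ((hmono a' ha').lt_iff_lt hbJ (hT a' ha')).1 h2
    · filter_upwards [self_mem_nhdsWithin] with a' ha'
      by_contra! h
      exact hbJ (hJ.out (hT a' ha') (hT a ha) ⟨h, hb.le⟩)
  · by_cases hbJ : b ∈ J
    · have h1 : c < F a b := hF a ha ▸ hmono a ha (hT a ha) hbJ hb
      filter_upwards [(hcont b hbJ a ha).eventually_const_lt h1, self_mem_nhdsWithin] with a' h2 ha'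
      rw [← hF a' ha'] at h2
      exact ((hmono a' ha').lt_iff_lt (hT a' ha') hbJ).1 h2
    · filter_upwards [self_mem_nhdsWithin] with a' ha'
      by_contra! h
      exact hbJ (hJ.out (hT a ha) (hT a' ha') ⟨hb.le, h⟩)

lemma Arc.exists_real {n : ℤ} {a b : ℂ} (h : Arc n a b) :
    ∃ g : ℝ → ℂ, Continuous g ∧ g 0 = a ∧ g 1 = b ∧ (∀ τ ∈ Set.Ioc (0 : ℝ) 1, g τ ∈ levelSet n) ∧
      StrictMonoOn (fun τ => ‖riemannZeta (g τ)‖) (Set.Icc 0 1) := by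
  obtain ⟨γ, h1, h2⟩ := h
  refine ⟨γ.extend, γ.continuous_extend, γ.extend_zero, γ.extend_one, fun τ hτ => ?_,
    fun τ hτ σ hσ hlt => ?_⟩
  · rw [γ.extend_apply (Set.Ioc_subset_Icc_self hτ)]
    exact h1 _ hτ.1
  · simp only [γ.extend_apply hτ, γ.extend_apply hσ]
    exact h2 hlt

lemma Arc.of_real {n : ℤ} {a b : ℂ} {g : ℝ → ℂ} (hg : ContinuousOn g (Set.Icc 0 1))
    (h0 : g 0 = a) (h1 : g 1 = b) (hmem : ∀ τ ∈ Set.Ioc (0 : ℝ) 1, g τ ∈ levelSet n)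
    (hmono : StrictMonoOn (fun τ => ‖riemannZeta (g τ)‖) (Set.Icc 0 1)) : Arc n a b := by
  refine ⟨⟨⟨fun τ => g τ, hg.comp_continuous continuous_subtype_val fun τ => τ.2⟩, by simpa, by simpa⟩,
    fun τ hτ => hmem τ ⟨hτ, τ.2.2⟩, fun τ σ hlt => hmono τ.2 σ.2 hlt⟩

lemma Arc.trans {n : ℤ} {a b c : ℂ} (h : Arc n a b) (h' : Arc n b c) : Arc n a c := by
  obtain ⟨g, hg, g0, g1, gmem, gmono⟩ := h.exists_real
  obtain ⟨k, hk, k0, k1, kmem, kmono⟩ := h'.exists_real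
  set f : ℝ → ℂ := fun τ => if τ ≤ 1 / 2 then g (2 * τ) else k (2 * τ - 1) with hf
  have fl : ∀ τ, τ ≤ 1 / 2 → f τ = g (2 * τ) := fun τ hτ => if_pos hτ
  have fr : ∀ τ, 1 / 2 ≤ τ → f τ = k (2 * τ - 1) := by
    intro τ hτ
    rcases hτ.eq_or_lt with rfl | hlt
    · rw [fl _ le_rfl]
      norm_num [g1, k0]
    · exact if_neg hlt.not_ge
  have hfc : Continuous f := by
    refine Continuous.if_le (by fun_prop) (by fun_prop) continuous_id continuous_const ?_
    intro τ hτ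
    rw [hτ]
    norm_num [g1, k0]
  refine Arc.of_real (g := f) hfc.continuousOn ?_ ?_ ?_ ?_
  · rw [fl _ (by norm_num)]; simpa using g0
  · rw [fr _ (by norm_num)]; norm_num [k1]
  · intro τ hτ
    rcases le_total τ (1 / 2) with h2 | h2
    · rw [fl _ h2]
      exact gmem _ ⟨by linarith [hτ.1], by linarith⟩
    · rcases h2.eq_or_lt with rfl | h3
      · rw [fl _ le_rfl]
        exact gmem _ ⟨by norm_num, by norm_num⟩
      · rw [fr _ h2]
        exact kmem _ ⟨by linarith, by linarith [hτ.2]⟩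
  · have hl : StrictMonoOn (fun τ => ‖riemannZeta (f τ)‖) (Set.Icc 0 (1 / 2)) := by
      intro τ hτ σ hσ hlt
      simp only [fl _ hτ.2, fl _ hσ.2]
      exact gmono ⟨by linarith [hτ.1], by linarith [hτ.2]⟩
        ⟨by linarith [hσ.1], by linarith [hσ.2]⟩ (by linarith)
    have hr : StrictMonoOn (fun τ => ‖riemannZeta (f τ)‖) (Set.Icc (1 / 2) 1) := by
      intro τ hτ σ hσ hlt
      simp only [fr _ hτ.1, fr _ hσ.1]
      exact kmono ⟨by linarith [hτ.1], by linarith [hτ.2]⟩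
        ⟨by linarith [hσ.1], by linarith [hσ.2]⟩ (by linarith)
    have := hl.union hr (c := 1 / 2) ⟨⟨by norm_num, le_rfl⟩, fun τ hτ => hτ.2⟩
      ⟨⟨le_rfl, by norm_num⟩, fun τ hτ => hτ.1⟩
    rwa [Set.Icc_union_Icc_eq_Icc (by norm_num) (by norm_num)] at this

/-- Only points after the start of an arc are required to lie on a line; the start follows by
continuity once it is off the real axis. -/
lemma Arc.source_mem {n : ℤ} {a b : ℂ} (h : Arc n a b) (ha : 0 < a.im) : a ∈ levelSet n := by
  obtain ⟨g, hg, g0, -, gmem, -⟩ := h.exists_real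
  have hne : a ≠ 1 := by rintro rfl; simp at ha
  have hc : Tendsto (fun τ => riemannZeta (g τ)) (𝓝[>] 0) (𝓝 (riemannZeta a)) := by
    have h1 := (differentiableAt_riemannZeta hne).continuousAt.tendsto
    rw [← g0] at h1 ⊢
    exact h1.comp (hg.continuousAt.tendsto.mono_left nhdsWithin_le_nhds)
  have hev : ∀ᶠ τ in 𝓝[>] (0 : ℝ), g τ ∈ levelSet n := by
    filter_upwards [Ioc_mem_nhdsGT (zero_lt_one' ℝ)] with τ hτ using gmem τ hτ
  refine ⟨ha, ?_⟩
  split_ifs with hn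
  · refine tendsto_nhds_unique ((Complex.continuous_re.tendsto _).comp hc)
      (tendsto_const_nhds.congr' ?_)
    filter_upwards [hev] with τ hτ
    have := hτ.2
    rw [if_pos hn] at this
    exact this.symm
  · refine tendsto_nhds_unique ((Complex.continuous_im.tendsto _).comp hc)
      (tendsto_const_nhds.congr' ?_)
    filter_upwards [hev] with τ hτ
    have := hτ.2
    rw [if_neg hn] at this
    exact this.symm

lemma exists_lineNumber_eq_of_mem_levelSet {n : ℤ} {s : ℂ} (hs : s ∈ levelSet n) (hre : s.re < 0) :
    ∃ m : ℤ, lineNumber (1 - s) = m ∧ (Even m ↔ Even n) := by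
  have h := one_sub_mem_levelSet_iff (z := 1 - s) (by simp; linarith) (by simpa using hs.1) n
  rw [sub_sub_cancel] at h
  exact h.1 hs

lemma eq_of_isPreconnected_of_int {f : ℝ → ℝ} {s : Set ℝ} (hs : IsPreconnected s)
    (hf : ContinuousOn f s) (hint : ∀ x ∈ s, ∃ m : ℤ, f x = m) {a b : ℝ} (ha : a ∈ s) (hb : b ∈ s) :
    f a = f b := by
  wlog hlt : f a < f b generalizing a b
  · rcases (not_lt.1 hlt).eq_or_lt with h | h
    · exact h.symm
    · exact (this hb ha h).symm
  obtain ⟨m, hm⟩ := hint a ha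
  obtain ⟨k, hk⟩ := hint b hb
  have hmk : (m : ℝ) + 1 ≤ k := by
    rw [hm, hk] at hlt
    exact_mod_cast hlt
  obtain ⟨x, hx, hfx⟩ := hs.intermediate_value ha hb hf
    (⟨by linarith, by linarith⟩ : (m : ℝ) + 1 / 2 ∈ Set.Icc (f a) (f b))
  obtain ⟨l, hl⟩ := hint x hx
  rw [hl] at hfx
  have : (2 * l : ℝ) = 2 * m + 1 := by linarith
  have : 2 * l = 2 * m + 1 := by exact_mod_cast this
  omega

/-- At each abscissa N rises from at most n at height 9 to arbitrarily large values, so it equals n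
at exactly one height. These heights form a continuous graph, and |ζ| increases along it to the
left. -/
lemma exists_arc_border {x₀ t₀ : ℝ} {n : ℤ} (hx : 2 ≤ x₀) (hx' : x₀ < 31) (ht : 9 ≤ t₀)
    (hn : lineNumber ⟨x₀, -t₀⟩ = n) (hbot : ∀ x ∈ Set.Icc x₀ 31, lineNumber ⟨x, -9⟩ ≤ n) :
    ∃ y, 9 ≤ y ∧ lineNumber ⟨31, -y⟩ = n ∧ Arc n (1 - ⟨x₀, -t₀⟩) (border y) := by
  have hex : ∀ x ∈ Set.Icc x₀ 31, ∃ t, 9 ≤ t ∧ lineNumber ⟨x, -t⟩ = n := by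
    intro x hxm
    obtain ⟨t₁, ht₁, h1⟩ := exists_le_lineNumber (x := x) (by linarith [hxm.1]) n
    obtain ⟨t, ht, h2⟩ := intermediate_value_Icc ht₁
      ((continuousOn_lineNumber_im (x := x) (by linarith [hxm.1])).mono
        fun t ht => (by norm_num : (0 : ℝ) < 9).trans_le ht.1) ⟨hbot x hxm, h1⟩
    exact ⟨t, ht.1, h2⟩
  choose! T hT9 hTn using hex
  have hinj : T x₀ = t₀ := (strictMonoOn_lineNumber_im hx).injOn
    (hT9 x₀ ⟨le_rfl, hx'.le⟩) ht ((hTn x₀ ⟨le_rfl, hx'.le⟩).trans hn.symm)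
  have hTc : ContinuousOn T (Set.Icc x₀ 31) :=
    continuousOn_of_strictMonoOn (J := Set.Ici 9) Set.ordConnected_Ici
      (F := fun x t => lineNumber ⟨x, -t⟩) hT9 hTn
      (fun x hxm => strictMonoOn_lineNumber_im (by linarith [hxm.1]))
      (fun t ht => (continuousOn_lineNumber_re ((by norm_num : (0 : ℝ) < 9).trans_le ht)).mono
        fun x hxm => (by linarith [hxm.1] : 1 < x))
  have hx31 : (31 : ℝ) ∈ Set.Icc x₀ 31 := ⟨hx'.le, le_rfl⟩
  refine ⟨T 31, hT9 31 hx31, hTn 31 hx31, ?_⟩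
  have hmaps : ∀ τ ∈ Set.Icc (0 : ℝ) 1, x₀ + τ * (31 - x₀) ∈ Set.Icc x₀ 31 := by
    intro τ hτ
    exact ⟨by nlinarith [hτ.1], by nlinarith [hτ.2]⟩
  have hgc : ContinuousOn (fun τ : ℝ => T (x₀ + τ * (31 - x₀))) (Set.Icc 0 1) :=
    hTc.comp (by fun_prop) hmaps
  refine Arc.of_real (g := fun τ => 1 - ⟨x₀ + τ * (31 - x₀), -T (x₀ + τ * (31 - x₀))⟩) ?_ ?_ ?_ ?_ ?_
  · simp_rw [mk_neg_eq]
    exact continuousOn_const.sub ((by fun_prop : Continuous fun τ : ℝ =>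
      ((x₀ + τ * (31 - x₀) : ℝ) : ℂ)).continuousOn.sub
      ((Complex.continuous_ofReal.comp_continuousOn hgc).mul continuousOn_const))
  · simp [hinj]
  · simp [border_eq]
  · intro τ hτ
    have hm := hmaps τ (Set.Ioc_subset_Icc_self hτ)
    have h9 := hT9 _ hm
    exact (one_sub_mem_levelSet_iff (by simp only; linarith [hm.1]) (by simp only; linarith) n).2
      ⟨n, hTn _ hm, Iff.rfl⟩
  · intro τ hτ σ hσ hlt
    have hmτ := hmaps τ hτ
    have hmσ := hmaps σ hσ
    have h9τ := hT9 _ hmτ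
    have h9σ := hT9 _ hmσ
    have hlt' : x₀ + τ * (31 - x₀) < x₀ + σ * (31 - x₀) := by nlinarith
    refine (norm_riemannZeta_one_sub_lt_iff (by simp only; linarith [hmτ.1])
      (by simp only; linarith) (by simp only; linarith [hmσ.1]) (by simp only; linarith)).2 ?_
    have hp := far_pos (a := ⟨x₀ + τ * (31 - x₀), -T (x₀ + τ * (31 - x₀))⟩)
      (b := ⟨x₀ + σ * (31 - x₀), -T (x₀ + σ * (31 - x₀))⟩) (by simp only; linarith [hmτ.1])
      (by simp only; linarith) (by simp only; linarith [hmσ.1]) (by simp only; linarith)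
      (fun he => hlt'.ne (congrArg Complex.re he))
    rw [Complex.sub_im, logZetaOneSub_im_eq_of_lineNumber_eq ((hTn _ hmτ).trans (hTn _ hmσ).symm),
      sub_self, zero_mul, add_zero, Complex.sub_re] at hp
    have := pos_of_mul_pos_left hp (by simp only; linarith)
    linarith

/-- Arcs are arbitrary paths, so this is a continuation argument. Near a point of the line, N stays
an integer and hence constant; then increasing |ζ| forces the path to the left. It cannot sink to
height 9, where N < -3. -/
lemma Arc.lineNumber_eq_of_nine_le {n m : ℤ} {a b : ℂ} (h : Arc n a b) (ha : a.re ≤ -1)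
    (ha' : 9 ≤ a.im) (hm : lineNumber (1 - a) = m) (hm' : -3 ≤ m) :
    b.re ≤ a.re ∧ 9 ≤ b.im ∧ lineNumber (1 - b) = m := by
  obtain ⟨g, hg, rfl, rfl, gmem, gmono⟩ := h.exists_real
  set C : Set ℂ := {w | w.re ≤ (g 0).re ∧ 9 ≤ w.im ∧ lineNumber (1 - w) = m} with hC
  have hCc : IsClosed C := by
    have h1 : IsClosed {w : ℂ | w.re ≤ (g 0).re ∧ 9 ≤ w.im} :=
      (isClosed_le Complex.continuous_re continuous_const).inter
        (isClosed_le continuous_const Complex.continuous_im)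
    have h2 : ContinuousOn (fun w => lineNumber (1 - w)) {w : ℂ | w.re ≤ (g 0).re ∧ 9 ≤ w.im} :=
      continuousOn_lineNumber.comp (by fun_prop) fun w hw =>
        ⟨by simp; linarith [hw.1], by simp; linarith [hw.2]⟩
    have h3 := h2.preimage_isClosed_of_isClosed h1 (isClosed_singleton (x := (m : ℝ)))
    convert h3 using 1
    ext w
    simp [hC, and_assoc]
  -- Continuous induction on [0, 1]: the condition is closed and extends a little to the right of
  -- every time at which it holds.
  have hsub : Set.Icc (0 : ℝ) 1 ⊆ g ⁻¹' C := by
    refine IsClosed.Icc_subset_of_forall_exists_gt ((hCc.preimage hg).inter isClosed_Icc)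
      ⟨le_rfl, ha', hm⟩ ?_
    rintro τ ⟨⟨hτ1, hτ2, hτ3⟩, hτ⟩ y hy
    set z := 1 - g τ with hz
    have hzre : z.re = 1 - (g τ).re := by simp [hz]
    have hzim : z.im = -(g τ).im := by simp [hz]
    have hz2 : 2 ≤ z.re := by linarith
    have hlt : z.im < -9 := by
      rw [hzim, neg_lt_neg_iff]
      refine hτ2.lt_of_ne fun he => ?_
      have h1 := lineNumber_nine_lt hz2
      rw [he, ← hzim, Complex.eta, hτ3] at h1
      have : m < -3 := by exact_mod_cast h1
      omega
    have hzq : z ∈ {z : ℂ | 1 < z.re ∧ z.im < 0} := ⟨by linarith, by linarith⟩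
    have hnhds := isOpen_quadrant.mem_nhds hzq
    have e1 : ∀ᶠ w in 𝓝 z, 0 < (logZetaOneSubDeriv w).re := by
      have h1 := logZetaOneSubDeriv_re_pos hz2 (t := -z.im) (by linarith)
      rw [mk_re_neg_neg_im] at h1
      exact (Complex.continuous_re.continuousAt.comp
        (continuousOn_logZetaOneSubDeriv.continuousAt hnhds)).eventually_const_lt h1
    have e2 : ∀ᶠ w in 𝓝 z, lineNumber w ∈ Set.Ioo ((m : ℝ) - 1) (m + 1) :=
      (continuousOn_lineNumber.continuousAt hnhds).eventually_mem
        (isOpen_Ioo.mem_nhds ⟨by linarith, by linarith⟩)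
    obtain ⟨ε, hε, hball⟩ := Metric.eventually_nhds_iff_ball.1
      (e1.and (e2.and ((Complex.continuous_im.continuousAt.eventually_lt_const hlt).and
        (isOpen_quadrant.eventually_mem hzq))))
    have e3 : ∀ᶠ σ in 𝓝 τ, 1 - g σ ∈ Metric.ball z ε :=
      (continuous_const.sub hg).continuousAt.eventually_mem (Metric.ball_mem_nhds _ hε)
    have hmin : τ < min y 1 := lt_min hy hτ.2
    obtain ⟨σ, hσb, hσ⟩ := ((e3.filter_mono nhdsWithin_le_nhds).and (Ioc_mem_nhdsGT hmin)).exists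
    have hσ1 : σ ≤ 1 := hσ.2.trans (min_le_right _ _)
    have hσ0 : 0 < σ := hτ.1.trans_lt hσ.1
    obtain ⟨-, ⟨hl, hu⟩, hq9, hq1, hq2⟩ := hball _ hσb
    obtain ⟨k, hk, -⟩ := exists_lineNumber_eq_of_mem_levelSet (gmem σ ⟨hσ0, hσ1⟩)
      (by rw [Complex.sub_re, Complex.one_re] at hq1; linarith)
    rw [hk] at hl hu
    have hkm : k = m := by
      have h1 : m - 1 < k := by exact_mod_cast hl
      have h2 : k < m + 1 := by exact_mod_cast hu
      omega
    subst hkm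
    have hnorm := gmono ⟨hτ.1, hτ.2.le⟩ ⟨hσ0.le, hσ1⟩ hσ.1
    have hre : (logZetaOneSub z).re < (logZetaOneSub (1 - g σ)).re := by
      rw [← norm_riemannZeta_one_sub_lt_iff hzq.1 hzq.2 hq1 hq2, hz, sub_sub_cancel, sub_sub_cancel]
      exact hnorm
    -- A ball serves as the convex set, since openness propagates Re L' > 0 to points slightly right
    -- of the original abscissa.
    have hp := re_mul_sub_mul_conj_pos (convex_ball z ε) (c := 1)
      (fun w hw => hasDerivAt_logZetaOneSub (hball w hw).2.2.2.1 (hball w hw).2.2.2.2)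
      (fun w hw => by rw [one_mul]; exact (hball w hw).1) (Metric.mem_ball_self hε) hσb
      (fun he => by rw [he] at hre; exact lt_irrefl _ hre)
    rw [one_mul, Complex.mul_re, Complex.conj_re, Complex.conj_im, Complex.sub_im (logZetaOneSub _),
      logZetaOneSub_im_eq_of_lineNumber_eq (hk.trans hτ3.symm), sub_self, zero_mul, sub_zero,
      Complex.sub_re, Complex.sub_re] at hp
    have hre2 := pos_of_mul_pos_right hp (by linarith)
    refine ⟨σ, ⟨?_, ?_, hk⟩, hσ.1, hσ.2.trans (min_le_left _ _)⟩
    · rw [hzre, Complex.sub_re, Complex.one_re] at hre2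
      linarith
    · rw [Complex.sub_im, Complex.one_im] at hq9
      linarith
  exact hsub ⟨zero_le_one, le_rfl⟩

/-! ### Counting the crossings of the left border -/

lemma mem_crossings_iff {y₀ y : ℝ} (hy₀ : 0 ≤ y₀) {v : ℝ} : v ∈ crossings y₀ y ↔
    v ∈ Set.Ioc y₀ y ∧ ∃ m : ℤ, lineNumber ⟨31, -v⟩ = m := by
  rw [crossings, Set.mem_ofPred_eq, ← and_assoc]
  refine and_congr_right fun hv => ?_
  have hv0 : 0 < v := hy₀.trans_lt hv.1
  have h := one_sub_mem_levelSet_iff (z := ⟨31, -v⟩) (by norm_num) (by simpa using hv0)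
  rw [← border_eq] at h
  have h0 := h 0
  have h1 := h 1
  simp only [levelSet, Set.mem_ofPred_eq, border, hv0, true_and, Even.zero, if_true, Int.not_even_one,
    if_false, iff_true, iff_false] at h0 h1
  rw [border, h0, h1]
  constructor
  · rintro (⟨m, hm, -⟩ | ⟨m, hm, -⟩) <;> exact ⟨m, hm⟩
  · rintro ⟨m, hm⟩
    exact (em (Even m)).imp (fun h => ⟨m, hm, h⟩) fun h => ⟨m, hm, h⟩

/-- On the border N is continuous and strictly increasing from height 9 on, so crossings correspond
to the integers in (k, N(y)]. -/
lemma ncard_crossings {y₀ y : ℝ} (hy₀ : 9 ≤ y₀) (hlt : y₀ < y) {k : ℤ}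
    (hk : lineNumber ⟨31, -y₀⟩ = k) :
    ((crossings y₀ y).ncard : ℤ) = ⌊lineNumber ⟨31, -y⟩⌋ - k := by
  have hmono := strictMonoOn_lineNumber_im (x := 31) (by norm_num)
  have hmem : ∀ v ∈ crossings y₀ y, 9 ≤ v := fun v hv => hy₀.trans hv.1.le
  have hinj : Set.InjOn (fun v : ℝ => ⌊lineNumber ⟨31, -v⟩⌋) (crossings y₀ y) := by
    intro v hv w hw he
    obtain ⟨-, m, hm⟩ := (mem_crossings_iff (by linarith)).1 hv
    obtain ⟨-, l, hl⟩ := (mem_crossings_iff (by linarith)).1 hw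
    refine hmono.injOn (hmem v hv) (hmem w hw) ?_
    simp only [hm, hl, Int.floor_intCast] at he ⊢
    rw [he]
  have himage : (fun v : ℝ => ⌊lineNumber ⟨31, -v⟩⌋) '' crossings y₀ y =
      Finset.Ioc k ⌊lineNumber ⟨31, -y⟩⌋ := by
    ext m
    rw [Finset.coe_Ioc]
    constructor
    · rintro ⟨v, hv, rfl⟩
      obtain ⟨hv', m, hm⟩ := (mem_crossings_iff (by linarith)).1 hv
      have h1 := hmono hy₀ (hmem v hv) hv'.1
      have h2 := hmono.monotoneOn (hmem v hv) (hy₀.trans hlt.le) hv'.2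
      simp only [hk, hm] at h1 h2
      simp only [hm, Int.floor_intCast]
      exact ⟨by exact_mod_cast h1, Int.le_floor.2 h2⟩
    · rintro ⟨h1, h2⟩
      have h1' : lineNumber ⟨31, -y₀⟩ ≤ m := by rw [hk]; exact_mod_cast h1.le
      obtain ⟨v, hv, hvm⟩ := intermediate_value_Icc hlt.le
        ((continuousOn_lineNumber_im (x := 31) (by norm_num)).mono
          fun t ht => (by linarith [ht.1] : 0 < t)) ⟨h1', Int.le_floor.1 h2⟩
      have hne : v ≠ y₀ := by
        rintro rfl
        simp only [hk] at hvm
        exact h1.ne (by exact_mod_cast hvm)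
      refine ⟨v, (mem_crossings_iff (by linarith)).2
        ⟨⟨lt_of_le_of_ne hv.1 hne.symm, hv.2⟩, m, hvm⟩, ?_⟩
      simp only at hvm ⊢
      rw [hvm, Int.floor_intCast]
  have hle : k ≤ ⌊lineNumber ⟨31, -y⟩⌋ := by
    rw [Int.le_floor, ← hk]
    exact (hmono hy₀ (hy₀.trans hlt.le) hlt).le
  rw [← hinj.ncard_image, himage, Set.ncard_coe_finset, Int.card_Ioc,
    Int.toNat_of_nonneg (by linarith)]

/-! ### Lines near the real axis; line -4 and the low lines -/

/-- The part of `Im logZetaOneSub` that extends continuously to the real axis, where it vanishes. -/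
noncomputable def axisError (z : ℂ) : ℝ :=
  (-z * Real.log (2 * Real.pi) + logGamma z + logZeta z).im

lemma continuousOn_axisError : ContinuousOn axisError {z | 1 < z.re} := by
  refine Complex.continuous_im.comp_continuousOn (((by fun_prop : Continuous fun z : ℂ =>
    -z * Real.log (2 * Real.pi)).continuousOn.add fun z hz => ?_).add fun z hz => ?_)
  · exact (hasDerivAt_logGamma hz).continuousAt.continuousWithinAt
  · exact (hasDerivAt_logZeta hz).continuousAt.continuousWithinAt

lemma logZeta_ofReal_im {x : ℝ} (hx : 1 < x) : (logZeta x).im = 0 := by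
  have h := hasSum_im_lseries logZetaCoeff_zero (x := x) (t := 0)
    (lseriesSummable_logZetaCoeff (by simpa using hx))
  simp only [zero_mul, Real.sin_zero, mul_zero, mk_neg_eq, Complex.ofReal_zero, sub_zero] at h
  exact h.unique hasSum_zero

lemma axisError_ofReal {x : ℝ} (hx : 1 < x) : axisError x = 0 := by
  rw [axisError, Complex.add_im, Complex.add_im, logZeta_ofReal_im hx, logGamma_ofReal_im hx.le,
    ← Complex.ofReal_neg, ← Complex.ofReal_mul, Complex.ofReal_im, add_zero, add_zero]

lemma lineNumber_eq_axisError (z : ℂ) : lineNumber z = 1 - z.re - 2 / Real.pi *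
    ((1 + Complex.exp (-(Complex.I * Real.pi * z))).arg + axisError z) := by
  have h : (Complex.I * Real.pi * z / 2).im = Real.pi * z.re / 2 := by
    rw [show Complex.I * Real.pi * z / 2 = Complex.I * ((Real.pi / 2 : ℝ) * z) by push_cast; ring,
      Complex.I_mul_im, Complex.re_ofReal_mul]
    ring
  have hp := Real.pi_ne_zero
  rw [lineNumber, logZetaOneSub, axisError]
  simp only [Complex.add_im, h, Complex.log_im]
  field_simp
  ring

/-- The only part of N that can jump at the axis is the argument of 1 + exp(-iπz), which is below
π/2 in size and contributes at most 1. -/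
lemma abs_lineNumber_sub_le {z : ℂ} (hz : z.im < 0) :
    |lineNumber z - (1 - z.re)| ≤ 1 + 2 / Real.pi * |axisError z| := by
  have h := (Complex.abs_arg_lt_pi_div_two_iff.2 (Or.inl (one_add_exp_re_pos hz))).le
  have hp := Real.pi_pos
  rw [lineNumber_eq_axisError, sub_sub_cancel_left, abs_neg, abs_mul, abs_of_pos (by positivity)]
  calc _ ≤ 2 / Real.pi * (Real.pi / 2 + |axisError z|) := by
        gcongr
        exact (abs_add_le _ _).trans (by gcongr)
    _ = _ := by field_simp

lemma one_add_exp_im (x t : ℝ) : (1 + Complex.exp (-(Complex.I * Real.pi * ⟨x, -t⟩))).im =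
    -(Real.exp (-(Real.pi * t)) * Real.sin (Real.pi * x)) := by
  simp [Complex.exp_im]

lemma tendsto_axisError {x : ℝ} (hx : 1 < x) :
    Tendsto (fun t : ℝ => axisError ⟨x, -t⟩) (𝓝[>] 0) (𝓝 0) := by
  have h : ContinuousAt axisError x :=
    continuousOn_axisError.continuousAt (isOpen_one_lt_re.mem_nhds (by simpa using hx))
  rw [ContinuousAt, axisError_ofReal hx] at h
  refine h.comp (Tendsto.mono_left ?_ nhdsWithin_le_nhds)
  simp_rw [mk_neg_eq]
  refine Continuous.tendsto' (by fun_prop) _ _ (by simp)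

/-- Right of an odd n the argument of 1 + exp(-iπz) is nonnegative, so N drops below its value 1 - n
by about δ or more. With the mirror statement `eventually_lt_lineNumber` this pins the line to the
trivial zero 1 - n. -/
lemma eventually_lineNumber_lt {n : ℕ} (hn : Odd n) {δ : ℝ} (hδ : 0 < δ) (hδ' : δ ≤ 1) :
    ∀ᶠ t in 𝓝[>] (0 : ℝ), lineNumber ⟨n + δ, -t⟩ < 1 - n := by
  have hn1 : (1 : ℝ) ≤ n := by exact_mod_cast hn.pos
  have hp := Real.pi_pos
  have h := ((tendsto_axisError (x := n + δ) (by linarith)).const_mul (2 / Real.pi))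
  rw [mul_zero] at h
  filter_upwards [h.eventually_const_lt (neg_lt_zero.2 hδ)] with t ht
  have harg : 0 ≤ (1 + Complex.exp (-(Complex.I * Real.pi * ⟨n + δ, -t⟩))).arg := by
    rw [Complex.arg_nonneg_iff, one_add_exp_im, mul_add, add_comm, mul_comm Real.pi n,
      Real.sin_add_nat_mul_pi, hn.neg_one_pow, neg_one_mul, mul_neg, neg_neg]
    exact mul_nonneg (Real.exp_pos _).le
      (Real.sin_nonneg_of_nonneg_of_le_pi (by positivity) (by nlinarith))
  have := mul_nonneg (by positivity : 0 ≤ 2 / Real.pi) harg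
  rw [lineNumber_eq_axisError, mul_add]
  simp only
  linarith

lemma eventually_lt_lineNumber {n : ℕ} (hn : Odd n) {δ : ℝ} (hδ : 0 < δ) (hδ' : δ < 1)
    (hδn : 1 + δ < n) : ∀ᶠ t in 𝓝[>] (0 : ℝ), 1 - n < lineNumber ⟨n - δ, -t⟩ := by
  have hp := Real.pi_pos
  have h := ((tendsto_axisError (x := n - δ) (by linarith)).const_mul (2 / Real.pi))
  rw [mul_zero] at h
  filter_upwards [h.eventually_lt_const hδ, self_mem_nhdsWithin] with t ht ht0
  have ht0 : 0 < t := ht0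
  have harg : (1 + Complex.exp (-(Complex.I * Real.pi * ⟨n - δ, -t⟩))).arg ≤ 0 := by
    refine (Complex.arg_neg_iff.2 ?_).le
    rw [one_add_exp_im, mul_sub, mul_comm Real.pi n, Real.sin_nat_mul_pi_sub, hn.neg_one_pow,
      neg_one_mul, neg_neg, neg_lt_zero]
    exact mul_pos (Real.exp_pos _) (Real.sin_pos_of_pos_of_lt_pi (by positivity) (by nlinarith))
  have := mul_nonneg (by positivity : 0 ≤ 2 / Real.pi) (neg_nonneg.2 harg)
  rw [lineNumber_eq_axisError, mul_add]
  simp only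
  linarith

lemma Arc.target_mem {n : ℤ} {a b : ℂ} (h : Arc n a b) : b ∈ levelSet n := by
  obtain ⟨γ, h1, -⟩ := h
  simpa using h1 1 zero_lt_one

/-- At each height up to 9, N decreases in the abscissa and passes -4 between 3 and 31. The
resulting graph extends continuously to the axis at z = 5, that is s = -4. -/
lemma exists_continuousOn_lineNumber_eq_neg_four : ∃ X : ℝ → ℝ, ContinuousOn X (Set.Icc 0 9) ∧
    X 0 = 5 ∧ ∀ t ∈ Set.Ioc (0 : ℝ) 9, X t ∈ Set.Ico (3 : ℝ) 31 ∧ lineNumber ⟨X t, -t⟩ = -4 := by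
  have hex : ∀ t ∈ Set.Ioc (0 : ℝ) 9, ∃ x ∈ Set.Icc (3 : ℝ) 31, lineNumber ⟨x, -t⟩ = -4 := by
    intro t ht
    exact intermediate_value_Icc' (by norm_num) ((continuousOn_lineNumber_re ht.1).mono
        fun x hx => (by linarith [hx.1] : 1 < x))
      ⟨(lineNumber_thirty_one_lt ht.1 ht.2).le, (neg_four_lt_lineNumber_three ht.1).le⟩
  choose! X hXm hX using hex
  have hanti : ∀ t ∈ Set.Ioc (0 : ℝ) 9,
      StrictAntiOn (fun x : ℝ => lineNumber ⟨x, -t⟩) (Set.Ici 3) :=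
    fun t ht => strictAntiOn_lineNumber_re ht.1 ht.2
  have hXc : ContinuousOn X (Set.Ioc 0 9) :=
    continuousOn_of_strictMonoOn (J := Set.Icc 3 31) Set.ordConnected_Icc
      (F := fun t x => -lineNumber ⟨x, -t⟩) (c := 4) hXm (fun t ht => by simp only [hX t ht, neg_neg])
      (fun t ht => ((hanti t ht).mono fun x hx => hx.1).neg)
      (fun x hx => ((continuousOn_lineNumber_im (by linarith [hx.1])).mono fun t ht => ht.1).neg)
  have hev : ∀ᶠ t in 𝓝[>] (0 : ℝ), t ∈ Set.Ioc (0 : ℝ) 9 := Ioc_mem_nhdsGT (by norm_num)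
  have hlim : Tendsto X (𝓝[>] 0) (𝓝 5) := by
    refine tendsto_order.2 ⟨fun b hb => ?_, fun b hb => ?_⟩
    · have hδ : 0 < min (5 - b) (1 / 2) := lt_min (by linarith) (by norm_num)
      have hδ' := min_le_right (5 - b) (1 / 2)
      filter_upwards [hev, eventually_lt_lineNumber (n := 5) (by decide) hδ (by linarith)
        (by push_cast; linarith)] with t ht h
      rw [show (1 - (5 : ℕ) : ℝ) = -4 by norm_num, ← hX t ht] at h
      have h3 : ((5 : ℕ) : ℝ) - min (5 - b) (1 / 2) ∈ Set.Ici 3 := by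
        rw [Set.mem_Ici]
        push_cast
        linarith
      have := ((hanti t ht).lt_iff_gt (hXm t ht).1 h3).1 h
      push_cast at this
      linarith [min_le_left (5 - b) (1 / 2)]
    · have hδ : 0 < min (b - 5) (1 / 2) := lt_min (by linarith) (by norm_num)
      have hδ' := min_le_right (b - 5) (1 / 2)
      filter_upwards [hev, eventually_lineNumber_lt (n := 5) (by decide) hδ (by linarith)]
        with t ht h
      rw [show (1 - (5 : ℕ) : ℝ) = -4 by norm_num, ← hX t ht] at h
      have h3 : ((5 : ℕ) : ℝ) + min (b - 5) (1 / 2) ∈ Set.Ici 3 := by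
        rw [Set.mem_Ici]
        push_cast
        linarith
      have := ((hanti t ht).lt_iff_gt h3 (hXm t ht).1).1 h
      push_cast at this
      linarith [min_le_left (b - 5) (1 / 2)]
  refine ⟨Function.update X 0 5, ?_, Function.update_self .., fun t ht => ?_⟩
  · rw [continuousOn_update_iff, Set.Icc_sdiff_left, nhdsWithin_Ioc_eq_nhdsGT (by norm_num)]
    exact ⟨hXc, fun _ => hlim⟩
  · rw [Function.update_of_ne ht.1.ne']
    refine ⟨⟨(hXm t ht).1, (hXm t ht).2.lt_of_ne fun he => ?_⟩, hX t ht⟩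
    have := lineNumber_thirty_one_lt ht.1 ht.2
    rw [← he, hX t ht] at this
    exact lt_irrefl _ this

theorem exists_onLowLine_border :
    ∃ y, 9 ≤ y ∧ lineNumber ⟨31, -y⟩ = -4 ∧ OnLowLine (-4) (border y) := by
  obtain ⟨X, hXc, hX0, hX⟩ := exists_continuousOn_lineNumber_eq_neg_four
  obtain ⟨⟨h93, h931⟩, h9⟩ := hX 9 ⟨by norm_num, le_rfl⟩
  obtain ⟨y, hy, hly, harc⟩ := exists_arc_border (x₀ := X 9) (t₀ := 9) (n := -4) (by linarith) h931
    le_rfl (by simpa using h9) (fun x hx => by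
      have := (strictAntiOn_lineNumber_re (by norm_num) le_rfl).antitoneOn h93
        (h93.trans hx.1) hx.1
      simp only [h9] at this
      simpa using this)
  suffices hlow : Arc (-4) (((-4 : ℤ) : ℝ) : ℂ) (1 - ⟨X 9, -9⟩) by
    refine ⟨y, hy, by simpa using hly, (hlow.trans harc).target_mem, ((-4 : ℤ) : ℝ), ?_,
      hlow.trans harc⟩
    rw [IsFoot, if_pos (by decide)]
  have hmaps : ∀ τ ∈ Set.Icc (0 : ℝ) 1, 9 * τ ∈ Set.Icc (0 : ℝ) 9 := fun τ hτ =>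
    ⟨by linarith [hτ.1], by linarith [hτ.2]⟩
  have hmaps' : ∀ τ ∈ Set.Ioc (0 : ℝ) 1, 9 * τ ∈ Set.Ioc (0 : ℝ) 9 := fun τ hτ =>
    ⟨by linarith [hτ.1], by linarith [hτ.2]⟩
  have hgc : ContinuousOn (fun τ : ℝ => X (9 * τ)) (Set.Icc 0 1) := hXc.comp (by fun_prop) hmaps
  refine Arc.of_real (g := fun τ => 1 - ⟨X (9 * τ), -(9 * τ)⟩) ?_ ?_ ?_ ?_ ?_
  · simp_rw [mk_neg_eq]
    exact continuousOn_const.sub ((Complex.continuous_ofReal.comp_continuousOn hgc).sub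
      (by fun_prop))
  · simp only [mk_neg_eq, mul_zero, hX0]
    norm_num
  · simp
  · intro τ hτ
    obtain ⟨⟨h3, -⟩, hl⟩ := hX _ (hmaps' τ hτ)
    exact (one_sub_mem_levelSet_iff (by simp only; linarith) (by simp only; linarith [hτ.1]) _).2
      ⟨-4, by simpa using hl, Iff.rfl⟩
  · intro τ hτ σ hσ hlt
    have hσ0 : 0 < σ := hτ.1.trans_lt hlt
    obtain ⟨⟨h3σ, -⟩, hlσ⟩ := hX _ (hmaps' σ ⟨hσ0, hσ.2⟩)
    -- The start is the trivial zero itself, outside the domain of L; there |ζ| = 0 is smaller than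
    -- any later value.
    rcases hτ.1.eq_or_lt with rfl | hτ0
    · have h0 : riemannZeta (1 - ⟨X (9 * 0), -(9 * 0)⟩) = 0 := by
        rw [mk_neg_eq, mul_zero, hX0]
        convert riemannZeta_neg_two_mul_nat_add_one 1 using 2
        norm_num
      simp only [h0, norm_zero]
      rw [norm_riemannZeta_one_sub (by simp only; linarith) (by simp only; linarith)]
      positivity
    · obtain ⟨⟨h3τ, -⟩, hlτ⟩ := hX _ (hmaps' τ ⟨hτ0, hτ.2⟩)
      refine (norm_riemannZeta_one_sub_lt_iff (by simp only; linarith)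
        (by simp only; linarith) (by simp only; linarith) (by simp only; linarith)).2 ?_
      have hp := near_pos (a := ⟨X (9 * τ), -(9 * τ)⟩) (b := ⟨X (9 * σ), -(9 * σ)⟩) h3τ
        (by simp only; linarith) (by simp only; linarith [hτ.2]) h3σ (by simp only; linarith)
        (by simp only; linarith [hσ.2])
        (fun he => hlt.ne (by simpa using congrArg Complex.im he))
      rw [Complex.sub_im, logZetaOneSub_im_eq_of_lineNumber_eq (hlτ.trans hlσ.symm),
        sub_self, zero_mul, zero_sub, Complex.sub_re, ← mul_neg] at hp
      have := pos_of_mul_pos_left hp (by simp only; linarith)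
      linarith

/-- Along the arc N is a fixed integer m with the parity of n. Letting the arc tend to its foot
gives |m - x| ≤ 1, so m and n differ by less than 2 and coincide. -/
lemma lineNumber_eq_of_isFoot {n : ℤ} {x : ℝ} {g : ℝ → ℂ} {σ : ℝ} (hn : n ≤ -4) (hx : IsFoot n x)
    (hg : Continuous g) (g0 : g 0 = x) (hσ : 0 < σ)
    (hmem : ∀ τ ∈ Set.Ioc 0 σ, g τ ∈ levelSet n ∧ (g τ).re < 0) : lineNumber (1 - g σ) = n := by
  have hn' : (n : ℝ) ≤ -4 := by exact_mod_cast hn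
  have hx1 : x < n + 1 := by
    unfold IsFoot at hx
    split_ifs at hx
    · linarith
    · exact hx.2
  have hint : ∀ τ ∈ Set.Ioc 0 σ, ∃ m : ℤ, lineNumber (1 - g τ) = m ∧ (Even m ↔ Even n) :=
    fun τ hτ => exists_lineNumber_eq_of_mem_levelSet (hmem τ hτ).1 (hmem τ hτ).2
  have hquad : ∀ τ ∈ Set.Ioc 0 σ, 1 < (1 - g τ).re ∧ (1 - g τ).im < 0 := fun τ hτ =>
    ⟨by simp; linarith [(hmem τ hτ).2], by simpa using (hmem τ hτ).1.1⟩
  have hconst : ∀ τ ∈ Set.Ioc 0 σ, lineNumber (1 - g τ) = lineNumber (1 - g σ) := fun τ hτ =>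
    eq_of_isPreconnected_of_int (f := fun τ => lineNumber (1 - g τ)) isPreconnected_Ioc
      (continuousOn_lineNumber.comp (by fun_prop) hquad)
      (fun τ hτ => (hint τ hτ).imp fun m hm => hm.1) hτ ⟨hσ, le_rfl⟩
  obtain ⟨m, hm, hpar⟩ := hint σ ⟨hσ, le_rfl⟩
  have hbound : |(m : ℝ) - x| ≤ 1 := by
    have hcont : ContinuousAt (fun τ => 1 + 2 / Real.pi * |axisError (1 - g τ)| -
        |m - (1 - (1 - g τ).re)|) 0 := by
      have h1 : ContinuousAt axisError (1 - g 0) :=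
        continuousOn_axisError.continuousAt (isOpen_one_lt_re.mem_nhds (by simp [g0]; linarith))
      have h2 : ContinuousAt (fun τ => axisError (1 - g τ)) 0 :=
        h1.comp (f := fun τ => 1 - g τ) (by fun_prop)
      fun_prop
    have h0 : (1 : ℂ) - g 0 = (1 - x : ℝ) := by rw [g0]; push_cast; ring
    have hlim := hcont.tendsto.mono_left (nhdsWithin_le_nhds (s := Set.Ioi 0))
    rw [h0, axisError_ofReal (by linarith), Complex.ofReal_re, sub_sub_cancel, abs_zero, mul_zero,
      add_zero] at hlim
    refine sub_nonneg.1 (ge_of_tendsto hlim ?_)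
    filter_upwards [Ioc_mem_nhdsGT hσ] with τ hτ
    have := abs_lineNumber_sub_le (hquad τ hτ).2
    rw [hconst τ hτ, hm] at this
    linarith
  rw [abs_le] at hbound
  rw [hm]
  unfold IsFoot at hx
  split_ifs at hx with hne
  · have h1 : m ≤ n + 1 := by
      have : (m : ℝ) ≤ n + 1 := by linarith
      exact_mod_cast this
    have h2 : n - 1 ≤ m := by
      have : (n : ℝ) - 1 ≤ m := by linarith
      exact_mod_cast this
    rw [Int.cast_inj]
    rw [Int.even_iff, Int.even_iff] at hpar
    rw [Int.even_iff] at hne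
    omega
  · have h1 : m < n + 2 := by
      have : (m : ℝ) < n + 2 := by linarith
      exact_mod_cast this
    have h2 : n - 2 < m := by
      have : (n : ℝ) - 2 < m := by linarith
      exact_mod_cast this
    rw [Int.cast_inj]
    rw [Int.even_iff, Int.even_iff] at hpar
    rw [Int.even_iff] at hne
    omega

/-- At a first contact with Re s = -1 the line would still have N = n ≤ -4, whereas N > -4 holds
there at every positive height. -/
theorem OnLowLine.re_lt_and_lineNumber_eq {n : ℤ} {s : ℂ} (hn : n ≤ -4) (h : OnLowLine n s) :
    s.re < -1 ∧ lineNumber (1 - s) = n := by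
  obtain ⟨-, x, hx, harc⟩ := h
  obtain ⟨g, hg, g0, rfl, gmem, -⟩ := harc.exists_real
  have hn' : (n : ℝ) ≤ -4 := by exact_mod_cast hn
  have hx1 : x < n + 1 := by
    unfold IsFoot at hx
    split_ifs at hx
    · linarith
    · exact hx.2
  have hg0 : (g 0).re < -1 := by simp [g0]; linarith
  have hre : ContinuousOn (fun τ => (g τ).re) (Set.Icc 0 1) := by fun_prop
  have hlt : ∀ τ ∈ Set.Icc (0 : ℝ) 1, (g τ).re < -1 := by
    by_contra! hcon
    obtain ⟨τ₀, hτ₀, hge⟩ := hcon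
    have hivt : ∀ τ ∈ Set.Icc (0 : ℝ) 1, -1 ≤ (g τ).re → ∃ σ ∈ Set.Icc 0 τ, (g σ).re = -1 :=
      fun τ hτ h => intermediate_value_Icc hτ.1 (hre.mono (Set.Icc_subset_Icc_right hτ.2))
        ⟨hg0.le, h⟩
    obtain ⟨τ₁, hτ₁, h1⟩ := hivt τ₀ hτ₀ hge
    obtain ⟨σ, ⟨hσ, hσ1⟩, hleast⟩ := IsCompact.exists_isLeast
      (s := Set.Icc (0 : ℝ) 1 ∩ {τ | (g τ).re = -1})
      (isCompact_Icc.inter_right (isClosed_eq (by fun_prop) (by fun_prop)))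
      ⟨τ₁, ⟨hτ₁.1, hτ₁.2.trans hτ₀.2⟩, h1⟩
    have hσ0 : 0 < σ := hσ.1.lt_of_ne fun he => by
      rw [Set.mem_ofPred_eq, ← he] at hσ1
      exact hg0.ne hσ1
    have hle : ∀ τ ∈ Set.Ioc 0 σ, (g τ).re ≤ -1 := by
      intro τ hτ
      by_contra! hgt
      obtain ⟨τ', hτ', h2⟩ := hivt τ ⟨hτ.1.le, hτ.2.trans hσ.2⟩ hgt.le
      have h3 := hleast ⟨⟨hτ'.1, hτ'.2.trans (hτ.2.trans hσ.2)⟩, h2⟩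
      have h4 : τ' = τ := le_antisymm hτ'.2 (hτ.2.trans h3)
      rw [h4] at h2
      exact hgt.ne' h2
    have h5 := lineNumber_eq_of_isFoot hn hx hg g0 hσ0
      fun τ hτ => ⟨gmem τ ⟨hτ.1, hτ.2.trans hσ.2⟩, by linarith [hle τ hτ]⟩
    have h6 := neg_four_lt_lineNumber_two (gmem σ ⟨hσ0, hσ.2⟩).1
    have h7 : (⟨2, -(g σ).im⟩ : ℂ) = 1 - g σ := by
      rw [Set.mem_ofPred_eq] at hσ1
      apply Complex.ext <;> simp [hσ1]
      norm_num
    rw [h7, h5] at h6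
    linarith
  exact ⟨hlt 1 ⟨zero_le_one, le_rfl⟩, lineNumber_eq_of_isFoot hn hx hg g0 one_pos
    fun τ hτ => ⟨gmem τ hτ, by linarith [hlt τ (Set.Ioc_subset_Icc_self hτ)]⟩⟩

end ZetaLine
-- Existence and uniqueness of the number of -1 + it
theorem theoremA (t : ℝ) (ht : 5 < t)
    (hline : (riemannZeta (-1 + t * Complex.I)).im = 0 ∨
      (riemannZeta (-1 + t * Complex.I)).re = 0) :
    (∃ n : ℤ, ZetaLine.OnLine n (-1 + t * Complex.I)) ∧
    ∀ n : ℤ, ZetaLine.OnLine n (-1 + t * Complex.I) →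
      ∀ m : ℤ, m ≠ n →
        |2 * t / Real.pi * Real.log (t / (2 * Real.pi)) - 2 * t / Real.pi + 1 / 2 - (n : ℝ)| <
        |2 * t / Real.pi * Real.log (t / (2 * Real.pi)) - 2 * t / Real.pi + 1 / 2 - (m : ℝ)| := by
  have hs : -1 + t * Complex.I = 1 - ⟨2, -t⟩ := by
    rw [ZetaLine.mk_neg_eq]
    push_cast
    ring
  have hs' : 1 - (-1 + t * Complex.I) = ⟨2, -t⟩ := by rw [hs, sub_sub_cancel]
  have hbound := ZetaLine.abs_lineNumber_two_sub_lt ht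
  have hmem : ∃ n, -1 + t * Complex.I ∈ ZetaLine.levelSet n := by
    rcases hline with h | h
    · exact ⟨1, by simp; linarith, by simpa using h⟩
    · exact ⟨0, by simp; linarith, by simpa using h⟩
  obtain ⟨n₀, hn₀⟩ := hmem
  obtain ⟨k, hk, hpar⟩ := ZetaLine.exists_lineNumber_eq_of_mem_levelSet hn₀ (by simp)
  rw [hs'] at hk
  have hk3 : -3 ≤ k := by
    have := ZetaLine.neg_four_lt_lineNumber_two (t := t) (by linarith)
    rw [hk] at this
    have : -4 < k := by exact_mod_cast this
    omega
  have hk3' : (-3 : ℝ) ≤ k := by exact_mod_cast hk3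
  -- For 5 < t ≤ 9 the value N lies strictly between -4 and -3, so it is not an integer.
  have ht9 : 9 ≤ t := by
    by_contra! h
    have := ZetaLine.lineNumber_two_lt_neg_three ht h.le
    linarith
  have hmemk : -1 + t * Complex.I ∈ ZetaLine.levelSet k := by
    rw [hs]
    exact (ZetaLine.one_sub_mem_levelSet_iff (by norm_num) (by simp; linarith) k).2
      ⟨k, hk, Iff.rfl⟩
  refine ⟨⟨k, Or.inr ⟨hk3, hmemk, ?_⟩⟩, fun n hn => ?_⟩
  · obtain ⟨y₀, hy₀, hl₀, hlow⟩ := ZetaLine.exists_onLowLine_border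
    obtain ⟨y, hy, hl, harc⟩ := ZetaLine.exists_arc_border le_rfl (by norm_num) ht9 hk
      fun x hx => (ZetaLine.lineNumber_nine_lt hx.1).le.trans hk3'
    have hlt : y₀ < y := by
      refine ((ZetaLine.strictMonoOn_lineNumber_im (x := 31) (by norm_num)).lt_iff_lt hy₀ hy).1 ?_
      simp only [hl₀, hl]
      linarith
    refine ⟨y₀, y, hlow, hlt, ?_, Or.inr (Or.inl (hs ▸ harc))⟩
    rw [ZetaLine.ncard_crossings hy₀ hlt (k := -4) (by simpa using hl₀), hl, Int.floor_intCast,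
      sub_neg_eq_add]
  -- An integer at distance less than 1/2 is strictly nearer than every other integer.
  · suffices hnk : n = k by
      intro m hm
      rw [hk, ← hnk] at hbound
      have h1 : (1 : ℝ) ≤ |(m : ℝ) - n| := by
        exact_mod_cast Int.one_le_abs (sub_ne_zero.2 hm)
      have h2 := abs_sub_le (m : ℝ) (2 * t / Real.pi * Real.log (t / (2 * Real.pi)) -
        2 * t / Real.pi + 1 / 2) n
      rw [abs_sub_comm (m : ℝ) (2 * t / Real.pi * Real.log (t / (2 * Real.pi)) -
        2 * t / Real.pi + 1 / 2)] at h2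
      linarith
    rcases hn with ⟨hn4, hlow⟩ | ⟨hn3, -, y₀, y, hlow, hlt, hcard, hn⟩
    · have := (hlow.re_lt_and_lineNumber_eq hn4).1
      simp at this
    have hl₀ := (hlow.re_lt_and_lineNumber_eq le_rfl).2
    rw [ZetaLine.border_eq, sub_sub_cancel] at hl₀
    have hpos : 0 < y₀ := hlow.1.1
    -- Below this height N < -4 on the border, so line -4 crosses higher up, where N is strictly
    -- increasing and crossings can be counted.
    have hy₀ : 9 ≤ y₀ := by
      by_contra! h
      have := ZetaLine.lineNumber_thirty_one_lt hpos h.le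
      rw [hl₀] at this
      norm_num at this
    rw [ZetaLine.ncard_crossings hy₀ hlt hl₀, sub_neg_eq_add, add_left_inj] at hcard
    rcases hn with hn | hn | hn
    · have := congrArg Complex.re hn
      norm_num [ZetaLine.border] at this
    · have h := (hn.lineNumber_eq_of_nine_le (by simp) (by simpa using ht9) (hs' ▸ hk) hk3).2.2
      rw [ZetaLine.border_eq, sub_sub_cancel] at h
      rw [← hcard, h, Int.floor_intCast]
    -- An arc leaving the border with N ≥ -3 runs further left and cannot come back to Re s = -1.
    · have hb : ZetaLine.border y ∈ ZetaLine.levelSet n := hn.source_mem (hpos.trans hlt)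
      obtain ⟨l, hl, -⟩ := ZetaLine.exists_lineNumber_eq_of_mem_levelSet hb
        (by simp [ZetaLine.border])
      have hl3 : -3 ≤ l := by
        have := ZetaLine.strictMonoOn_lineNumber_im (x := 31) (by norm_num) hy₀
          (hy₀.trans hlt.le) hlt
        rw [ZetaLine.border_eq, sub_sub_cancel] at hl
        simp only [hl₀, hl] at this
        have : -4 < l := by exact_mod_cast this
        omega
      have h := (hn.lineNumber_eq_of_nine_le (by norm_num [ZetaLine.border])
        (hy₀.trans hlt.le) hl hl3).1
      norm_num [ZetaLine.border] at h
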